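/- Let $N\ge 0$ be an integer, $\sigma\in(0,2)$ and $m>\max\{1,\sigma\}$. Write $B_\delta$ for the open ball of radius $\delta$ centred at $0$ in $\mathbb R^N$, $B=B_1$; functions on $\mathbb T^N=\mathbb R^N/\mathbb Z^N$ are identified with $\mathbb Z^N$-periodic functions on $\mathbb R^N$. A modulus is a nondecreasing $\zeta:[0,\infty)\to[0,\infty)$ with $\zeta(0)=0=\lim_{s\to0^+}\zeta(s)$ (no growth restriction at infinity). Let $\nu$ be a positive Borel measure on $\mathbb R^N$, let $j:\mathbb R^N\times\mathbb R^N\to\mathbb R^N$ be such that $j(\cdot,z)$ is continuous and $\mathbb Z^N$-periodic for every $z$ and $j(x,\cdot)$ is Borel for every $x$, and let $H:\mathbb R^N\times\mathbb R^N\to\mathbb R$ be $\mathbb Z^N$-periodic in its first variable. Assume: (M1) for all $\alpha\in[0,2]$ there is $C>0$ with $\int_{B_\delta^c}\min\{1,|z|^\alpha\}\,\nu(dz)\le C\,h_{\alpha,\sigma}(\delta)$ for all $\delta>0$, where $h_{\alpha,\sigma}(\delta)=\delta^{\alpha-\sigma}$ if $\alpha<\sigma$, $|\ln\delta|+1$ if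 $\alpha=\sigma$, and $1$ if $\alpha>\sigma$; (M2) for all $\alpha\in(\sigma,2]$ there is $C>0$ with $\int_{B_\delta}|z|^\alpha\,\nu(dz)\le C\delta^{\alpha-\sigma}$ for all $\delta\in(0,1)$; (J1) there is $C>0$ with $|j(x,z)|\le C|z|$ for all $x,z$; (J2) for each $\delta>0$ there is $C_\delta>0$ such that for all $x,y$: $\int_{B_\delta}|j(x,z)-j(y,z)|^2\nu(dz)\le C_\delta|x-y|^2$ and $\int_{B\setminus B_\delta}|j(x,z)-j(y,z)|\,\nu(dz)\le C_\delta|x-y|$; (covering property) with $X_0(x)=\{x\}$ and $X_{n+1}(x)=\bigcup_{\xi\in X_n(x)}\{\xi+j(\xi,z):z\in\operatorname{supp}\nu\}$, the image of $\bigcup_{n}X_n(x)$ in $\mathbb T^N$ is dense for every $x$; (H0) $\sup_x|H(x,0)|<\infty$; (H1) there are moduli $\zeta_1,\zeta_2$ such that for all $x,y,p,q\in\mathbb R^N$ $$H(y,p+q)-H(x,p)\le\zeta_1(|x-y|)(1+|p|^m)+\zeta_2(|q|)(1+|p|^{m-1});$$ (H2) there are $A,b_0>0$ such that for all $\mu\in(0,1)$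 and $x,p\in\mathbb R^N$: $H(x,p)-\mu H(x,\mu^{-1}p)\le(1-\mu)\big(b_0(1-m)|p|^m+A\big)$. For $c\in\mathbb R$ consider the ergodic problem $$-I^j_x(u,x)+H(x,Du)=-c\quad\text{in }\mathbb T^N,\qquad(\mathrm E_c)$$ $$I^j_x(u,x)=\int_{\mathbb R^N}\big[u(x+j(x,z))-u(x)-\mathbf 1_B(z)\langle Du(x),j(x,z)\rangle\big]\nu(dz),$$ understood in the viscosity sense: $u$ is $\mathbb Z^N$-periodic and upper (resp. lower) semicontinuous, and whenever $\varphi\in C^2(\mathbb R^N)$, $u-\varphi$ has a maximum (resp. minimum) over a ball $B_r(x)$ at $x$, and $\delta>0$ is such that $x+j(x,z)\in B_r(x)$ for $|z|<\delta$, then the equation holds at $x$ with $\le$ (resp. $\ge$), where $Du(x)$ is replaced by $D\varphi(x)$, and $u$ is replaced by $\varphi$ in the part of the integral over $|z|<\delta$; a solution satisfies both requirements. Then: (i) There is a unique constant $c\in\mathbb R$ for which $(\mathrm E_c)$ has a solution $w\in C^{(m-\sigma)/m}(\mathbb T^N)$. (ii) Suppose in addition that $j(x,\cdot)$ is continuous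 on $\operatorname{supp}\nu$ for every $x$ and that the modulus $\zeta_2$ in (H1) satisfies $\zeta_2(s)\,s^{(1-m)/m}\to0$ as $s\to0^+$ (for instance $\zeta_2(s)=Cs$ for small $s$). Then $w$ is the unique continuous solution of $(\mathrm E_c)$ up to an additive constant. -/

import Mathlib

open Set Filter Topology MeasureTheory

noncomputable section

/-- `ℝ^N` with its Euclidean norm. -/
abbrev Eucl (N : ℕ) : Type := EuclideanSpace ℝ (Fin N)

/-- The point of the lattice `ℤ^N ⊆ ℝ^N` with coordinates `k`. -/
def latticePoint {N : ℕ} (k : Fin N → ℤ) : Eucl N :=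
  WithLp.toLp 2 (fun i => (k i : ℝ))

/-- `ℤ^N`-periodicity; functions on the torus `𝕋^N` are periodic functions on `ℝ^N`. -/
def ZPeriodic {N : ℕ} {β : Type*} (f : Eucl N → β) : Prop :=
  ∀ (k : Fin N → ℤ) (x : Eucl N), f (x + latticePoint k) = f x

/-! ### Assumptions on the Lévy measure -/

/-- The function `h_{α,σ}(δ)`. -/
def levyRate (α σ δ : ℝ) : ℝ :=
  if α < σ then δ ^ (α - σ) else if α = σ then |Real.log δ| + 1 else 1

/-- Condition (M1) for a single measure `ν`. -/
def CondM1 {N : ℕ} (σ : ℝ) (ν : Measure (Eucl N)) : Prop :=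
  ∀ α : ℝ, 0 ≤ α → α ≤ 2 → ∃ C : ℝ, 0 < C ∧ ∀ δ : ℝ, 0 < δ →
    ∫⁻ z in (Metric.ball (0 : Eucl N) δ)ᶜ, ENNReal.ofReal (min 1 (‖z‖ ^ α)) ∂ν
      ≤ ENNReal.ofReal (C * levyRate α σ δ)

/-- Condition (M2) for a single measure `ν`. -/
def CondM2 {N : ℕ} (σ : ℝ) (ν : Measure (Eucl N)) : Prop :=
  ∀ α : ℝ, σ < α → α ≤ 2 → ∃ C : ℝ, 0 < C ∧ ∀ δ : ℝ, 0 < δ → δ < 1 →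
    ∫⁻ z in Metric.ball (0 : Eucl N) δ, ENNReal.ofReal (‖z‖ ^ α) ∂ν
      ≤ ENNReal.ofReal (C * δ ^ (α - σ))

/-! ### Assumptions on the jump function -/

/-- Condition (J1). -/
def CondJ1 {N : ℕ} (j : Eucl N → Eucl N → Eucl N) : Prop :=
  ∃ C : ℝ, 0 < C ∧ ∀ x z : Eucl N, ‖j x z‖ ≤ C * ‖z‖

/-- Condition (J2). -/
def CondJ2 {N : ℕ} (ν : Measure (Eucl N)) (j : Eucl N → Eucl N → Eucl N) : Prop :=
  ∀ δ : ℝ, 0 < δ → ∃ C : ℝ, 0 < C ∧ ∀ x y : Eucl N,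
    (∫⁻ z in Metric.ball (0 : Eucl N) δ, ENNReal.ofReal (‖j x z - j y z‖ ^ 2) ∂ν
      ≤ ENNReal.ofReal (C * ‖x - y‖ ^ 2)) ∧
    (∫⁻ z in Metric.ball (0 : Eucl N) 1 \ Metric.ball (0 : Eucl N) δ,
        ENNReal.ofReal ‖j x z - j y z‖ ∂ν
      ≤ ENNReal.ofReal (C * ‖x - y‖))

/-- The sets `X_n(x)` of points reachable from `x` in `n` jumps:
`X_0(x) = {x}` and `X_{n+1}(x) = ⋃_{ξ ∈ X_n(x)} (ξ + j(ξ, supp ν))`. -/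
def reachable {N : ℕ} (ν : Measure (Eucl N)) (j : Eucl N → Eucl N → Eucl N) (x : Eucl N) :
    ℕ → Set (Eucl N)
  | 0 => {x}
  | n + 1 => ⋃ ξ ∈ reachable ν j x n, (fun z => ξ + j ξ z) '' ν.support

/-- Iterative covering property: for every `x`, the image of `⋃_n X_n(x)` in the torus
`ℝ^N / ℤ^N` is dense. It is written on `ℝ^N`, with the preimage of that image. -/
def Covering {N : ℕ} (ν : Measure (Eucl N)) (j : Eucl N → Eucl N → Eucl N) : Prop :=
  ∀ x : Eucl N,
    closure {y : Eucl N | ∃ k : Fin N → ℤ, y + latticePoint k ∈ ⋃ n, reachable ν j x n} = univ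

/-! ### Assumptions on the Hamiltonian -/

/-- Modulus of continuity on `[0, ∞)`; no growth restriction at infinity. -/
structure IsModulus (ζ : ℝ → ℝ) : Prop where
  monotoneOn : MonotoneOn ζ (Ici 0)
  map_zero : ζ 0 = 0
  tendsto_zero : Tendsto ζ (𝓝[>] 0) (𝓝 0)

/-- Condition (H0). -/
def CondH0 {N : ℕ} (H : Eucl N → Eucl N → ℝ) : Prop :=
  ∃ H₀ : ℝ, 0 < H₀ ∧ ∀ x : Eucl N, |H x 0| ≤ H₀

/-- Condition (H1) with exponent `m` and moduli `ζ₁`, `ζ₂`. -/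
def CondH1 {N : ℕ} (m : ℝ) (ζ₁ ζ₂ : ℝ → ℝ) (H : Eucl N → Eucl N → ℝ) : Prop :=
  ∀ x y p q : Eucl N,
    H y (p + q) - H x p
      ≤ ζ₁ ‖x - y‖ * (1 + ‖p‖ ^ m) + ζ₂ ‖q‖ * (1 + ‖p‖ ^ (m - 1))

/-- Condition (H2) with exponent `m`. -/
def CondH2 {N : ℕ} (m : ℝ) (H : Eucl N → Eucl N → ℝ) : Prop :=
  ∃ A b₀ : ℝ, 0 < A ∧ 0 < b₀ ∧ ∀ μ : ℝ, 0 < μ → μ < 1 → ∀ x p : Eucl N,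
    H x p - μ * H x (μ⁻¹ • p) ≤ (1 - μ) * (b₀ * (1 - m) * ‖p‖ ^ m + A)

/-! ### The operator and viscosity solutions -/

/-- `I_x^j[A](u, x, p) = ∫_A [u(x + j(x,z)) - u(x) - 1_B(z) ⟨p, j(x,z)⟩] ν(dz)`,
where `B` is the open unit ball. -/
def levyIto {N : ℕ} (ν : Measure (Eucl N)) (j : Eucl N → Eucl N → Eucl N) (A : Set (Eucl N))
    (u : Eucl N → ℝ) (x p : Eucl N) : ℝ :=
  ∫ z in A, (u (x + j x z) - u x
    - (Metric.ball (0 : Eucl N) 1).indicator (fun z => inner ℝ p (j x z)) z) ∂ν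

/-- The expression `-I_x^j(u, x) + H(x, Du(x))` evaluated with the test function `φ` on the
small jumps `|z| < δ` and in the gradient slots, and with `u` on the jumps `|z| ≥ δ`. -/
def testedOperator {N : ℕ} (ν : Measure (Eucl N)) (j : Eucl N → Eucl N → Eucl N)
    (H : Eucl N → Eucl N → ℝ) (δ : ℝ) (u φ : Eucl N → ℝ) (x : Eucl N) : ℝ :=
  - levyIto ν j (Metric.ball 0 δ) φ x (gradient φ x)
    - levyIto ν j (Metric.ball 0 δ)ᶜ u x (gradient φ x)
    + H x (gradient φ x)

/-- Viscosity subsolution of `-I_x^j(u, x) + H(x, Du) = a` in `ℝ^N`: whenever `u - φ`, with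
`φ` of class `C²`, is maximal at `x` over a ball `B_r(x)` that contains all the jumps from
`x` with `|z| < δ`, the equation holds at `x` with `≤`. -/
def IsViscSubsolution {N : ℕ} (ν : Measure (Eucl N)) (j : Eucl N → Eucl N → Eucl N)
    (H : Eucl N → Eucl N → ℝ) (a : ℝ) (u : Eucl N → ℝ) : Prop :=
  UpperSemicontinuous u ∧
  ∀ (φ : Eucl N → ℝ) (x : Eucl N) (r δ : ℝ), ContDiff ℝ 2 φ → 0 < r → 0 < δ →
    (∀ z ∈ Metric.ball (0 : Eucl N) δ, x + j x z ∈ Metric.ball x r) →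
    (∀ y ∈ Metric.ball x r, u y - φ y ≤ u x - φ x) →
    testedOperator ν j H δ u φ x ≤ a

/-- Viscosity supersolution of `-I_x^j(u, x) + H(x, Du) = a` in `ℝ^N`. -/
def IsViscSupersolution {N : ℕ} (ν : Measure (Eucl N)) (j : Eucl N → Eucl N → Eucl N)
    (H : Eucl N → Eucl N → ℝ) (a : ℝ) (u : Eucl N → ℝ) : Prop :=
  LowerSemicontinuous u ∧
  ∀ (φ : Eucl N → ℝ) (x : Eucl N) (r δ : ℝ), ContDiff ℝ 2 φ → 0 < r → 0 < δ →
    (∀ z ∈ Metric.ball (0 : Eucl N) δ, x + j x z ∈ Metric.ball x r) →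
    (∀ y ∈ Metric.ball x r, u x - φ x ≤ u y - φ y) →
    a ≤ testedOperator ν j H δ u φ x

/-- Viscosity solution of the ergodic problem `-I_x^j(u, x) + H(x, Du) = -c` in `𝕋^N`. -/
def IsErgodicSolution {N : ℕ} (ν : Measure (Eucl N)) (j : Eucl N → Eucl N → Eucl N)
    (H : Eucl N → Eucl N → ℝ) (c : ℝ) (u : Eucl N → ℝ) : Prop :=
  ZPeriodic u ∧ IsViscSubsolution ν j H (-c) u ∧ IsViscSupersolution ν j H (-c) u

/-- Global Hölder continuity with exponent `γ`; together with periodicity this is membership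
in `C^γ(𝕋^N)`. -/
def IsHolder {N : ℕ} (γ : ℝ) (u : Eucl N → ℝ) : Prop :=
  ∃ C : ℝ, 0 ≤ C ∧ ∀ x y : Eucl N, |u x - u y| ≤ C * ‖x - y‖ ^ γ

end

/-! Sub- and supersolutions are recast as inequalities tested with global paraboloids (`JetSub`,
`JetSuper`). When a paraboloid of opening K touches, the jumps with |z| < δ cost at most
K·C·δ^(2-σ). Only the integral over |z| ≥ δ remains, and it is continuous in the point and the
gradient. For bounded continuous functions this agrees with the viscosity definition.

Existence rests on a regularity estimate for subsolutions alone. Conditions (H0)-(H2) make H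
coercive like |p|^m (`exists_coercive`). If a cone L|z - x₀|^γ with γ = (m-σ)/m touches a
subsolution from above at distance d from its vertex, then |p|^m is of order L^m d^(-σ). The
nonlocal terms carry no worse power of d and are only linear in L and in the oscillation, so L is
bounded because m > 1 (`holder_constant_bound`). Hence bounded families of subsolutions are
equi-Hölder, and periodic ones have an oscillation bounded independently of the discount. Perron's
method can therefore be run among continuous functions, without a comparison principle
(`exists_discounted_solution`). Letting the discount vanish gives a pair (c, w)
(`exists_ergodic_pair`).

Uniqueness compares μw with v for μ < 1. Condition (H2) yields a term of order -(1-μ)|p|^m, which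
absorbs the growing errors of (H1). Doubling of variables then works uniformly in the possibly
unbounded common gradient (`exists_hamiltonian_comparison`, `le_of_doubling`). At a maximum of μw -
v, letting μ → 1 orders the constants (`ergodic_constant_le`). For two solutions with the same c, a
localizing perturbation of size 1-μ is added, and the condition on ζ₂ is what makes its error
vanish. It follows that arbitrarily near any maximum of w - v there is a maximum from which almost
every jump lands on a maximum (`exists_max_ae_jump`). By continuity the jumps along the support
preserve maxima (`max_of_jump`), and the covering property spreads the maximal value over the torus.
-/

/-! ### Integral bounds for the Lévy–Itô operator -/

/-- Quantitative consequences of (M1), (M2) and (J1), together with the regularity of the jumps. -/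
structure JumpBounds {N : ℕ} (σ : ℝ) (ν : Measure (Eucl N)) (j : Eucl N → Eucl N → Eucl N)
    (C : ℝ) : Prop where
  pos : 0 < C
  sigma_pos : 0 < σ
  sigma_lt : σ < 2
  meas : ∀ x, Measurable (j x)
  cont : ∀ z, Continuous fun x => j x z
  norm_le : ∀ x z, ‖j x z‖ ≤ C * ‖z‖
  small : ∀ δ, 0 < δ → δ < 1 → ∀ x, ∫⁻ z in Metric.ball (0 : Eucl N) δ,
    ENNReal.ofReal (‖j x z‖ ^ 2) ∂ν ≤ ENNReal.ofReal (C * δ ^ (2 - σ))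
  tail : ∀ δ, 0 < δ → ν (Metric.ball (0 : Eucl N) δ)ᶜ ≤ ENNReal.ofReal (C * δ ^ (-σ))

/-- The exponent 0 in (M1) turns the integrand into 1 and gives the tail mass. The exponent 2 in
(M2), combined with (J1), gives the second moment of the small jumps. -/
theorem exists_jumpBounds {N : ℕ} {σ : ℝ} {ν : Measure (Eucl N)}
    {j : Eucl N → Eucl N → Eucl N} (hσ0 : 0 < σ) (hσ2 : σ < 2)
    (hM1 : CondM1 σ ν) (hM2 : CondM2 σ ν) (hj_meas : ∀ x : Eucl N, Measurable (j x))
    (hj_cont : ∀ z : Eucl N, Continuous (fun x => j x z)) (hJ1 : CondJ1 j) :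
    ∃ C, JumpBounds σ ν j C := by
  obtain ⟨C₁, hC₁, h₁⟩ := hM1 0 le_rfl (by norm_num)
  obtain ⟨C₂, hC₂, h₂⟩ := hM2 2 hσ2 le_rfl
  obtain ⟨C₃, hC₃, h₃⟩ := hJ1
  refine ⟨C₁ + C₃ + C₃ ^ 2 * C₂, ⟨by positivity, hσ0, hσ2, hj_meas, hj_cont, ?_, ?_, ?_⟩⟩
  · intro x z
    refine (h₃ x z).trans (mul_le_mul_of_nonneg_right ?_ (norm_nonneg z))
    nlinarith [mul_pos (pow_pos hC₃ 2) hC₂]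
  · intro δ hδ hδ1 x
    calc ∫⁻ z in Metric.ball (0 : Eucl N) δ, ENNReal.ofReal (‖j x z‖ ^ 2) ∂ν
        ≤ ∫⁻ z in Metric.ball (0 : Eucl N) δ,
            ENNReal.ofReal (C₃ ^ 2) * ENNReal.ofReal (‖z‖ ^ (2 : ℝ)) ∂ν := by
          refine lintegral_mono fun z => ?_
          rw [← ENNReal.ofReal_mul (by positivity)]
          refine ENNReal.ofReal_le_ofReal ?_
          rw [Real.rpow_two, ← mul_pow]
          exact pow_le_pow_left₀ (norm_nonneg _) (h₃ x z) 2
      _ = ENNReal.ofReal (C₃ ^ 2) * ∫⁻ z in Metric.ball (0 : Eucl N) δ,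
            ENNReal.ofReal (‖z‖ ^ (2 : ℝ)) ∂ν := lintegral_const_mul' _ _ ENNReal.ofReal_ne_top
      _ ≤ ENNReal.ofReal (C₃ ^ 2) * ENNReal.ofReal (C₂ * δ ^ (2 - σ)) := by
          gcongr; exact h₂ δ hδ hδ1
      _ ≤ _ := by
          rw [← ENNReal.ofReal_mul (by positivity), ← mul_assoc]
          refine ENNReal.ofReal_le_ofReal (mul_le_mul_of_nonneg_right ?_ (by positivity))
          linarith
  · intro δ hδ
    have h := h₁ δ hδ
    simp only [Real.rpow_zero, min_self, ENNReal.ofReal_one, lintegral_one,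
      Measure.restrict_apply_univ, levyRate, if_pos hσ0, zero_sub] at h
    refine h.trans (ENNReal.ofReal_le_ofReal (mul_le_mul_of_nonneg_right ?_ (by positivity)))
    nlinarith [mul_pos (pow_pos hC₃ 2) hC₂]

section Increment

variable {N : ℕ} {σ C : ℝ} {ν : Measure (Eucl N)} {j : Eucl N → Eucl N → Eucl N}

/-- The compensated increment integrated by `levyIto`. -/
noncomputable def increment (j : Eucl N → Eucl N → Eucl N) (u : Eucl N → ℝ) (x p z : Eucl N) : ℝ :=
  u (x + j x z) - u x
    - (Metric.ball (0 : Eucl N) 1).indicator (fun z => inner ℝ p (j x z)) z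

theorem levyIto_eq (A : Set (Eucl N)) (u : Eucl N → ℝ) (x p : Eucl N) :
    levyIto ν j A u x p = ∫ z in A, increment j u x p z ∂ν := rfl

theorem increment_of_norm_lt {u : Eucl N → ℝ} {x p z : Eucl N} (hz : ‖z‖ < 1) :
    increment j u x p z = u (x + j x z) - u x - inner ℝ p (j x z) := by
  simp [increment, Set.indicator, hz]

theorem increment_of_le_norm {u : Eucl N → ℝ} {x p z : Eucl N} (hz : 1 ≤ ‖z‖) :
    increment j u x p z = u (x + j x z) - u x := by
  simp [increment, Set.indicator, hz]

theorem increment_neg (u : Eucl N → ℝ) (x p z : Eucl N) :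
    increment j (fun y => -u y) x (-p) z = -increment j u x p z := by
  by_cases hz : ‖z‖ < 1
  · rw [increment_of_norm_lt hz, increment_of_norm_lt hz, inner_neg_left]; ring
  · rw [increment_of_le_norm (not_lt.1 hz), increment_of_le_norm (not_lt.1 hz)]; ring

theorem levyIto_neg (A : Set (Eucl N)) (u : Eucl N → ℝ) (x p : Eucl N) :
    levyIto ν j A (fun y => -u y) x (-p) = -levyIto ν j A u x p := by
  simp only [levyIto_eq, increment_neg, integral_neg]

theorem levyIto_smul (A : Set (Eucl N)) (u : Eucl N → ℝ) (x p : Eucl N) (μ : ℝ) :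
    levyIto ν j A (fun y => μ * u y) x (μ • p) = μ * levyIto ν j A u x p := by
  rw [levyIto_eq, levyIto_eq, ← integral_const_mul]
  congr 1; ext z
  by_cases hz : ‖z‖ < 1
  · rw [increment_of_norm_lt hz, increment_of_norm_lt hz, real_inner_smul_left]; ring
  · rw [increment_of_le_norm (not_lt.1 hz), increment_of_le_norm (not_lt.1 hz)]; ring

theorem measurable_increment (hB : JumpBounds σ ν j C) {u : Eucl N → ℝ} (hu : Continuous u)
    (x p : Eucl N) : Measurable (increment j u x p) := by
  have hj := hB.meas x
  unfold increment
  refine ((hu.measurable.comp (hj.const_add x)).sub_const _).sub ?_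
  exact (measurable_const.inner hj).indicator measurableSet_ball

theorem abs_increment_le (hB : JumpBounds σ ν j C) {u : Eucl N → ℝ} {M : ℝ}
    (hM : ∀ x, |u x| ≤ M) (x p z : Eucl N) : |increment j u x p z| ≤ 2 * M + ‖p‖ * C := by
  have h1 := abs_le.1 (hM x)
  have h2 := abs_le.1 (hM (x + j x z))
  have hp : 0 ≤ ‖p‖ * C := mul_nonneg (norm_nonneg _) hB.pos.le
  by_cases hz : ‖z‖ < 1
  · rw [increment_of_norm_lt hz]
    have h3 : |inner ℝ p (j x z)| ≤ ‖p‖ * C :=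
      (abs_real_inner_le_norm _ _).trans (mul_le_mul_of_nonneg_left
        ((hB.norm_le x z).trans (by nlinarith [hB.pos])) (norm_nonneg _))
    have h3 := abs_le.1 h3
    rw [abs_le]; constructor <;> linarith
  · rw [increment_of_le_norm (not_lt.1 hz), abs_le]; constructor <;> linarith

theorem JumpBounds.tail_ne_top (hB : JumpBounds σ ν j C) {δ : ℝ} (hδ : 0 < δ) :
    ν (Metric.ball (0 : Eucl N) δ)ᶜ ≠ ⊤ :=
  ne_top_of_le_ne_top ENNReal.ofReal_ne_top (hB.tail δ hδ)

theorem JumpBounds.tail_real (hB : JumpBounds σ ν j C) {δ : ℝ} (hδ : 0 < δ) :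
    ν.real (Metric.ball (0 : Eucl N) δ)ᶜ ≤ C * δ ^ (-σ) :=
  ENNReal.toReal_le_of_le_ofReal (mul_nonneg hB.pos.le (by positivity)) (hB.tail δ hδ)

theorem integrableOn_increment (hB : JumpBounds σ ν j C) {u : Eucl N → ℝ} (hu : Continuous u)
    {M : ℝ} (hM : ∀ x, |u x| ≤ M) {δ : ℝ} (hδ : 0 < δ) (x p : Eucl N) :
    IntegrableOn (increment j u x p) (Metric.ball (0 : Eucl N) δ)ᶜ ν :=
  Measure.integrableOn_of_bounded (hB.tail_ne_top hδ)
    (measurable_increment hB hu x p).aestronglyMeasurable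
    (ae_of_all _ fun z => abs_increment_le hB hM x p z)

/-- Continuity of the operator on large jumps with respect to the point and the gradient. -/
theorem continuous_levyIto (hB : JumpBounds σ ν j C) {u : Eucl N → ℝ} (hu : Continuous u)
    {M : ℝ} (hM : ∀ x, |u x| ≤ M) {δ : ℝ} (hδ : 0 < δ) :
    Continuous fun q : Eucl N × Eucl N =>
      levyIto ν j (Metric.ball (0 : Eucl N) δ)ᶜ u q.1 q.2 := by
  rw [continuous_iff_continuousAt]
  intro q₀
  have hfin : IsFiniteMeasure (ν.restrict (Metric.ball (0 : Eucl N) δ)ᶜ) :=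
    ⟨by rw [Measure.restrict_apply_univ]; exact (hB.tail_ne_top hδ).lt_top⟩
  simp only [levyIto_eq]
  refine continuousAt_of_dominated (bound := fun _ => 2 * M + (‖q₀.2‖ + 1) * C) ?_ ?_
    (integrable_const _) ?_
  · exact Eventually.of_forall fun q => (measurable_increment hB hu _ _).aestronglyMeasurable
  · have : ∀ᶠ q : Eucl N × Eucl N in 𝓝 q₀, ‖q.2‖ < ‖q₀.2‖ + 1 :=
      (continuous_snd.norm.continuousAt (x := q₀)).eventually (gt_mem_nhds (by linarith))
    filter_upwards [this] with q hq
    refine ae_of_all _ fun z => (abs_increment_le hB hM _ _ z).trans ?_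
    have := mul_le_mul_of_nonneg_right hq.le hB.pos.le
    linarith
  · refine ae_of_all _ fun z => Continuous.continuousAt ?_
    have hj : Continuous fun q : Eucl N × Eucl N => j q.1 z := (hB.cont z).comp continuous_fst
    have hd : Continuous fun q : Eucl N × Eucl N => u (q.1 + j q.1 z) - u q.1 :=
      (hu.comp (continuous_fst.add hj)).sub (hu.comp continuous_fst)
    by_cases hz : ‖z‖ < 1
    · simp only [increment_of_norm_lt hz]
      exact hd.sub (continuous_snd.inner hj)
    · simp only [increment_of_le_norm (not_lt.1 hz)]
      exact hd

/-- The slack `v x + c - u x` does not depend on z, so it is simply weighted by the finite tail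
mass. It vanishes when `v + c` touches `u` at `x`. -/
theorem levyIto_mono (hB : JumpBounds σ ν j C) {u v : Eucl N → ℝ} (hu : Continuous u)
    (hv : Continuous v) {M M' c : ℝ} (hM : ∀ x, |u x| ≤ M) (hM' : ∀ x, |v x| ≤ M')
    (huv : ∀ y, u y ≤ v y + c) {δ : ℝ} (hδ : 0 < δ) (x p : Eucl N) :
    levyIto ν j (Metric.ball (0 : Eucl N) δ)ᶜ u x p
      ≤ levyIto ν j (Metric.ball (0 : Eucl N) δ)ᶜ v x p
        + (v x + c - u x) * ν.real (Metric.ball (0 : Eucl N) δ)ᶜ := by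
  have hI := integrableOn_increment hB hv hM' hδ x p
  have hc : IntegrableOn (fun _ => v x + c - u x) (Metric.ball (0 : Eucl N) δ)ᶜ ν :=
    integrableOn_const (hB.tail_ne_top hδ)
  have : (v x + c - u x) * ν.real (Metric.ball (0 : Eucl N) δ)ᶜ
      = ∫ _ in (Metric.ball (0 : Eucl N) δ)ᶜ, (v x + c - u x) ∂ν := by
    rw [setIntegral_const, smul_eq_mul, mul_comm]
  rw [this, levyIto_eq, levyIto_eq, ← integral_add hI hc]
  refine setIntegral_mono (integrableOn_increment hB hu hM hδ x p) (hI.add hc) fun z => ?_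
  have := huv (x + j x z)
  simp only [increment]
  linarith

theorem compl_ball_eq_union {δ' δ : ℝ} (h : δ' ≤ δ) :
    (Metric.ball (0 : Eucl N) δ')ᶜ
      = (Metric.ball (0 : Eucl N) δ \ Metric.ball (0 : Eucl N) δ') ∪ (Metric.ball 0 δ)ᶜ := by
  ext z; simp only [mem_compl_iff, mem_union, Set.mem_sdiff, Metric.mem_ball, dist_zero_right, not_lt]
  constructor
  · intro hz; by_cases h2 : ‖z‖ < δ
    · exact Or.inl ⟨h2, hz⟩
    · exact Or.inr (not_lt.1 h2)
  · rintro (⟨_, h2⟩ | h2)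
    · exact h2
    · exact h.trans h2

theorem levyIto_split (hB : JumpBounds σ ν j C) {u : Eucl N → ℝ} (hu : Continuous u)
    {M : ℝ} (hM : ∀ x, |u x| ≤ M) {δ' δ : ℝ} (hδ' : 0 < δ') (h : δ' ≤ δ) (x p : Eucl N) :
    levyIto ν j (Metric.ball (0 : Eucl N) δ')ᶜ u x p
      = levyIto ν j (Metric.ball (0 : Eucl N) δ \ Metric.ball (0 : Eucl N) δ') u x p
        + levyIto ν j (Metric.ball (0 : Eucl N) δ)ᶜ u x p := by
  have hI := integrableOn_increment hB hu hM hδ' x p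
  simp only [levyIto_eq]
  rw [compl_ball_eq_union h] at hI ⊢
  refine setIntegral_union ?_ measurableSet_ball.compl (hI.mono_set subset_union_left)
    (hI.mono_set subset_union_right)
  exact disjoint_compl_right.mono_left sdiff_subset

theorem integrableOn_and_setIntegral_le {A : Set (Eucl N)} {g : Eucl N → ℝ} (hg : Measurable g)
    (h0 : ∀ z, 0 ≤ g z) {c : ℝ} (hc : 0 ≤ c)
    (h : ∫⁻ z in A, ENNReal.ofReal (g z) ∂ν ≤ ENNReal.ofReal c) :
    IntegrableOn g A ν ∧ ∫ z in A, g z ∂ν ≤ c := by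
  refine ⟨⟨hg.aestronglyMeasurable, ?_⟩, ?_⟩
  · rw [hasFiniteIntegral_iff_ofReal (ae_of_all _ h0)]
    exact h.trans_lt ENNReal.ofReal_lt_top
  · rw [integral_eq_lintegral_of_nonneg_ae (ae_of_all _ h0) hg.aestronglyMeasurable]
    exact ENNReal.toReal_le_of_le_ofReal hc h

/-- The square of the jumps on a set of small jumps. -/
theorem setIntegral_sq_le (hB : JumpBounds σ ν j C) {δ : ℝ} (hδ : 0 < δ) (hδ1 : δ < 1)
    {A : Set (Eucl N)} (hA : A ⊆ Metric.ball 0 δ) (x : Eucl N) :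
    IntegrableOn (fun z => ‖j x z‖ ^ 2) A ν ∧
      ∫ z in A, ‖j x z‖ ^ 2 ∂ν ≤ C * δ ^ (2 - σ) := by
  exact integrableOn_and_setIntegral_le ((hB.meas x).norm.pow_const 2) (fun z => by positivity)
    (mul_nonneg hB.pos.le (by positivity)) ((lintegral_mono_set hA).trans (hB.small δ hδ hδ1 x))

end Increment

/-! ### Viscosity inequalities in terms of global quadratic test functions -/

section Jets

variable {N : ℕ}

theorem norm_sub_sq_expand (x x₀ y : Eucl N) :
    ‖y - x₀‖ ^ 2 = ‖x - x₀‖ ^ 2 + 2 * inner ℝ (x - x₀) (y - x) + ‖y - x‖ ^ 2 := by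
  rw [← norm_add_sq_real]; congr 2; abel

/-- The paraboloid with gradient `p` and opening `K` touches `u` from above at `x`. -/
def TouchAbove (u : Eucl N → ℝ) (x p : Eucl N) (K : ℝ) : Prop :=
  ∀ y, u y ≤ u x + inner ℝ p (y - x) + K * ‖y - x‖ ^ 2

/-- The paraboloid with gradient `p` and opening `-K` touches `u` from below at `x`. -/
def TouchBelow (u : Eucl N → ℝ) (x p : Eucl N) (K : ℝ) : Prop :=
  ∀ y, u x + inner ℝ p (y - x) - K * ‖y - x‖ ^ 2 ≤ u y

/-- Subsolution inequality with right-hand side `g`, tested with global paraboloids; the constants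
`σ`, `C` are those of `JumpBounds`. -/
def JetSub (σ C : ℝ) (ν : Measure (Eucl N)) (j : Eucl N → Eucl N → Eucl N)
    (H : Eucl N → Eucl N → ℝ) (g u : Eucl N → ℝ) : Prop :=
  ∀ (x p : Eucl N) (K : ℝ), 0 ≤ K → TouchAbove u x p K → ∀ δ : ℝ, 0 < δ → δ < 1 →
    H x p - levyIto ν j (Metric.ball 0 δ)ᶜ u x p ≤ g x + K * (C * δ ^ (2 - σ))

/-- Supersolution inequality with right-hand side `g`, tested with global paraboloids. -/
def JetSuper (σ C : ℝ) (ν : Measure (Eucl N)) (j : Eucl N → Eucl N → Eucl N)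
    (H : Eucl N → Eucl N → ℝ) (g u : Eucl N → ℝ) : Prop :=
  ∀ (x p : Eucl N) (K : ℝ), 0 ≤ K → TouchBelow u x p K → ∀ δ : ℝ, 0 < δ → δ < 1 →
    g x - K * (C * δ ^ (2 - σ)) ≤ H x p - levyIto ν j (Metric.ball 0 δ)ᶜ u x p

/-- The Hamiltonian satisfied by `-u`. -/
def dualHam (H : Eucl N → Eucl N → ℝ) : Eucl N → Eucl N → ℝ := fun x p => -H x (-p)

theorem touchBelow_iff_neg {u : Eucl N → ℝ} {x p : Eucl N} {K : ℝ} :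
    TouchBelow u x p K ↔ TouchAbove (fun y => -u y) x (-p) K := by
  refine forall_congr' fun y => ?_
  rw [inner_neg_left]
  constructor <;> intro h <;> linarith

variable {σ C : ℝ} {ν : Measure (Eucl N)} {j : Eucl N → Eucl N → Eucl N}
  {H : Eucl N → Eucl N → ℝ}

/-- Supersolutions are reduced to subsolutions by a change of sign. Only results that need at most
continuity of the Hamiltonian are transferred in this way, since `dualHam` does not inherit
coercivity. -/
theorem jetSuper_iff_neg {g u : Eucl N → ℝ} :
    JetSuper σ C ν j H g u ↔
      JetSub σ C ν j (dualHam H) (fun x => -g x) (fun x => -u x) := by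
  constructor
  · intro h x p K hK ht δ hδ hδ1
    have := h x (-p) K hK (touchBelow_iff_neg.2 (by simpa using ht)) δ hδ hδ1
    have e := levyIto_neg (ν := ν) (j := j) (Metric.ball 0 δ)ᶜ u x (-p)
    rw [neg_neg] at e
    rw [e, dualHam]; linarith
  · intro h x p K hK ht δ hδ hδ1
    have := h x (-p) K hK (touchBelow_iff_neg.1 ht) δ hδ hδ1
    rw [levyIto_neg, dualHam, neg_neg] at this
    linarith

theorem JetSub.congr {g g' u : Eucl N → ℝ} (h : JetSub σ C ν j H g u) (hg : ∀ x, g x = g' x) :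
    JetSub σ C ν j H g' u := by
  rwa [← funext hg]

/-- Since δ < 1, the compensator is present on the whole annulus and cancels the linear part of the
paraboloid. Each increment is then at most K‖j‖². -/
theorem levyIto_le_of_touchAbove (hB : JumpBounds σ ν j C) {u : Eucl N → ℝ} (hu : Continuous u)
    {M : ℝ} (hM : ∀ x, |u x| ≤ M) {δ' δ : ℝ} (hδ' : 0 < δ') (h : δ' ≤ δ) (hδ1 : δ < 1)
    {x p : Eucl N} {K : ℝ} (hK : 0 ≤ K) (ht : TouchAbove u x p K) :
    levyIto ν j (Metric.ball (0 : Eucl N) δ')ᶜ u x p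
      ≤ levyIto ν j (Metric.ball (0 : Eucl N) δ)ᶜ u x p + K * (C * δ ^ (2 - σ)) := by
  rw [levyIto_split hB hu hM hδ' h, add_comm]
  gcongr
  obtain ⟨hi, hb⟩ := setIntegral_sq_le hB (hδ'.trans_le h) hδ1
    (sdiff_subset (s := Metric.ball (0 : Eucl N) δ) (t := Metric.ball 0 δ')) x
  refine le_trans ?_ (mul_le_mul_of_nonneg_left hb hK)
  rw [← integral_const_mul, levyIto_eq]
  refine setIntegral_mono_on ((integrableOn_increment hB hu hM hδ' x p).mono_set ?_)
    (hi.const_mul K) (measurableSet_ball.diff measurableSet_ball) fun z hz => ?_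
  · exact fun z hz => hz.2
  · have hz1 : ‖z‖ < 1 := (mem_ball_zero_iff.1 hz.1).trans hδ1
    rw [increment_of_norm_lt hz1]
    have := ht (x + j x z)
    rw [add_sub_cancel_left] at this
    linarith

theorem exists_small_rate (hσ2 : σ < 2) (K : ℝ) {ε : ℝ} (hε : 0 < ε) :
    ∃ δ₀ > 0, ∀ δ, 0 < δ → δ < δ₀ → K * (C * δ ^ (2 - σ)) < ε := by
  have h : Tendsto (fun δ : ℝ => K * (C * δ ^ (2 - σ))) (𝓝 0) (𝓝 0) := by
    have h1 : ContinuousAt (fun δ : ℝ => δ ^ (2 - σ)) 0 :=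
      Real.continuousAt_rpow_const _ _ (Or.inr (by linarith))
    have h2 : Tendsto (fun δ : ℝ => K * (C * δ ^ (2 - σ))) (𝓝 0)
        (𝓝 (K * (C * (0 : ℝ) ^ (2 - σ)))) := (h1.tendsto.const_mul C).const_mul K
    rwa [Real.zero_rpow (by linarith), mul_zero, mul_zero] at h2
  obtain ⟨δ₀, hδ₀, hh⟩ := Metric.eventually_nhds_iff.1 (h.eventually (gt_mem_nhds hε))
  refine ⟨δ₀, hδ₀, fun δ hδ hδ' => hh ?_⟩
  rw [dist_zero_right, Real.norm_eq_abs, abs_of_pos hδ]; exact hδ'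

/-- It suffices to check the subsolution inequality up to small errors along small radii. -/
theorem jetSub_of_frequently (hB : JumpBounds σ ν j C) {g u : Eucl N → ℝ} (hu : Continuous u)
    {M : ℝ} (hM : ∀ x, |u x| ≤ M)
    (h : ∀ (x p : Eucl N) (K : ℝ), 0 ≤ K → TouchAbove u x p K → ∀ ε > 0, ∀ δ₀ > 0,
      ∃ δ, 0 < δ ∧ δ < δ₀ ∧ H x p - levyIto ν j (Metric.ball 0 δ)ᶜ u x p ≤ g x + ε) :
    JetSub σ C ν j H g u := by
  intro x p K hK ht δ hδ hδ1
  refine le_of_forall_pos_le_add fun ε hε => ?_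
  obtain ⟨δ', hδ', hlt, hle⟩ := h x p K hK ht ε hε δ hδ
  have := levyIto_le_of_touchAbove hB hu hM hδ' hlt.le hδ1 hK ht
  linarith

theorem eq_zero_of_inner_le {p : Eucl N} {K : ℝ} (h : ∀ y, 0 ≤ inner ℝ p y + K * ‖y‖ ^ 2) :
    p = 0 := by
  by_contra hp
  have hp' : 0 < ‖p‖ ^ 2 := by positivity
  have hK : 0 < |K| + 1 := by positivity
  have := h (-(1 / (|K| + 1)) • p)
  rw [real_inner_smul_right, real_inner_self_eq_norm_sq, norm_smul, mul_pow, Real.norm_eq_abs,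
    sq_abs] at this
  have h2 : 0 ≤ ‖p‖ ^ 2 * (1 / (|K| + 1)) * (-1 + K * (1 / (|K| + 1))) := by linarith
  have h3 : K * (1 / (|K| + 1)) < 1 := by
    rw [mul_one_div, div_lt_one hK]; linarith [le_abs_self K]
  have h4 : 0 < ‖p‖ ^ 2 * (1 / (|K| + 1)) := by positivity
  nlinarith

/-! ### Comparison of the two notions of viscosity solution -/

theorem hasGradientAt_paraboloid (x p : Eucl N) (K : ℝ) :
    HasGradientAt (fun y : Eucl N => inner ℝ p (y - x) + K * ‖y - x‖ ^ 2) p x := by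
  rw [hasGradientAt_iff_hasFDerivAt]
  have h1 : HasFDerivAt (fun y : Eucl N => y - x) (ContinuousLinearMap.id ℝ (Eucl N)) x :=
    (hasFDerivAt_id x).sub_const x
  have h2 := (HasFDerivAt.inner ℝ (hasFDerivAt_const p x) h1).add ((h1.norm_sq).const_mul K)
  refine h2.congr_fderiv ?_
  ext y
  simp

theorem contDiff_paraboloid (x p : Eucl N) (K : ℝ) :
    ContDiff ℝ 2 (fun y : Eucl N => inner ℝ p (y - x) + K * ‖y - x‖ ^ 2) := by
  have h1 : ContDiff ℝ 2 (fun y : Eucl N => y - x) := contDiff_id.sub contDiff_const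
  exact (contDiff_const.inner ℝ h1).add (contDiff_const.mul (h1.norm_sq ℝ))

theorem jetSub_of_isViscSubsolution (hB : JumpBounds σ ν j C) {u : Eucl N → ℝ} {a : ℝ}
    (h : IsViscSubsolution ν j H a u) : JetSub σ C ν j H (fun _ => a) u := by
  intro x p K hK ht δ hδ hδ1
  have hg := (hasGradientAt_paraboloid x p K).gradient
  -- The radius C + 1 exceeds every jump with |z| < δ < 1, since ‖j‖ ≤ C‖z‖.
  have := h.2 (fun y => inner ℝ p (y - x) + K * ‖y - x‖ ^ 2) x (C + 1) δ
    (contDiff_paraboloid x p K) (by linarith [hB.pos]) hδ ?_ ?_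
  · rw [testedOperator, hg] at this
    obtain ⟨-, hb⟩ := setIntegral_sq_le hB hδ hδ1 subset_rfl x
    have e : levyIto ν j (Metric.ball 0 δ)
        (fun y => inner ℝ p (y - x) + K * ‖y - x‖ ^ 2) x p
        = K * ∫ z in Metric.ball (0 : Eucl N) δ, ‖j x z‖ ^ 2 ∂ν := by
      rw [← integral_const_mul, levyIto_eq]
      refine setIntegral_congr_fun measurableSet_ball fun z hz => ?_
      have hz1 : ‖z‖ < 1 := (mem_ball_zero_iff.1 hz).trans hδ1
      simp [increment_of_norm_lt hz1]
    rw [e] at this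
    have := mul_le_mul_of_nonneg_left hb hK
    linarith
  · intro z hz
    have hz1 : ‖z‖ < 1 := (mem_ball_zero_iff.1 hz).trans hδ1
    rw [mem_ball_iff_norm, add_sub_cancel_left]
    nlinarith [hB.norm_le x z, hB.pos]
  · intro y _
    have := ht y
    simp only [sub_self, inner_zero_right, norm_zero]
    linarith

theorem exists_taylor_bound {φ : Eucl N → ℝ} (hφ : ContDiff ℝ 2 φ) (x : Eucl N) :
    ∃ K r : ℝ, 0 ≤ K ∧ 0 < r ∧ ∀ y ∈ Metric.ball x r,
      |φ y - φ x - inner ℝ (gradient φ x) (y - x)| ≤ K * ‖y - x‖ ^ 2 := by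
  have hd : ContDiff ℝ 1 (fderiv ℝ φ) := hφ.fderiv_right (by norm_num)
  obtain ⟨K, t, ht, hL⟩ := (hd.contDiffAt (x := x)).exists_lipschitzOnWith
  obtain ⟨r, hr, hrt⟩ := Metric.mem_nhds_iff.1 ht
  refine ⟨K, r, K.2, hr, fun y hy => ?_⟩
  have hxy : ‖y - x‖ < r := mem_ball_iff_norm.1 hy
  have hs : Metric.closedBall x ‖y - x‖ ⊆ t :=
    (Metric.closedBall_subset_ball hxy).trans hrt
  have := Convex.norm_image_sub_le_of_norm_hasFDerivWithin_le' (f := φ) (f' := fderiv ℝ φ)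
    (φ := fderiv ℝ φ x) (s := Metric.closedBall x ‖y - x‖) (C := K * ‖y - x‖) (x := x) (y := y)
    (fun z _ => ((hφ.differentiable (by norm_num)) z).hasFDerivAt.hasFDerivWithinAt)
    (fun z hz => ?_) (convex_closedBall _ _) (Metric.mem_closedBall_self (norm_nonneg _))
    (by rw [mem_closedBall_iff_norm])
  · rw [inner_gradient_left]
    rw [Real.norm_eq_abs] at this
    calc _ ≤ _ := this
      _ = _ := by ring
  · have h1 := hL.dist_le_mul z (hs hz) x (mem_of_mem_nhds ht)
    rw [dist_eq_norm, dist_eq_norm] at h1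
    exact h1.trans (mul_le_mul_of_nonneg_left (mem_closedBall_iff_norm.1 hz) K.2)

theorem exists_touchAbove_of_isMax {u φ : Eucl N → ℝ} {M : ℝ} (hM : ∀ x, |u x| ≤ M)
    {x p : Eucl N} {K r : ℝ} (hr : 0 < r) (hK : 0 ≤ K)
    (hφ : ∀ y ∈ Metric.ball x r, |φ y - φ x - inner ℝ p (y - x)| ≤ K * ‖y - x‖ ^ 2)
    (hmax : ∀ y ∈ Metric.ball x r, u y - φ y ≤ u x - φ x) :
    ∃ K', 0 ≤ K' ∧ TouchAbove u x p K' := by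
  have hM0 : 0 ≤ M := (abs_nonneg _).trans (hM x)
  -- Outside the ball, 2M/r² pays for the oscillation of `u` and ‖p‖/r for the linear term; inside,
  -- the Taylor constant K suffices.
  refine ⟨K + (2 * M / r ^ 2 + ‖p‖ / r), by positivity, fun y => ?_⟩
  have hpos : 0 ≤ (2 * M / r ^ 2 + ‖p‖ / r) * ‖y - x‖ ^ 2 := by positivity
  by_cases hy : ‖y - x‖ < r
  · have h1 := hmax y (mem_ball_iff_norm.2 hy)
    have h2 := (abs_le.1 (hφ y (mem_ball_iff_norm.2 hy))).2
    rw [add_mul]; linarith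
  · rw [not_lt] at hy
    have h1 := (abs_le.1 (hM y)).2
    have h2 := (abs_le.1 (hM x)).1
    have h3 := (abs_le.1 (abs_real_inner_le_norm p (y - x))).1
    have h4 : 2 * M ≤ 2 * M / r ^ 2 * ‖y - x‖ ^ 2 := by
      rw [div_mul_eq_mul_div, le_div_iff₀ (by positivity)]
      exact mul_le_mul_of_nonneg_left (pow_le_pow_left₀ hr.le hy 2) (by linarith)
    have h5 : ‖p‖ * ‖y - x‖ ≤ ‖p‖ / r * ‖y - x‖ ^ 2 := by
      rw [div_mul_eq_mul_div, le_div_iff₀ hr]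
      have := mul_le_mul_of_nonneg_left hy (mul_nonneg (norm_nonneg p) (norm_nonneg (y - x)))
      nlinarith
    have h6 : 0 ≤ K * ‖y - x‖ ^ 2 := by positivity
    rw [add_mul, add_mul]; linarith

/-- The test function is replaced by a global paraboloid with the same gradient, used at a much
smaller radius δ'. Jumps below δ' contribute a vanishing error for both `u` and `φ`. Those between
δ' and δ are compared through the maximality of `u - φ`. -/
theorem isViscSubsolution_of_jetSub (hB : JumpBounds σ ν j C) {u : Eucl N → ℝ} {a : ℝ}
    (hu : Continuous u) {M : ℝ} (hM : ∀ x, |u x| ≤ M)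
    (h : JetSub σ C ν j H (fun _ => a) u) : IsViscSubsolution ν j H a u := by
  refine ⟨hu.upperSemicontinuous, fun φ x r δ hφ hr hδ hjump hmax => ?_⟩
  obtain ⟨K, r', hK, hr', hT⟩ := exists_taylor_bound hφ x
  set p := gradient φ x with hp
  obtain ⟨K', hK', ht⟩ := exists_touchAbove_of_isMax hM (lt_min hr hr') hK
    (fun y hy => hT y (Metric.ball_subset_ball (min_le_right _ _) hy))
    (fun y hy => hmax y (Metric.ball_subset_ball (min_le_left _ _) hy))
  refine le_of_forall_pos_le_add fun ε hε => ?_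
  obtain ⟨δ₀, hδ₀, hrate⟩ := exists_small_rate (C := C) hB.sigma_lt (K + K') hε
  obtain ⟨δ', hδ'0, hδ'⟩ := exists_between (lt_min (lt_min hδ hδ₀)
    (lt_min one_pos (div_pos hr' hB.pos)))
  simp only [lt_min_iff] at hδ'
  obtain ⟨⟨hδ'δ, hδ'δ₀⟩, hδ'1, hδ'r⟩ := hδ'
  have hrate := hrate δ' hδ'0 hδ'δ₀
  have hineq := h x p K' hK' ht δ' hδ'0 hδ'1
  have hsplit := levyIto_split hB hu hM hδ'0 hδ'δ.le x p
  obtain ⟨hsq, hsqb⟩ := setIntegral_sq_le hB hδ'0 hδ'1 subset_rfl x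
  have hφc := hφ.continuous
  have hmφ : Measurable (increment j φ x p) := measurable_increment hB hφc x p
  -- small jumps
  have hsmall : ∀ z ∈ Metric.ball (0 : Eucl N) δ', |increment j φ x p z| ≤ K * ‖j x z‖ ^ 2 := by
    intro z hz
    have hz' := mem_ball_zero_iff.1 hz
    rw [increment_of_norm_lt (hz'.trans hδ'1)]
    have hjr : ‖j x z‖ < r' := by
      rw [lt_div_iff₀ hB.pos] at hδ'r
      nlinarith [hB.norm_le x z, hB.pos]
    have := hT (x + j x z) (by rwa [mem_ball_iff_norm, add_sub_cancel_left])
    rwa [add_sub_cancel_left] at this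
  have hi1 : IntegrableOn (increment j φ x p) (Metric.ball (0 : Eucl N) δ') ν :=
    (hsq.const_mul K).mono' hmφ.aestronglyMeasurable
      ((ae_restrict_mem measurableSet_ball).mono hsmall)
  have hb1 : -(K * (C * δ' ^ (2 - σ))) ≤ levyIto ν j (Metric.ball 0 δ') φ x p := by
    have h1 : ∫ z in Metric.ball (0 : Eucl N) δ', -(K * ‖j x z‖ ^ 2) ∂ν
        ≤ levyIto ν j (Metric.ball 0 δ') φ x p :=
      setIntegral_mono_on (hsq.const_mul K).neg hi1 measurableSet_ball
        fun z hz => (abs_le.1 (hsmall z hz)).1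
    rw [integral_neg, integral_const_mul] at h1
    have := mul_le_mul_of_nonneg_left hsqb hK
    linarith
  -- intermediate jumps
  have hR : 0 ≤ C * δ := mul_nonneg hB.pos.le hδ.le
  obtain ⟨B, hBd⟩ := (isCompact_closedBall x (C * δ)).exists_bound_of_continuousOn
    hφc.continuousOn
  have hann : ∀ z ∈ Metric.ball (0 : Eucl N) δ \ Metric.ball 0 δ',
      |increment j φ x p z| ≤ 2 * B + ‖p‖ * (C * δ) := by
    intro z hz
    have hz1 : ‖j x z‖ ≤ C * δ :=
      (hB.norm_le x z).trans (mul_le_mul_of_nonneg_left (mem_ball_zero_iff.1 hz.1).le hB.pos.le)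
    have h1 := abs_le.1 (hBd (x + j x z) (by rwa [mem_closedBall_iff_norm, add_sub_cancel_left]))
    have h2 := abs_le.1 (hBd x (Metric.mem_closedBall_self hR))
    have h3 := abs_le.1 ((abs_real_inner_le_norm p (j x z)).trans
      (mul_le_mul_of_nonneg_left hz1 (norm_nonneg p)))
    have h4 : 0 ≤ ‖p‖ * (C * δ) := by positivity
    by_cases hz : ‖z‖ < 1
    · rw [increment_of_norm_lt hz, abs_le]; constructor <;> linarith
    · rw [increment_of_le_norm (not_lt.1 hz), abs_le]; constructor <;> linarith
  have hms : MeasurableSet (Metric.ball (0 : Eucl N) δ \ Metric.ball 0 δ') :=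
    measurableSet_ball.diff measurableSet_ball
  have hsub : Metric.ball (0 : Eucl N) δ \ Metric.ball 0 δ' ⊆ (Metric.ball 0 δ')ᶜ :=
    fun z hz => hz.2
  have hi2 : IntegrableOn (increment j φ x p) (Metric.ball (0 : Eucl N) δ \ Metric.ball 0 δ') ν :=
    Measure.integrableOn_of_bounded
      (ne_top_of_le_ne_top (hB.tail_ne_top hδ'0) (measure_mono hsub))
      hmφ.aestronglyMeasurable ((ae_restrict_mem hms).mono hann)
  have hb2 : levyIto ν j (Metric.ball (0 : Eucl N) δ \ Metric.ball 0 δ') u x p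
      ≤ levyIto ν j (Metric.ball (0 : Eucl N) δ \ Metric.ball 0 δ') φ x p := by
    refine setIntegral_mono_on ((integrableOn_increment hB hu hM hδ'0 x p).mono_set hsub) hi2 hms
      fun z hz => ?_
    have := hmax _ (hjump z hz.1)
    gcongr ?_ - _
    linarith
  have hu2 : levyIto ν j (Metric.ball 0 δ) φ x p = levyIto ν j (Metric.ball 0 δ') φ x p
      + levyIto ν j (Metric.ball (0 : Eucl N) δ \ Metric.ball 0 δ') φ x p := by
    simp only [levyIto_eq]
    rw [← setIntegral_union disjoint_sdiff_right hms hi1 hi2,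
      union_sdiff_cancel (Metric.ball_subset_ball hδ'δ.le)]
  rw [testedOperator, ← hp, hu2]
  rw [add_mul] at hrate
  linarith

theorem testedOperator_dual (δ : ℝ) (u φ : Eucl N → ℝ) (x : Eucl N) :
    testedOperator ν j (dualHam H) δ (fun y => -u y) (fun y => -φ y) x
      = -testedOperator ν j H δ u φ x := by
  have hg : gradient (fun y => -φ y) x = -gradient φ x := by
    simp [gradient, fderiv_fun_neg]
  rw [testedOperator, testedOperator, hg, levyIto_neg, levyIto_neg, dualHam]
  simp only [neg_neg]
  ring

theorem isViscSupersolution_iff_neg {u : Eucl N → ℝ} {a : ℝ} :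
    IsViscSupersolution ν j H a u ↔ IsViscSubsolution ν j (dualHam H) (-a) (fun x => -u x) := by
  constructor
  · rintro ⟨hl, h⟩
    refine ⟨fun x y hy => ?_, fun φ x r δ hφ hr hδ hj hm => ?_⟩
    · filter_upwards [hl x (-y) (by linarith)] with z hz using by linarith
    · have := h (fun y => -φ y) x r δ hφ.neg hr hδ hj fun y hy => by linarith [hm y hy]
      have e := testedOperator_dual (ν := ν) (j := j) (H := H) δ u (fun y => -φ y) x
      simp only [neg_neg] at e
      linarith
  · rintro ⟨hl, h⟩
    refine ⟨fun x y hy => ?_, fun φ x r δ hφ hr hδ hj hm => ?_⟩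
    · filter_upwards [hl x (-y) (by linarith)] with z hz using by linarith
    · have := h (fun y => -φ y) x r δ hφ.neg hr hδ hj fun y hy => by linarith [hm y hy]
      rw [testedOperator_dual] at this
      linarith

theorem jetSuper_of_isViscSupersolution (hB : JumpBounds σ ν j C) {u : Eucl N → ℝ} {a : ℝ}
    (h : IsViscSupersolution ν j H a u) : JetSuper σ C ν j H (fun _ => a) u :=
  jetSuper_iff_neg.2 (jetSub_of_isViscSubsolution hB (isViscSupersolution_iff_neg.1 h))

theorem isViscSupersolution_of_jetSuper (hB : JumpBounds σ ν j C) {u : Eucl N → ℝ} {a : ℝ}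
    (hu : Continuous u) {M : ℝ} (hM : ∀ x, |u x| ≤ M)
    (h : JetSuper σ C ν j H (fun _ => a) u) : IsViscSupersolution ν j H a u :=
  isViscSupersolution_iff_neg.2 (isViscSubsolution_of_jetSub hB hu.neg (M := M)
    (by simpa using hM) (jetSuper_iff_neg.1 h))

end Jets

/-! ### Consequences of the assumptions on the Hamiltonian -/

section Hamiltonian

variable {N : ℕ} {m : ℝ} {ζ₁ ζ₂ : ℝ → ℝ} {H : Eucl N → Eucl N → ℝ}

theorem IsModulus.nonneg {ζ : ℝ → ℝ} (h : IsModulus ζ) {s : ℝ} (hs : 0 ≤ s) : 0 ≤ ζ s := by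
  rw [← h.map_zero]
  exact h.monotoneOn (mem_Ici.2 le_rfl) (mem_Ici.2 hs) hs

theorem IsModulus.tendsto_norm {ζ : ℝ → ℝ} (h : IsModulus ζ) {E : Type*} [NormedAddCommGroup E] :
    Tendsto (fun x : E => ζ ‖x‖) (𝓝 0) (𝓝 0) := by
  have h1 : Tendsto ζ (𝓝[≥] 0) (𝓝 0) := by
    rw [← Ioi_insert, nhdsWithin_insert, tendsto_sup]
    exact ⟨by simpa [h.map_zero] using tendsto_pure_nhds ζ 0, h.tendsto_zero⟩
  refine h1.comp (tendsto_nhdsWithin_iff.2 ⟨?_, Eventually.of_forall fun x => norm_nonneg x⟩)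
  simpa using (continuous_norm (E := E)).tendsto 0

theorem continuous_hamiltonian (hm : 1 < m) (hζ₁ : IsModulus ζ₁) (hζ₂ : IsModulus ζ₂)
    (hH1 : CondH1 m ζ₁ ζ₂ H) : Continuous fun q : Eucl N × Eucl N => H q.1 q.2 := by
  rw [continuous_iff_continuousAt]
  rintro ⟨x₀, p₀⟩
  have e1 : Tendsto (fun q : Eucl N × Eucl N => ζ₁ ‖x₀ - q.1‖) (𝓝 (x₀, p₀)) (𝓝 0) := by
    refine hζ₁.tendsto_norm.comp ?_
    have : Continuous fun q : Eucl N × Eucl N => x₀ - q.1 := by fun_prop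
    simpa using this.tendsto (x₀, p₀)
  have e2 : Tendsto (fun q : Eucl N × Eucl N => ζ₂ ‖q.2 - p₀‖) (𝓝 (x₀, p₀)) (𝓝 0) := by
    refine hζ₂.tendsto_norm.comp ?_
    have : Continuous fun q : Eucl N × Eucl N => q.2 - p₀ := by fun_prop
    simpa using this.tendsto (x₀, p₀)
  have e3 : Tendsto (fun q : Eucl N × Eucl N => 1 + ‖q.2‖ ^ m) (𝓝 (x₀, p₀))
      (𝓝 (1 + ‖p₀‖ ^ m)) :=
    (((continuous_snd.norm).rpow_const fun _ => Or.inr (by linarith)).const_add 1).tendsto _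
  have e4 : Tendsto (fun q : Eucl N × Eucl N => 1 + ‖q.2‖ ^ (m - 1)) (𝓝 (x₀, p₀))
      (𝓝 (1 + ‖p₀‖ ^ (m - 1))) :=
    (((continuous_snd.norm).rpow_const fun _ => Or.inr (by linarith)).const_add 1).tendsto _
  have up : Tendsto (fun q : Eucl N × Eucl N => H x₀ p₀ + (ζ₁ ‖x₀ - q.1‖ * (1 + ‖p₀‖ ^ m)
      + ζ₂ ‖q.2 - p₀‖ * (1 + ‖p₀‖ ^ (m - 1)))) (𝓝 (x₀, p₀)) (𝓝 (H x₀ p₀)) := by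
    simpa using tendsto_const_nhds.add ((e1.mul_const (1 + ‖p₀‖ ^ m)).add
      (e2.mul_const (1 + ‖p₀‖ ^ (m - 1))))
  have low : Tendsto (fun q : Eucl N × Eucl N => H x₀ p₀ - (ζ₁ ‖x₀ - q.1‖ * (1 + ‖q.2‖ ^ m)
      + ζ₂ ‖q.2 - p₀‖ * (1 + ‖q.2‖ ^ (m - 1)))) (𝓝 (x₀, p₀)) (𝓝 (H x₀ p₀)) := by
    simpa using tendsto_const_nhds.sub ((e1.mul e3).add (e2.mul e4))
  refine tendsto_of_tendsto_of_tendsto_of_le_of_le low up (fun q => ?_) (fun q => ?_)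
  · have := hH1 q.1 x₀ q.2 (p₀ - q.2)
    rw [add_sub_cancel, norm_sub_rev q.1, norm_sub_rev p₀] at this
    simp only; linarith
  · have := hH1 x₀ q.1 p₀ (q.2 - p₀)
    rw [add_sub_cancel] at this
    simp only; linarith

/-- With μ = 1/2 at the point p/2, (H2) reads H(x,p) ≥ 2H(x,p/2) + b|p|^m - A. Starting from a bound
on the unit ball, obtained from (H0) and (H1), this is iterated over dyadic shells. -/
theorem exists_coercive (hm : 1 < m) (hζ₂ : IsModulus ζ₂) (hζ₁ : IsModulus ζ₁)
    (hH0 : CondH0 H) (hH1 : CondH1 m ζ₁ ζ₂ H) (hH2 : CondH2 m H) :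
    ∃ b E D : ℝ, 0 < b ∧ 0 ≤ E ∧ 0 ≤ D ∧ ∀ x p : Eucl N, b * ‖p‖ ^ m - E * ‖p‖ - D ≤ H x p := by
  obtain ⟨H₀, hH₀, h0⟩ := hH0
  obtain ⟨A, b₀, hA, hb₀, h2⟩ := hH2
  have hz := hζ₂.nonneg zero_le_one
  set D₀ := H₀ + 2 * ζ₂ 1 with hD₀
  set b := b₀ * (m - 1) * (1 / 2) ^ m with hb
  have hbpos : 0 < b := by
    have : 0 < m - 1 := by linarith
    positivity
  have base : ∀ x p : Eucl N, ‖p‖ ≤ 1 → -D₀ ≤ H x p := by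
    intro x p hp
    have h := hH1 x x p (-p)
    rw [add_neg_cancel, sub_self, norm_zero, hζ₁.map_zero, norm_neg, zero_mul, zero_add] at h
    have h3 : ζ₂ ‖p‖ ≤ ζ₂ 1 :=
      hζ₂.monotoneOn (mem_Ici.2 (norm_nonneg p)) (mem_Ici.2 zero_le_one) hp
    have h4 : ‖p‖ ^ (m - 1) ≤ 1 := Real.rpow_le_one (norm_nonneg _) hp (by linarith)
    have h5 : ζ₂ ‖p‖ * (1 + ‖p‖ ^ (m - 1)) ≤ ζ₂ 1 * 2 :=
      mul_le_mul h3 (by linarith) (by positivity) hz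
    linarith [(abs_le.1 (h0 x)).1]
  have pow_le : ∀ p : Eucl N, ‖p‖ ≤ 1 → b * ‖p‖ ^ m ≤ b := fun p hp =>
    mul_le_of_le_one_right hbpos.le (Real.rpow_le_one (norm_nonneg _) hp (by linarith))
  -- For |p| ≥ 1/2 the term E|p| is at least b + A + D₀, so the bound below follows from `base` on
  -- the first shell. The `+ A` in the induction hypothesis is doubled at each step and pays for the
  -- loss of A.
  set E := 2 * (b + A + D₀) with hE
  have hD₀pos : 0 ≤ D₀ := by positivity
  have key : ∀ n : ℕ, ∀ x p : Eucl N, 1 / 2 ≤ ‖p‖ → ‖p‖ ≤ 2 ^ n →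
      b * ‖p‖ ^ m - E * ‖p‖ + A ≤ H x p := by
    intro n
    induction n with
    | zero =>
      intro x p h1 h3
      rw [pow_zero] at h3
      have := base x p h3
      have := pow_le p h3
      have : E * (1 / 2) ≤ E * ‖p‖ := mul_le_mul_of_nonneg_left h1 (by positivity)
      linarith
    | succ n ih =>
      intro x p h1 h3
      rcases le_or_gt ‖p‖ (2 ^ n) with h4 | h4
      · exact ih x p h1 h4
      have hn : (1 : ℝ) ≤ 2 ^ n := one_le_pow₀ (by norm_num)
      have hnorm : ‖(1 / 2 : ℝ) • p‖ = 1 / 2 * ‖p‖ := by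
        rw [norm_smul]; norm_num
      have h5 := ih x ((1 / 2 : ℝ) • p) (by rw [hnorm]; linarith)
        (by rw [hnorm]; rw [pow_succ] at h3; linarith)
      have h6 := h2 (1 / 2) (by norm_num) (by norm_num) x ((1 / 2 : ℝ) • p)
      rw [smul_smul, inv_mul_cancel₀ (by norm_num), one_smul] at h6
      rw [hnorm, Real.mul_rpow (by norm_num) (norm_nonneg p)] at h5 h6
      have h7 : 0 ≤ b * ((1 / 2) ^ m * ‖p‖ ^ m) := by positivity
      have h8 : b₀ * (1 - m) * ((1 / 2) ^ m * ‖p‖ ^ m) = -(b * ‖p‖ ^ m) := by rw [hb]; ring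
      rw [h8] at h6
      linarith
  refine ⟨b, E, b + D₀, hbpos, by positivity, by positivity, fun x p => ?_⟩
  rcases le_or_gt ‖p‖ 1 with hp | hp
  · have := base x p hp
    have := pow_le p hp
    have : 0 ≤ E * ‖p‖ := by positivity
    linarith
  · obtain ⟨n, hn⟩ := pow_unbounded_of_one_lt ‖p‖ (one_lt_two (α := ℝ))
    have := key n x p (by linarith) hn.le
    linarith

end Hamiltonian

/-! ### Hölder regularity of subsolutions -/

section Regularity

variable {N : ℕ} {σ C : ℝ} {ν : Measure (Eucl N)} {j : Eucl N → Eucl N → Eucl N}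
  {H : Eucl N → Eucl N → ℝ}

/-- The increment of `u` is bounded by the oscillation. The compensator, present only for ‖z‖ < 1,
is bounded using ‖z‖ ≤ ‖z‖^α, so no smoothness of `u` enters. -/
theorem levyIto_le_of_osc (hB : JumpBounds σ ν j C) {α C' : ℝ} (hα1 : α ≤ 1)
    (hC' : 0 ≤ C') {δ : ℝ} (hδ : 0 < δ)
    (hdrift : ∫⁻ z in (Metric.ball (0 : Eucl N) δ)ᶜ, ENNReal.ofReal (min 1 (‖z‖ ^ α)) ∂ν
      ≤ ENNReal.ofReal (C' * δ ^ (α - σ)))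
    {u : Eucl N → ℝ} (hu : Continuous u) {M Ω : ℝ} (hM : ∀ x, |u x| ≤ M)
    (hΩ : ∀ x y, u x - u y ≤ Ω) (x p : Eucl N) :
    levyIto ν j (Metric.ball (0 : Eucl N) δ)ᶜ u x p
      ≤ Ω * (C * δ ^ (-σ)) + ‖p‖ * C * (C' * δ ^ (α - σ)) := by
  have hΩ0 : 0 ≤ Ω := by simpa using hΩ x x
  have hnn : ∀ z : Eucl N, 0 ≤ min 1 (‖z‖ ^ α) := fun z => le_min zero_le_one (by positivity)
  have hmeas : Measurable fun z : Eucl N => min 1 (‖z‖ ^ α) :=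
    measurable_const.min (measurable_norm.pow_const α)
  obtain ⟨hint, hbd⟩ := integrableOn_and_setIntegral_le hmeas hnn
    (show 0 ≤ C' * δ ^ (α - σ) by positivity) hdrift
  have hc : IntegrableOn (fun _ : Eucl N => Ω) (Metric.ball (0 : Eucl N) δ)ᶜ ν :=
    integrableOn_const (hB.tail_ne_top hδ)
  have hpC : 0 ≤ ‖p‖ * C := mul_nonneg (norm_nonneg _) hB.pos.le
  calc levyIto ν j (Metric.ball (0 : Eucl N) δ)ᶜ u x p
      ≤ ∫ z in (Metric.ball (0 : Eucl N) δ)ᶜ, (Ω + ‖p‖ * C * min 1 (‖z‖ ^ α)) ∂ν := by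
        refine setIntegral_mono (integrableOn_increment hB hu hM hδ x p)
          (hc.add (hint.const_mul _)) fun z => ?_
        change increment j u x p z ≤ Ω + ‖p‖ * C * min 1 (‖z‖ ^ α)
        have h1 := hΩ (x + j x z) x
        by_cases hz : ‖z‖ < 1
        · rw [increment_of_norm_lt hz]
          have h2 : ‖z‖ ≤ min 1 (‖z‖ ^ α) := by
            refine le_min hz.le ?_
            rcases (norm_nonneg z).eq_or_lt with h0 | h0
            · rw [← h0]; positivity
            · calc ‖z‖ = ‖z‖ ^ (1 : ℝ) := (Real.rpow_one _).symm
                _ ≤ ‖z‖ ^ α := Real.rpow_le_rpow_of_exponent_ge h0 hz.le hα1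
          have h3 := (abs_le.1 (abs_real_inner_le_norm p (j x z))).1
          have h4 : ‖p‖ * ‖j x z‖ ≤ ‖p‖ * C * min 1 (‖z‖ ^ α) := by
            rw [mul_assoc]
            exact mul_le_mul_of_nonneg_left ((hB.norm_le x z).trans
              (mul_le_mul_of_nonneg_left h2 hB.pos.le)) (norm_nonneg p)
          linarith
        · rw [increment_of_le_norm (not_lt.1 hz)]
          have := mul_nonneg hpC (hnn z)
          linarith
    _ = Ω * ν.real (Metric.ball (0 : Eucl N) δ)ᶜ
        + ‖p‖ * C * ∫ z in (Metric.ball (0 : Eucl N) δ)ᶜ, min 1 (‖z‖ ^ α) ∂ν := by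
        rw [integral_add hc (hint.const_mul _), setIntegral_const, integral_const_mul, smul_eq_mul,
          mul_comm Ω]
    _ ≤ _ := by
        have := hB.tail_real hδ
        gcongr

/-- This is concavity of t ↦ t^(γ/2) at t = d², in the form of Bernoulli's inequality. Being
quadratic in s and valid for all s ≥ 0, it turns a touching cone into a globally touching
paraboloid. -/
theorem rpow_le_tangent {s d γ : ℝ} (hs : 0 ≤ s) (hd : 0 < d) (hγ0 : 0 < γ) (hγ1 : γ < 1) :
    s ^ γ ≤ d ^ γ + γ / 2 * d ^ (γ - 2) * (s ^ 2 - d ^ 2) := by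
  have h := rpow_one_add_le_one_add_mul_self (s := s ^ 2 / d ^ 2 - 1) (p := γ / 2)
    (by linarith [show 0 ≤ s ^ 2 / d ^ 2 by positivity]) (by positivity) (by linarith)
  have e1 : (1 + (s ^ 2 / d ^ 2 - 1)) ^ (γ / 2) = s ^ γ / d ^ γ := by
    rw [add_sub_cancel, ← div_pow, ← Real.rpow_natCast, ← Real.rpow_mul (by positivity),
      Real.div_rpow hs hd.le, show ((2 : ℕ) : ℝ) * (γ / 2) = γ by push_cast; ring]
  have e2 : d ^ (γ - 2) = d ^ γ / d ^ 2 := by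
    rw [Real.rpow_sub hd, Real.rpow_two]
  have hdγ : 0 < d ^ γ := by positivity
  rw [e1, div_le_iff₀ hdγ] at h
  rw [e2]
  refine h.trans (le_of_eq ?_)
  field_simp

theorem touchAbove_of_isMax_cone {u : Eucl N → ℝ} {L γ : ℝ} (hL : 0 < L) (hγ0 : 0 < γ)
    (hγ1 : γ < 1) {x₀ y : Eucl N} (hy : y ≠ x₀)
    (hmax : ∀ z, u z - L * ‖z - x₀‖ ^ γ ≤ u y - L * ‖y - x₀‖ ^ γ) :
    TouchAbove u y ((L * γ * ‖y - x₀‖ ^ (γ - 2)) • (y - x₀))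
      (L * (γ / 2) * ‖y - x₀‖ ^ (γ - 2)) := by
  intro z
  have hd : 0 < ‖y - x₀‖ := norm_pos_iff.2 (sub_ne_zero.2 hy)
  have h1 := mul_le_mul_of_nonneg_left
    (rpow_le_tangent (norm_nonneg (z - x₀)) hd hγ0 hγ1) hL.le
  have h2 : ‖z - x₀‖ ^ 2 = ‖y - x₀‖ ^ 2 + 2 * inner ℝ (y - x₀) (z - y) + ‖z - y‖ ^ 2 :=
    norm_sub_sq_expand y x₀ z
  rw [h2] at h1
  rw [real_inner_smul_left]
  linarith [hmax z]

/-- This is a scaling argument at the radius δ = τd. As γ - 1 = -σ/m, the gradient satisfies |p|^m =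
(Lγ)^m d^(-σ). The tail is of order Ω d^(-σ), the drift of order L d^(-σ), and the small jumps of
order L d^(γ-σ). Multiplying by d^σ leaves powers of d with nonnegative exponents, which are bounded
for d ≤ R. -/
theorem holder_constant_bound (hB : JumpBounds σ ν j C) {m C' b E D a R : ℝ} (hm : 1 < m)
    (hmσ : σ < m) (hC' : 0 ≤ C')
    (hdrift : ∀ δ, 0 < δ → ∫⁻ z in (Metric.ball (0 : Eucl N) δ)ᶜ,
      ENNReal.ofReal (min 1 (‖z‖ ^ (σ / m))) ∂ν ≤ ENNReal.ofReal (C' * δ ^ (σ / m - σ)))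
    (hb : 0 < b) (hE : 0 ≤ E) (hD : 0 ≤ D)
    (hH : ∀ x p : Eucl N, b * ‖p‖ ^ m - E * ‖p‖ - D ≤ H x p) (ha : 0 ≤ a) (hR : 0 ≤ R) :
    ∃ Λ, 0 ≤ Λ ∧ ∀ (u g : Eucl N → ℝ) (M Ω L : ℝ) (x₀ y : Eucl N), Continuous u →
      (∀ x, |u x| ≤ M) → JetSub σ C ν j H g u → (∀ x, g x ≤ a) → (∀ x y, u x - u y ≤ Ω) →
      0 < L → y ≠ x₀ → ‖y - x₀‖ ≤ R →
      (∀ z, u z - L * ‖z - x₀‖ ^ ((m - σ) / m) ≤ u y - L * ‖y - x₀‖ ^ ((m - σ) / m)) →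
      L ^ m ≤ Λ * (1 + L + Ω) := by
  have hm0 : 0 < m := by linarith
  have hσ := hB.sigma_pos
  have hC := hB.pos
  have hσm : σ / m ≤ 1 := by rw [div_le_one hm0]; exact hmσ.le
  have hσm' : σ / m ≤ σ := div_le_self hσ.le hm.le
  set γ := (m - σ) / m with hγ
  have hγ' : γ = 1 - σ / m := by rw [hγ]; field_simp
  have hσm0 : 0 < σ / m := by positivity
  have hγ0 : 0 < γ := div_pos (by linarith) hm0
  have hγ1 : γ < 1 := by linarith
  -- This choice ensures τd < 1 for all d ≤ R, so that δ = τd is an admissible radius.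
  set τ := 1 / (R + 1) with hτ
  have hτ0 : 0 < τ := by positivity
  set Q := (a + D) * R ^ σ + E * γ * R ^ (σ - σ / m) + C * τ ^ (-σ)
    + γ * C * C' * τ ^ (σ / m - σ) + γ / 2 * C * τ ^ (2 - σ) * R ^ γ with hQ
  have hQ0 : 0 ≤ Q := by positivity
  have hbγ : 0 < b * γ ^ m := by positivity
  refine ⟨Q / (b * γ ^ m), by positivity, ?_⟩
  intro u g M Ω L x₀ y hu hM hsub hg hΩ hL hy hyR hmax
  have hΩ0 : 0 ≤ Ω := by simpa using hΩ y y
  have ht := touchAbove_of_isMax_cone hL hγ0 hγ1 hy hmax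
  have hd : 0 < ‖y - x₀‖ := norm_pos_iff.2 (sub_ne_zero.2 hy)
  set d := ‖y - x₀‖ with hdd
  set p : Eucl N := (L * γ * d ^ (γ - 2)) • (y - x₀) with hp
  have hδ : 0 < τ * d := by positivity
  have hδ1 : τ * d < 1 := by
    rw [hτ, one_div_mul_eq_div, div_lt_one (by linarith)]; linarith
  have hpn : ‖p‖ = L * γ * d ^ (-(σ / m)) := by
    rw [hp, norm_smul, Real.norm_eq_abs, abs_of_pos (by positivity), ← hdd, mul_assoc (L * γ)]
    congr 1
    conv_lhs => rw [← Real.rpow_one d, ← Real.rpow_mul hd.le, one_mul, ← Real.rpow_add hd]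
    congr 1; linarith
  have h1 := hsub y p _ (by positivity) ht (τ * d) hδ hδ1
  have h2 := levyIto_le_of_osc hB hσm hC' hδ (hdrift _ hδ) hu hM hΩ y p
  have h3 := hH y p
  have h4 := hg y
  have hpm : ‖p‖ ^ m = (L * γ) ^ m * d ^ (-σ) := by
    rw [hpn, Real.mul_rpow (by positivity) (by positivity), ← Real.rpow_mul hd.le]
    congr 2; field_simp
  have h5 : b * ((L * γ) ^ m * d ^ (-σ)) ≤ a + D + E * (L * γ * d ^ (-(σ / m)))
      + Ω * (C * (τ * d) ^ (-σ)) + (L * γ * d ^ (-(σ / m))) * C * (C' * (τ * d) ^ (σ / m - σ))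
      + L * (γ / 2) * d ^ (γ - 2) * (C * (τ * d) ^ (2 - σ)) := by
    rw [← hpm, ← hpn]; linarith
  have h6 := mul_le_mul_of_nonneg_right h5 (show 0 ≤ d ^ σ by positivity)
  have r0 : d ^ (-σ) * d ^ σ = 1 := by rw [← Real.rpow_add hd]; simp
  have r1 : d ^ (-(σ / m)) * d ^ σ = d ^ (σ - σ / m) := by rw [← Real.rpow_add hd]; congr 1; ring
  have r2 : d ^ (-(σ / m)) * d ^ (σ / m - σ) * d ^ σ = 1 := by
    rw [← Real.rpow_add hd, ← Real.rpow_add hd, ← Real.rpow_zero d]; congr 1; ring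
  have r3 : d ^ (γ - 2) * d ^ (2 - σ) * d ^ σ = d ^ γ := by
    rw [← Real.rpow_add hd, ← Real.rpow_add hd]; congr 1; ring
  rw [Real.mul_rpow hτ0.le hd.le, Real.mul_rpow hτ0.le hd.le, Real.mul_rpow hτ0.le hd.le] at h6
  have h7 : b * (L * γ) ^ m ≤ (a + D) * d ^ σ + E * (L * γ) * d ^ (σ - σ / m)
      + Ω * (C * τ ^ (-σ)) + L * γ * C * C' * τ ^ (σ / m - σ)
      + L * (γ / 2) * C * τ ^ (2 - σ) * d ^ γ := by
    calc b * (L * γ) ^ m = b * ((L * γ) ^ m * d ^ (-σ)) * d ^ σ := by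
          rw [mul_assoc b, mul_assoc, r0, mul_one]
      _ ≤ _ := h6
      _ = (a + D) * d ^ σ + E * (L * γ) * (d ^ (-(σ / m)) * d ^ σ)
          + Ω * (C * τ ^ (-σ)) * (d ^ (-σ) * d ^ σ)
          + L * γ * C * C' * τ ^ (σ / m - σ) * (d ^ (-(σ / m)) * d ^ (σ / m - σ) * d ^ σ)
          + L * (γ / 2) * C * τ ^ (2 - σ) * (d ^ (γ - 2) * d ^ (2 - σ) * d ^ σ) := by ring
      _ = _ := by rw [r0, r1, r2, r3]; ring
  have s1 : d ^ σ ≤ R ^ σ := Real.rpow_le_rpow hd.le hyR hσ.le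
  have s2 : d ^ (σ - σ / m) ≤ R ^ (σ - σ / m) := Real.rpow_le_rpow hd.le hyR (by linarith)
  have s3 : d ^ γ ≤ R ^ γ := Real.rpow_le_rpow hd.le hyR hγ0.le
  have h8 : b * (L * γ) ^ m ≤ (a + D) * R ^ σ + E * (L * γ) * R ^ (σ - σ / m)
      + Ω * (C * τ ^ (-σ)) + L * γ * C * C' * τ ^ (σ / m - σ)
      + L * (γ / 2) * C * τ ^ (2 - σ) * R ^ γ := h7.trans (by gcongr)
  have h9 : b * γ ^ m * L ^ m ≤ Q * (1 + L + Ω) := by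
    rw [Real.mul_rpow hL.le hγ0.le] at h8
    have t1 : 0 ≤ (a + D) * R ^ σ := by positivity
    have t2 : 0 ≤ E * γ * R ^ (σ - σ / m) := by positivity
    have t3 : 0 ≤ C * τ ^ (-σ) := by positivity
    have t4 : 0 ≤ γ * C * C' * τ ^ (σ / m - σ) := by positivity
    have t5 : 0 ≤ γ / 2 * C * τ ^ (2 - σ) * R ^ γ := by positivity
    have : Q * (1 + L + Ω) - ((a + D) * R ^ σ + E * (L * γ) * R ^ (σ - σ / m)
      + Ω * (C * τ ^ (-σ)) + L * γ * C * C' * τ ^ (σ / m - σ)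
      + L * (γ / 2) * C * τ ^ (2 - σ) * R ^ γ)
      = (a + D) * R ^ σ * (L + Ω) + E * γ * R ^ (σ - σ / m) * (1 + Ω)
        + C * τ ^ (-σ) * (1 + L) + γ * C * C' * τ ^ (σ / m - σ) * (1 + Ω)
        + γ / 2 * C * τ ^ (2 - σ) * R ^ γ * (1 + Ω) := by rw [hQ]; ring
    have t6 : 0 ≤ (a + D) * R ^ σ * (L + Ω) + E * γ * R ^ (σ - σ / m) * (1 + Ω)
        + C * τ ^ (-σ) * (1 + L) + γ * C * C' * τ ^ (σ / m - σ) * (1 + Ω)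
        + γ / 2 * C * τ ^ (2 - σ) * R ^ γ * (1 + Ω) := by positivity
    linarith
  rw [div_mul_eq_mul_div, le_div_iff₀ hbγ]
  linarith

end Regularity

/-! ### Extrema of periodic functions and reduction to a bounded cell. -/

section Periodic

variable {N : ℕ}

theorem exists_max_of_le {E : Type*} [NormedAddCommGroup E] [ProperSpace E] {f : E → ℝ}
    (hf : Continuous f) (x₀ : E) (R : ℝ) (h : ∀ y, R < ‖y - x₀‖ → f y ≤ f x₀) :
    ∃ x, ∀ y, f y ≤ f x := by
  have hx₀ : x₀ ∈ Metric.closedBall x₀ (max R 0) :=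
    Metric.mem_closedBall_self (le_max_right _ _)
  obtain ⟨x, -, hx⟩ := (isCompact_closedBall x₀ (max R 0)).exists_isMaxOn ⟨x₀, hx₀⟩ hf.continuousOn
  refine ⟨x, fun y => ?_⟩
  by_cases hy : y ∈ Metric.closedBall x₀ (max R 0)
  · exact hx hy
  · rw [mem_closedBall_iff_norm, not_le] at hy
    exact (h y ((le_max_left _ _).trans_lt hy)).trans (hx hx₀)

/-- Every point has a lattice translate within this distance of a given point. -/
noncomputable def cellRadius (N : ℕ) : ℝ := √N + 1

theorem one_le_cellRadius : 1 ≤ cellRadius N := by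
  unfold cellRadius; linarith [Real.sqrt_nonneg (N : ℝ)]

theorem exists_translate_near (x x₀ : Eucl N) :
    ∃ k : Fin N → ℤ, ‖x + latticePoint k - x₀‖ ≤ cellRadius N := by
  refine ⟨fun i => -⌊x i - x₀ i⌋, ?_⟩
  have h : ‖x + latticePoint (fun i => -⌊x i - x₀ i⌋) - x₀‖ ≤ √N := by
    rw [EuclideanSpace.norm_eq]
    refine Real.sqrt_le_sqrt ?_
    calc _ ≤ ∑ _i : Fin N, (1 : ℝ) := Finset.sum_le_sum fun i _ => ?_
      _ = N := by simp
    have e : (x + latticePoint (fun i => -⌊x i - x₀ i⌋) - x₀) i = Int.fract (x i - x₀ i) := by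
      simp only [latticePoint, PiLp.sub_apply, PiLp.add_apply, Int.cast_neg]
      rw [← Int.self_sub_floor]; ring
    rw [e, Real.norm_eq_abs, abs_of_nonneg (Int.fract_nonneg _)]
    exact pow_le_one₀ (Int.fract_nonneg _) (Int.fract_lt_one _).le
  unfold cellRadius; linarith

theorem ZPeriodic.exists_max {u : Eucl N → ℝ} (hu : Continuous u) (hp : ZPeriodic u) :
    ∃ x, ∀ y, u y ≤ u x := by
  obtain ⟨x, -, hx⟩ := (isCompact_closedBall (0 : Eucl N) (cellRadius N)).exists_isMaxOn
    ⟨0, Metric.mem_closedBall_self (by linarith [one_le_cellRadius (N := N)])⟩ hu.continuousOn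
  refine ⟨x, fun y => ?_⟩
  obtain ⟨k, hk⟩ := exists_translate_near y 0
  rw [← hp k y]
  exact hx (mem_closedBall_iff_norm.2 hk)

theorem ZPeriodic.neg {u : Eucl N → ℝ} (hp : ZPeriodic u) : ZPeriodic fun x => -u x :=
  fun k x => congrArg Neg.neg (hp k x)

theorem ZPeriodic.exists_min {u : Eucl N → ℝ} (hu : Continuous u) (hp : ZPeriodic u) :
    ∃ x, ∀ y, u x ≤ u y := by
  obtain ⟨x, hx⟩ := hp.neg.exists_max hu.neg
  exact ⟨x, fun y => neg_le_neg_iff.1 (hx y)⟩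

theorem ZPeriodic.exists_bound {u : Eucl N → ℝ} (hu : Continuous u) (hp : ZPeriodic u) :
    ∃ M, ∀ y, |u y| ≤ M := by
  obtain ⟨x, hx⟩ := hp.exists_max hu
  obtain ⟨x', hx'⟩ := hp.exists_min hu
  exact ⟨max (u x) (-u x'), fun y => abs_le.2 ⟨by
    linarith [hx' y, le_max_right (u x) (-u x')], (hx y).trans (le_max_left _ _)⟩⟩

end Periodic

/-! ### Hölder and oscillation estimates deduced from the control of touching cones. -/

section HolderEstimates

variable {N : ℕ}

theorem IsHolder.continuous {γ : ℝ} (hγ : 0 < γ) {u : Eucl N → ℝ} (h : IsHolder γ u) :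
    Continuous u := by
  obtain ⟨L, -, hL⟩ := h
  rw [continuous_iff_continuousAt]
  intro x
  rw [ContinuousAt, tendsto_iff_norm_sub_tendsto_zero]
  have hlim : Tendsto (fun y => L * ‖y - x‖ ^ γ) (𝓝 x) (𝓝 0) := by
    have : Continuous fun y => L * ‖y - x‖ ^ γ :=
      ((continuous_id.sub continuous_const).norm.rpow_const fun _ => Or.inr hγ.le).const_mul L
    simpa [Real.zero_rpow hγ.ne'] using this.tendsto x
  exact squeeze_zero (fun y => norm_nonneg _) (fun y => hL y x) hlim

/-- A priori control of the opening of a cone with exponent `(m - σ) / m` that touches a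
subsolution from above away from its vertex. -/
def HolderControl {N : ℕ} (σ C m a R Λ : ℝ) (ν : Measure (Eucl N))
    (j : Eucl N → Eucl N → Eucl N) (H : Eucl N → Eucl N → ℝ) : Prop :=
  ∀ (u g : Eucl N → ℝ) (M Ω L : ℝ) (x₀ y : Eucl N), Continuous u →
    (∀ x, |u x| ≤ M) → JetSub σ C ν j H g u → (∀ x, g x ≤ a) → (∀ x y, u x - u y ≤ Ω) →
    0 < L → y ≠ x₀ → ‖y - x₀‖ ≤ R →
    (∀ z, u z - L * ‖z - x₀‖ ^ ((m - σ) / m) ≤ u y - L * ‖y - x₀‖ ^ ((m - σ) / m)) →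
    L ^ m ≤ Λ * (1 + L + Ω)

theorem exists_forall_mul_lt_rpow {m : ℝ} (hm : 1 < m) (A : ℝ) :
    ∃ L₀ : ℝ, 1 ≤ L₀ ∧ ∀ L, L₀ ≤ L → A * L < L ^ m := by
  obtain ⟨L₁, hL₁⟩ := eventually_atTop.1
    ((tendsto_rpow_atTop (show 0 < m - 1 by linarith)).eventually_gt_atTop A)
  refine ⟨max 1 L₁, le_max_left _ _, fun L hL => ?_⟩
  have h1 : 0 < L := lt_of_lt_of_le one_pos ((le_max_left _ _).trans hL)
  have h2 := hL₁ L ((le_max_right _ _).trans hL)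
  calc A * L < L ^ (m - 1) * L := mul_lt_mul_of_pos_right h2 h1
    _ = L ^ m := by rw [← Real.rpow_add_one h1.ne', sub_add_cancel]

variable {σ C m a Λ : ℝ} {ν : Measure (Eucl N)} {j : Eucl N → Eucl N → Eucl N}
  {H : Eucl N → Eucl N → ℝ}

/-- Hölder estimate for bounded subsolutions. -/
theorem HolderControl.exists_holder {R : ℝ} (hR : 1 ≤ R) (h : HolderControl σ C m a R Λ ν j H)
    (hm : 1 < m) (hmσ : σ < m) (hΛ : 0 ≤ Λ) {M : ℝ} (hM0 : 0 ≤ M) :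
    ∃ L, 0 < L ∧ ∀ u g : Eucl N → ℝ, Continuous u → (∀ x, |u x| ≤ M) → JetSub σ C ν j H g u →
      (∀ x, g x ≤ a) → ∀ x y, |u x - u y| ≤ L * ‖x - y‖ ^ ((m - σ) / m) := by
  have hγ : 0 < (m - σ) / m := div_pos (by linarith) (by linarith)
  set γ := (m - σ) / m with hγd
  obtain ⟨L₀, hL₀, hL⟩ := exists_forall_mul_lt_rpow hm (Λ * (2 + 2 * M))
  -- With L ≥ 2M the cone dominates the oscillation beyond distance 1, so the maximum is attained
  -- near the vertex. With L ≥ L₀, `HolderControl` excludes a maximum away from the vertex.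
  set L := max L₀ (2 * M) with hLd
  have h1 : 1 ≤ L := hL₀.trans (le_max_left _ _)
  have hL' := hL L (le_max_left _ _)
  refine ⟨L, by linarith, fun u g hu hM hs hg => ?_⟩
  have key : ∀ x₀ z, u z - u x₀ ≤ L * ‖z - x₀‖ ^ γ := by
    intro x₀ z
    by_contra! hcon
    have hf : Continuous fun y => u y - L * ‖y - x₀‖ ^ γ :=
      hu.sub (((continuous_id.sub continuous_const).norm.rpow_const
        fun _ => Or.inr hγ.le).const_mul L)
    have hΩ : ∀ x y, u x - u y ≤ 2 * M := fun x y => by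
      linarith [(abs_le.1 (hM x)).2, (abs_le.1 (hM y)).1]
    have h0 : (0 : ℝ) ^ γ = 0 := Real.zero_rpow hγ.ne'
    have hfar : ∀ y, 1 < ‖y - x₀‖ → u y - L * ‖y - x₀‖ ^ γ ≤ u x₀ := by
      intro y hy
      have : L ≤ L * ‖y - x₀‖ ^ γ :=
        le_mul_of_one_le_right (by linarith) (Real.one_le_rpow hy.le hγ.le)
      linarith [hΩ y x₀, le_max_right L₀ (2 * M)]
    obtain ⟨y, hy⟩ := exists_max_of_le hf x₀ 1 (by simpa [h0] using hfar)
    have hyz := hy z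
    have hyx : y ≠ x₀ := by
      rintro rfl
      rw [sub_self, norm_zero, h0] at hyz
      linarith
    have hyR : ‖y - x₀‖ ≤ R := by
      by_contra! hc
      linarith [hfar y (by linarith)]
    have := h u g M (2 * M) L x₀ y hu hM hs hg hΩ (by linarith) hyx hyR hy
    have h3 : 1 + L + 2 * M ≤ (2 + 2 * M) * L := by nlinarith
    nlinarith [mul_le_mul_of_nonneg_left h3 hΛ]
  intro x y
  rw [abs_le]
  have h1 := key x y
  rw [norm_sub_rev] at h1
  constructor <;> linarith [key y x]

/-- Universal bound for the oscillation of periodic subsolutions. -/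
theorem HolderControl.exists_osc_bound (h : HolderControl σ C m a (cellRadius N) Λ ν j H)
    (hm : 1 < m) (hmσ : σ < m) (hΛ : 0 ≤ Λ) :
    ∃ Ω₀, 0 ≤ Ω₀ ∧ ∀ u g : Eucl N → ℝ, Continuous u → ZPeriodic u → JetSub σ C ν j H g u →
      (∀ x, g x ≤ a) → ∀ x y, u x - u y ≤ Ω₀ := by
  have hγ : 0 < (m - σ) / m := div_pos (by linarith) (by linarith)
  set γ := (m - σ) / m with hγd
  have hR : 0 < cellRadius N := by linarith [one_le_cellRadius (N := N)]
  set T := cellRadius N ^ γ with hT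
  have hTpos : 0 < T := by positivity
  obtain ⟨L₀, hL₀, hL⟩ := exists_forall_mul_lt_rpow hm (Λ * (2 + 2 * T))
  refine ⟨2 * T * L₀, by positivity, fun u g hu hp hs hg => ?_⟩
  obtain ⟨M, hM⟩ := hp.exists_bound hu
  obtain ⟨X, hX⟩ := hp.exists_max hu
  obtain ⟨x₀, hx₀⟩ := hp.exists_min hu
  suffices hmain : u X - u x₀ ≤ 2 * T * L₀ from fun x y => by linarith [hX x, hx₀ y]
  by_contra! hcon
  set Ω := u X - u x₀ with hΩd
  -- The cone with vertex at a minimum rises by only Ω/2 across a cell, so the maximum of the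
  -- difference is not at the vertex. Since Ω is linear in L, the bound on L^m then limits Ω.
  set L := Ω / (2 * T) with hLd
  have hΩL : Ω = 2 * T * L := by rw [hLd]; field_simp
  have hLL : L₀ ≤ L := by
    rw [hLd, le_div_iff₀ (by positivity)]; linarith
  have hL1 : 1 ≤ L := hL₀.trans hLL
  have hf : Continuous fun y => u y - L * ‖y - x₀‖ ^ γ :=
    hu.sub (((continuous_id.sub continuous_const).norm.rpow_const
      fun _ => Or.inr hγ.le).const_mul L)
  obtain ⟨y, hyR, hy⟩ := (isCompact_closedBall x₀ (cellRadius N)).exists_isMaxOn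
    ⟨x₀, Metric.mem_closedBall_self hR.le⟩ hf.continuousOn
  rw [mem_closedBall_iff_norm] at hyR
  have hy' : ∀ z, ‖z - x₀‖ ≤ cellRadius N →
      u z - L * ‖z - x₀‖ ^ γ ≤ u y - L * ‖y - x₀‖ ^ γ := fun z hz =>
    hy (mem_closedBall_iff_norm.2 hz)
  -- Translating a distant point into the cell preserves `u` and lowers the cone.
  have hyg : ∀ z, u z - L * ‖z - x₀‖ ^ γ ≤ u y - L * ‖y - x₀‖ ^ γ := by
    intro z
    by_cases hz : ‖z - x₀‖ ≤ cellRadius N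
    · exact hy' z hz
    · obtain ⟨k, hk⟩ := exists_translate_near z x₀
      have h1 := hy' _ hk
      rw [hp k z] at h1
      have h2 : ‖z + latticePoint k - x₀‖ ^ γ ≤ ‖z - x₀‖ ^ γ :=
        Real.rpow_le_rpow (norm_nonneg _) (hk.trans (not_le.1 hz).le) hγ.le
      nlinarith
  by_cases hyx : y = x₀
  · obtain ⟨k, hk⟩ := exists_translate_near X x₀
    have h1 := hy' _ hk
    rw [hp k X, hyx, sub_self, norm_zero, Real.zero_rpow hγ.ne'] at h1
    have h2 : ‖X + latticePoint k - x₀‖ ^ γ ≤ T := Real.rpow_le_rpow (norm_nonneg _) hk hγ.le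
    have h3 : L * ‖X + latticePoint k - x₀‖ ^ γ ≤ L * T :=
      mul_le_mul_of_nonneg_left h2 (by linarith)
    have h4 : 0 < T * L := by positivity
    linarith
  · have := h u g M Ω L x₀ y hu hM hs hg (fun x y => by linarith [hX x, hx₀ y]) (by linarith)
      hyx hyR hyg
    have h3 : 1 + L + Ω ≤ (2 + 2 * T) * L := by rw [hΩL]; nlinarith
    have h4 := hL L hLL
    nlinarith [mul_le_mul_of_nonneg_left h3 hΛ]

end HolderEstimates

/-! ### Stability of subsolutions -/

section Stability

variable {N : ℕ} {σ C : ℝ} {ν : Measure (Eucl N)} {j : Eucl N → Eucl N → Eucl N}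
  {H : Eucl N → Eucl N → ℝ}

theorem exists_max_sub_paraboloid {u : Eucl N → ℝ} (hu : Continuous u) {M : ℝ}
    (hM : ∀ x, |u x| ≤ M) (x₀ p : Eucl N) {K : ℝ} (hK : 1 ≤ K) :
    ∃ x, ∀ y, u y - inner ℝ p (y - x₀) - K * ‖y - x₀‖ ^ 2
      ≤ u x - inner ℝ p (x - x₀) - K * ‖x - x₀‖ ^ 2 := by
  have hM0 : 0 ≤ M := (abs_nonneg _).trans (hM x₀)
  have hs : Continuous fun y : Eucl N => y - x₀ := continuous_id.sub continuous_const
  refine exists_max_of_le (((hu.sub (continuous_const.inner hs))).sub ((hs.norm.pow 2).const_mul K))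
    x₀ (2 * M + ‖p‖ + 1) fun y hy => ?_
  simp only [sub_self, inner_zero_right, norm_zero]
  have h1 := (abs_le.1 (hM y)).2
  have h2 := (abs_le.1 (hM x₀)).1
  have h3 := (abs_le.1 (abs_real_inner_le_norm p (y - x₀))).1
  have hp := norm_nonneg p
  set t := ‖y - x₀‖
  have h4 : t ^ 2 ≤ K * t ^ 2 := le_mul_of_one_le_left (by positivity) hK
  have h5 : (2 * M + ‖p‖ + 1) * t ≤ t ^ 2 := by nlinarith
  have h6 : 2 * M ≤ 2 * M * t := le_mul_of_one_le_right (by linarith) (by linarith)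
  nlinarith

theorem touchAbove_of_isMax_sub_paraboloid {u : Eucl N → ℝ} {x₀ x p : Eucl N} {K : ℝ}
    (hx : ∀ y, u y - inner ℝ p (y - x₀) - K * ‖y - x₀‖ ^ 2
      ≤ u x - inner ℝ p (x - x₀) - K * ‖x - x₀‖ ^ 2) :
    TouchAbove u x (p + (2 * K) • (x - x₀)) K := by
  intro y
  have h1 : ‖y - x₀‖ ^ 2 = ‖x - x₀‖ ^ 2 + 2 * inner ℝ (x - x₀) (y - x) + ‖y - x‖ ^ 2 :=
    norm_sub_sq_expand x x₀ y
  have h2 : inner ℝ p (y - x₀) = inner ℝ p (x - x₀) + inner ℝ p (y - x) := by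
    rw [← inner_add_right]; congr 1; abel
  have := hx y
  rw [h1, h2] at this
  rw [inner_add_left, real_inner_smul_left]
  linarith

/-- The approximating functions need to be close to `w` from below only at the point under study;
elsewhere the upper bound u ≤ w + ε is enough, since a subsolution needs the large-jump integral
only from above. The lemma thus serves both suprema and uniform limits, and allows the discount to
vary. -/
theorem jetSub_of_approx (hB : JumpBounds σ ν j C)
    (hH : Continuous fun q : Eucl N × Eucl N => H q.1 q.2) {w : Eucl N → ℝ} (hw : Continuous w)
    {M M' : ℝ} (hM : ∀ x, |w x| ≤ M) {a l : ℝ}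
    (h : ∀ x, ∀ ε > 0, ∃ (u : Eucl N → ℝ) (a' l' : ℝ), Continuous u ∧ (∀ y, |u y| ≤ M') ∧
      |a' - a| ≤ ε ∧ |l' - l| ≤ ε ∧ JetSub σ C ν j H (fun y => a' - l' * u y) u ∧
      (∀ y, u y ≤ w y + ε) ∧ w x - ε ≤ u x) :
    JetSub σ C ν j H (fun y => a - l * w y) w := by
  refine jetSub_of_frequently hB hw hM fun x p K hK ht ε hε δ₀ hδ₀ => ?_
  obtain ⟨δ₁, hδ₁, hrate⟩ := exists_small_rate (C := C) hB.sigma_lt (K + 1) hε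
  obtain ⟨δ, hδ, hlt⟩ := exists_between (lt_min (lt_min hδ₀ hδ₁) one_pos)
  simp only [lt_min_iff] at hlt
  obtain ⟨⟨hδδ₀, hδδ₁⟩, hδ1⟩ := hlt
  refine ⟨δ, hδ, hδδ₀, ?_⟩
  suffices hmain : H x p - levyIto ν j (Metric.ball 0 δ)ᶜ w x p
      ≤ a - l * w x + (K + 1) * (C * δ ^ (2 - σ)) by
    linarith [hrate δ hδ hδδ₁]
  have hn : ∀ n : ℕ, (0 : ℝ) < 1 / (n + 1) := fun n => by positivity
  choose u a' l' hu hub ha hl hjet hle hge using fun n : ℕ => h x (1 / (n + 1)) (hn n)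
  -- The opening K + 1 instead of K makes the contact at `x` strict; the surplus ‖X n - x‖² is
  -- bounded by 2/(n+1) and forces X n → x.
  choose X hX using fun n => exists_max_sub_paraboloid (hu n) (hub n) x p
    (show 1 ≤ K + 1 by linarith)
  have hlim : Tendsto (fun n : ℕ => 1 / ((n : ℝ) + 1)) atTop (𝓝 0) :=
    tendsto_one_div_add_atTop_nhds_zero_nat
  have hdist : ∀ n, ‖X n - x‖ ^ 2 ≤ 2 * (1 / ((n : ℝ) + 1)) := by
    intro n
    have h1 := hX n x
    simp only [sub_self, inner_zero_right, norm_zero] at h1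
    linarith [ht (X n), hle n (X n), hge n]
  have hXlim : Tendsto X atTop (𝓝 x) := by
    rw [tendsto_iff_norm_sub_tendsto_zero]
    have h1 : Tendsto (fun n => ‖X n - x‖ ^ 2) atTop (𝓝 0) :=
      squeeze_zero (fun n => by positivity) hdist (by simpa using hlim.const_mul 2)
    simpa [Real.sqrt_sq] using h1.sqrt
  have hPlim : Tendsto (fun n => p + (2 * (K + 1)) • (X n - x)) atTop (𝓝 p) := by
    simpa using tendsto_const_nhds.add ((hXlim.sub_const x).const_smul (2 * (K + 1)))
  have hwX : Tendsto (fun n => w (X n)) atTop (𝓝 (w x)) := (hw.tendsto x).comp hXlim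
  have huX : Tendsto (fun n => u n (X n)) atTop (𝓝 (w x)) := by
    have hc : Continuous fun y : Eucl N => inner ℝ p (y - x) + (K + 1) * ‖y - x‖ ^ 2 :=
      (contDiff_paraboloid x p (K + 1)).continuous
    have hc' : Tendsto (fun n => inner ℝ p (X n - x) + (K + 1) * ‖X n - x‖ ^ 2) atTop (𝓝 0) := by
      have := (hc.tendsto x).comp hXlim
      simp only [sub_self, inner_zero_right, norm_zero] at this
      simpa [Function.comp_def] using this
    refine tendsto_of_tendsto_of_tendsto_of_le_of_le
      (g := fun n : ℕ => w x - 1 / ((n : ℝ) + 1) + (inner ℝ p (X n - x) + (K + 1) * ‖X n - x‖ ^ 2))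
      (h := fun n : ℕ => w (X n) + 1 / ((n : ℝ) + 1)) ?_ ?_ (fun n => ?_) fun n => hle n (X n)
    · simpa using (tendsto_const_nhds.sub hlim).add hc'
    · simpa using hwX.add hlim
    · have h1 := hX n x
      simp only [sub_self, inner_zero_right, norm_zero] at h1
      simp only
      linarith [hge n]
  have halim : Tendsto a' atTop (𝓝 a) := by
    rw [tendsto_iff_norm_sub_tendsto_zero]
    exact squeeze_zero (fun n => norm_nonneg _) ha hlim
  have hllim : Tendsto l' atTop (𝓝 l) := by
    rw [tendsto_iff_norm_sub_tendsto_zero]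
    exact squeeze_zero (fun n => norm_nonneg _) hl hlim
  have hpair := hXlim.prodMk_nhds hPlim
  have hHlim := (hH.tendsto (x, p)).comp hpair
  have hIlim := ((continuous_levyIto hB hw hM hδ).tendsto (x, p)).comp hpair
  have hL : Tendsto (fun n => H (X n) (p + (2 * (K + 1)) • (X n - x))
      - (levyIto ν j (Metric.ball 0 δ)ᶜ w (X n) (p + (2 * (K + 1)) • (X n - x))
        + (w (X n) + 1 / ((n : ℝ) + 1) - u n (X n)) * ν.real (Metric.ball (0 : Eucl N) δ)ᶜ)) atTop
      (𝓝 (H x p - (levyIto ν j (Metric.ball 0 δ)ᶜ w x p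
        + (w x + 0 - w x) * ν.real (Metric.ball (0 : Eucl N) δ)ᶜ))) :=
    hHlim.sub (hIlim.add (((hwX.add hlim).sub huX).mul_const _))
  have hRlim : Tendsto (fun n => a' n - l' n * u n (X n) + (K + 1) * (C * δ ^ (2 - σ))) atTop
      (𝓝 (a - l * w x + (K + 1) * (C * δ ^ (2 - σ)))) :=
    (halim.sub (hllim.mul huX)).add_const _
  have := le_of_tendsto_of_tendsto' hL hRlim fun n => ?_
  · simpa using this
  · have h1 := hjet n (X n) _ (K + 1) (by linarith)
      (touchAbove_of_isMax_sub_paraboloid (hX n)) δ hδ hδ1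
    have h2 := levyIto_mono hB (hu n) hw (hub n) hM (hle n) hδ (X n)
      (p + (2 * (K + 1)) • (X n - x))
    linarith

end Stability

/-! ### Perron's method for the discounted problem -/

section Perron

variable {N : ℕ} {σ C : ℝ} {ν : Measure (Eucl N)} {j : Eucl N → Eucl N → Eucl N}
  {H : Eucl N → Eucl N → ℝ}

theorem jetSuper_of_frequently (hB : JumpBounds σ ν j C) {g u : Eucl N → ℝ} (hu : Continuous u)
    {M : ℝ} (hM : ∀ x, |u x| ≤ M)
    (h : ∀ (x p : Eucl N) (K : ℝ), 0 ≤ K → TouchBelow u x p K → ∀ ε > 0, ∀ δ₀ > 0,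
      ∃ δ, 0 < δ ∧ δ < δ₀ ∧ g x - ε ≤ H x p - levyIto ν j (Metric.ball 0 δ)ᶜ u x p) :
    JetSuper σ C ν j H g u := by
  rw [jetSuper_iff_neg]
  refine jetSub_of_frequently hB hu.neg (M := M) (by simpa using hM)
    fun x p K hK ht ε hε δ₀ hδ₀ => ?_
  obtain ⟨δ, hδ, hlt, hle⟩ :=
    h x (-p) K hK (touchBelow_iff_neg.2 (by simpa using ht)) ε hε δ₀ hδ₀
  refine ⟨δ, hδ, hlt, ?_⟩
  have e := levyIto_neg (ν := ν) (j := j) (Metric.ball 0 δ)ᶜ u x (-p)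
  rw [neg_neg] at e
  change dualHam H x p - levyIto ν j (Metric.ball 0 δ)ᶜ (fun y => -u y) x p ≤ _
  rw [e, dualHam]; linarith

theorem levyIto_ge_of_touchBelow (hB : JumpBounds σ ν j C) {u : Eucl N → ℝ} (hu : Continuous u)
    {M : ℝ} (hM : ∀ x, |u x| ≤ M) {δ' δ : ℝ} (hδ' : 0 < δ') (h : δ' ≤ δ) (hδ1 : δ < 1)
    {x p : Eucl N} {K : ℝ} (hK : 0 ≤ K) (ht : TouchBelow u x p K) :
    levyIto ν j (Metric.ball (0 : Eucl N) δ)ᶜ u x p - K * (C * δ ^ (2 - σ))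
      ≤ levyIto ν j (Metric.ball (0 : Eucl N) δ')ᶜ u x p := by
  have := levyIto_le_of_touchAbove hB (u := fun y => -u y) hu.neg (M := M) (by simpa using hM)
    hδ' h hδ1 hK (touchBelow_iff_neg.1 ht)
  rw [levyIto_neg, levyIto_neg] at this
  linarith

/-- The concave paraboloid used to bump subsolutions. -/
noncomputable def bump (x₀ p : Eucl N) (s K : ℝ) (y : Eucl N) : ℝ :=
  s + inner ℝ p (y - x₀) - K * ‖y - x₀‖ ^ 2

theorem continuous_bump (x₀ p : Eucl N) (s K : ℝ) : Continuous (bump x₀ p s K) := by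
  have hs : Continuous fun y : Eucl N => y - x₀ := continuous_id.sub continuous_const
  exact ((continuous_const.inner hs).const_add s).sub ((hs.norm.pow 2).const_mul K)

theorem bump_expand (x₀ p x y : Eucl N) (s K : ℝ) :
    bump x₀ p s K y = bump x₀ p s K x + inner ℝ (p - (2 * K) • (x - x₀)) (y - x)
      - K * ‖y - x‖ ^ 2 := by
  have h1 : ‖y - x₀‖ ^ 2 = ‖x - x₀‖ ^ 2 + 2 * inner ℝ (x - x₀) (y - x) + ‖y - x‖ ^ 2 :=
    norm_sub_sq_expand x x₀ y
  have h2 : inner ℝ p (y - x₀) = inner ℝ p (x - x₀) + inner ℝ p (y - x) := by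
    rw [← inner_add_right]; congr 1; abel
  rw [bump, bump, h1, h2, inner_sub_left p, real_inner_smul_left]
  ring

/-- Bumping a subsolution by a paraboloid that is a strict subsolution where it is larger. -/
theorem jetSub_max_bump (hB : JumpBounds σ ν j C) {w : Eucl N → ℝ} (hw : Continuous w)
    {M l : ℝ} (hM : ∀ x, |w x| ≤ M) (hsub : JetSub σ C ν j H (fun y => 0 - l * w y) w)
    {x₀ p : Eucl N} {s K δ : ℝ} (hK : 0 ≤ K) (hδ : 0 < δ) (hδ1 : δ < 1)
    (hbump : ∀ x, w x < bump x₀ p s K x → bump x₀ p s K x ≤ M ∧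
      H x (p - (2 * K) • (x - x₀))
        - (levyIto ν j (Metric.ball 0 δ)ᶜ w x (p - (2 * K) • (x - x₀))
          + (w x - bump x₀ p s K x) * ν.real (Metric.ball (0 : Eucl N) δ)ᶜ)
        + K * (C * δ ^ (2 - σ)) ≤ 0 - l * bump x₀ p s K x) :
    Continuous (fun x => max (w x) (bump x₀ p s K x)) ∧
      (∀ x, |max (w x) (bump x₀ p s K x)| ≤ M) ∧
      JetSub σ C ν j H (fun x => 0 - l * max (w x) (bump x₀ p s K x))
        (fun x => max (w x) (bump x₀ p s K x)) := by
  set ψ := bump x₀ p s K with hψ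
  have hc : Continuous fun x => max (w x) (ψ x) := hw.max (continuous_bump x₀ p s K)
  have hb : ∀ x, |max (w x) (ψ x)| ≤ M := by
    intro x
    obtain ⟨h1, h2⟩ := abs_le.1 (hM x)
    refine abs_le.2 ⟨h1.trans (le_max_left _ _), max_le h2 ?_⟩
    rcases le_or_gt (ψ x) (w x) with h | h
    · exact h.trans h2
    · exact (hbump x h).1
  refine ⟨hc, hb, jetSub_of_frequently hB hc hb fun x q K₁ hK₁ ht ε hε δ₀ hδ₀ => ?_⟩
  obtain ⟨δ', hδ', hlt⟩ := exists_between (lt_min hδ₀ hδ)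
  simp only [lt_min_iff] at hlt
  rcases le_or_gt (ψ x) (w x) with h | h
  · have hx : max (w x) (ψ x) = w x := max_eq_left h
    obtain ⟨δ₁, hδ₁, hrate⟩ := exists_small_rate (C := C) hB.sigma_lt K₁ hε
    obtain ⟨δ'', hδ'', hlt''⟩ := exists_between (lt_min hδ' hδ₁)
    simp only [lt_min_iff] at hlt''
    refine ⟨δ'', hδ'', hlt''.1.trans hlt.1, ?_⟩
    have ht' : TouchAbove w x q K₁ := fun y => by
      have := ht y
      simp only [hx] at this
      exact (le_max_left _ _).trans this
    have h1 := hsub x q K₁ hK₁ ht' δ'' hδ'' (by linarith)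
    have h2 := levyIto_mono hB hw hc hM hb (c := 0) (fun y => by simp) hδ'' x q
    simp only [hx, add_zero, sub_self, zero_mul] at h2 ⊢
    linarith [hrate δ'' hδ'' hlt''.2]
  · have hx : max (w x) (ψ x) = ψ x := max_eq_right h.le
    have hbelow : TouchBelow (fun x => max (w x) (ψ x)) x (p - (2 * K) • (x - x₀)) K := fun y => by
      simp only [hx]
      rw [hψ, ← bump_expand]
      exact le_max_right _ _
    -- At such a point the maximum is touched from both sides by paraboloids, so their gradients
    -- coincide.
    have hq : q = p - (2 * K) • (x - x₀) := by
      rw [← sub_eq_zero]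
      refine eq_zero_of_inner_le (K := K₁ + K) fun y => ?_
      have h1 := ht (x + y)
      have h2 := hbelow (x + y)
      rw [add_sub_cancel_left] at h1 h2
      rw [inner_sub_left]
      linarith
    refine ⟨δ', hδ', hlt.1, ?_⟩
    rw [hq]
    obtain ⟨-, h1⟩ := hbump x h
    have h2 := levyIto_ge_of_touchBelow hB hc hb hδ' hlt.2.le hδ1 hK hbelow
    have h3 := levyIto_mono hB hw hc hM hb (c := 0) (fun y => by simp) hδ x
      (p - (2 * K) • (x - x₀))
    simp only [hx, add_zero] at h3 ⊢
    have h4 : (w x - ψ x) * ν.real (Metric.ball (0 : Eucl N) δ)ᶜ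
      = -((ψ x - w x) * ν.real (Metric.ball (0 : Eucl N) δ)ᶜ) := by ring
    rw [h4] at h1
    linarith

theorem JetSub.translate (hj_per : ∀ z : Eucl N, ZPeriodic (fun x => j x z))
    (hH_per : ∀ p : Eucl N, ZPeriodic (fun x => H x p)) {g u : Eucl N → ℝ}
    (h : JetSub σ C ν j H g u) (k : Fin N → ℤ) :
    JetSub σ C ν j H (fun x => g (x + latticePoint k)) (fun x => u (x + latticePoint k)) := by
  intro x p K hK ht δ hδ hδ1
  have h1 := h (x + latticePoint k) p K hK (fun y => ?_) δ hδ hδ1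
  · have e : levyIto ν j (Metric.ball 0 δ)ᶜ (fun x => u (x + latticePoint k)) x p
        = levyIto ν j (Metric.ball 0 δ)ᶜ u (x + latticePoint k) p := by
      have hj : ∀ z, j (x + latticePoint k) z = j x z := fun z => hj_per z k x
      simp only [levyIto_eq, increment, hj, add_right_comm]
    have hH : H (x + latticePoint k) p = H x p := hH_per p k x
    rw [e, ← hH]
    exact h1
  · have := ht (y - latticePoint k)
    simp only [sub_add_cancel] at this
    rwa [sub_right_comm, sub_sub] at this

theorem zero_sub_mul_le_of_bound {l M : ℝ} (hl : 0 < l) {u : Eucl N → ℝ} (hM : ∀ x, |u x| ≤ M)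
    (x : Eucl N) : 0 - l * u x ≤ l * M := by
  nlinarith [(abs_le.1 (hM x)).1]

theorem jetSub_const (hB : JumpBounds σ ν j C) {H₀ : ℝ} (h0 : ∀ x, |H x 0| ≤ H₀) {l : ℝ}
    (hl : 0 < l) : JetSub σ C ν j H (fun _ => 0 - l * -(H₀ / l)) (fun _ => -(H₀ / l)) := by
  intro x p K hK ht δ hδ hδ1
  have hp : p = 0 := eq_zero_of_inner_le (K := K) fun y => by
    have := ht (x + y)
    rw [add_sub_cancel_left] at this
    linarith
  subst hp
  have e : levyIto ν j (Metric.ball 0 δ)ᶜ (fun _ => -(H₀ / l)) x 0 = 0 := by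
    simp [levyIto_eq, increment, indicator]
  have h1 : 0 ≤ K * (C * δ ^ (2 - σ)) := by have := hB.pos; positivity
  have h2 : 0 - l * -(H₀ / l) = H₀ := by field_simp; ring
  rw [e, h2]
  linarith [(abs_le.1 (h0 x)).2]

/-- The supremum of subsolutions is a supersolution: otherwise it could be bumped. -/
theorem jetSuper_of_maximal (hB : JumpBounds σ ν j C)
    (hH : Continuous fun q : Eucl N × Eucl N => H q.1 q.2) {H₀ l : ℝ}
    (h0 : ∀ x, |H x 0| ≤ H₀) (hl : 0 < l) {w : Eucl N → ℝ} (hw : Continuous w)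
    (hM : ∀ x, |w x| ≤ H₀ / l) (hsub : JetSub σ C ν j H (fun y => 0 - l * w y) w)
    (hmax : ∀ u : Eucl N → ℝ, Continuous u → (∀ x, |u x| ≤ H₀ / l) →
      JetSub σ C ν j H (fun y => 0 - l * u y) u → ∀ x, u x ≤ w x) :
    JetSuper σ C ν j H (fun y => 0 - l * w y) w := by
  refine jetSuper_of_frequently hB hw hM fun x₀ p K hK ht ε hε δ₀ hδ₀ => ?_
  by_contra! hcon
  obtain ⟨δ₁, hδ₁, hrate⟩ := exists_small_rate (C := C) hB.sigma_lt (K + 1) hε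
  obtain ⟨δ, hδ, hlt⟩ := exists_between (lt_min (lt_min hδ₀ hδ₁) one_pos)
  simp only [lt_min_iff] at hlt
  obtain ⟨⟨hδδ₀, hδδ₁⟩, hδ1⟩ := hlt
  have hrate := hrate δ hδ hδδ₁
  have hcon := hcon δ hδ hδδ₀
  have hMl : l * (H₀ / l) = H₀ := by field_simp
  -- `w` is below the barrier at the touching point
  have hlt : w x₀ < H₀ / l := by
    -- At the barrier value `x₀` would be a maximum of `w`. Then p = 0 and the nonlocal term is
    -- nonpositive, while H(x₀,0) ≥ -H₀ = -l w(x₀), against `hcon`.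
    refine lt_of_le_of_ne (abs_le.1 (hM x₀)).2 fun heq => ?_
    have hp : p = 0 := by
      rw [← neg_eq_zero]
      refine eq_zero_of_inner_le (K := K) fun y => ?_
      have h1 := ht (x₀ + y)
      rw [add_sub_cancel_left] at h1
      rw [inner_neg_left]
      linarith [(abs_le.1 (hM (x₀ + y))).2]
    have hI : levyIto ν j (Metric.ball 0 δ)ᶜ w x₀ p ≤ 0 := by
      rw [levyIto_eq]
      refine integral_nonpos fun z => ?_
      have : w (x₀ + j x₀ z) ≤ w x₀ := by rw [heq]; exact (abs_le.1 (hM _)).2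
      simp only [increment, hp, inner_zero_left, indicator_zero, Pi.zero_apply]
      linarith
    have h2 := (abs_le.1 (h0 x₀)).1
    rw [heq, hMl, hp] at hcon
    rw [hp] at hI
    linarith
  -- choice of the height of the bump
  set F : Eucl N × ℝ → ℝ := fun q =>
    H q.1 (p - (2 * (K + 1)) • (q.1 - x₀))
      - (levyIto ν j (Metric.ball 0 δ)ᶜ w q.1 (p - (2 * (K + 1)) • (q.1 - x₀))
        + (w q.1 - bump x₀ p (w x₀ + q.2) (K + 1) q.1) * ν.real (Metric.ball (0 : Eucl N) δ)ᶜ)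
      + (K + 1) * (C * δ ^ (2 - σ)) + l * bump x₀ p (w x₀ + q.2) (K + 1) q.1 with hF
  have hsc : Continuous fun q : Eucl N × ℝ => q.1 - x₀ := continuous_fst.sub continuous_const
  have hbc : Continuous fun q : Eucl N × ℝ => bump x₀ p (w x₀ + q.2) (K + 1) q.1 :=
    ((continuous_snd.const_add _).add (continuous_const.inner hsc)).sub
      ((hsc.norm.pow 2).const_mul _)
  have hpc : Continuous fun q : Eucl N × ℝ => (q.1, p - (2 * (K + 1)) • (q.1 - x₀)) :=
    by fun_prop
  have hFc : Continuous F :=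
    (((hH.comp hpc).sub (((continuous_levyIto hB hw hM hδ).comp hpc).add
      (((hw.comp continuous_fst).sub hbc).mul_const _))).add_const _).add (hbc.const_mul l)
  have hb0 : bump x₀ p (w x₀ + 0) (K + 1) x₀ = w x₀ := by simp [bump]
  have hF0 : F (x₀, 0) < 0 := by
    simp only [hF]
    rw [hb0, sub_self x₀, smul_zero, sub_zero, sub_self, zero_mul, add_zero]
    linarith
  have hev : ∀ᶠ q : Eucl N × ℝ in 𝓝 (x₀, 0),
      F q < 0 ∧ bump x₀ p (w x₀ + q.2) (K + 1) q.1 < H₀ / l :=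
    ((hFc.tendsto (x₀, 0)).eventually (gt_mem_nhds hF0)).and
      ((hbc.tendsto (x₀, 0)).eventually (gt_mem_nhds (by simpa only [hb0] using hlt)))
  obtain ⟨ρ, hρ, hball⟩ := Metric.eventually_nhds_iff.1 hev
  -- The bump has opening K + 1 and the touching paraboloid K, so the bump exceeds `w` only where ‖x
  -- - x₀‖² < κ. The bound κ ≤ (ρ/2)² keeps this set inside the ball where the strict inequality
  -- holds.
  set κ := min (ρ / 2) ((ρ / 2) ^ 2) with hκ
  have hκ0 : 0 < κ := by positivity
  have hκ1 : κ < ρ := (min_le_left _ _).trans_lt (by linarith)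
  obtain ⟨hc, hb, hs⟩ := jetSub_max_bump hB hw hM hsub (x₀ := x₀) (p := p) (s := w x₀ + κ)
    (K := K + 1) (by linarith) hδ hδ1 fun x hx => by
      have h1 := ht x
      have h2 : ‖x - x₀‖ ^ 2 < κ := by
        rw [bump] at hx; linarith
      have h3 : ‖x - x₀‖ < ρ := by
        have : ‖x - x₀‖ < ρ / 2 :=
          lt_of_pow_lt_pow_left₀ 2 (by linarith) (h2.trans_le (min_le_right _ _))
        linarith
      have h4 := hball (y := (x, κ)) (by
        rw [Prod.dist_eq, max_lt_iff, dist_eq_norm, Real.dist_eq, sub_zero, abs_of_pos hκ0]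
        exact ⟨h3, hκ1⟩)
      refine ⟨h4.2.le, ?_⟩
      have := h4.1
      simp only [hF] at this
      linarith
  have h1 := hmax _ hc hb hs x₀
  have h2 : bump x₀ p (w x₀ + κ) (K + 1) x₀ = w x₀ + κ := by simp [bump]
  rw [h2] at h1
  linarith [le_max_right (w x₀) (w x₀ + κ)]

/-- The solution is the supremum of all continuous subsolutions bounded by H₀/l. The Hölder estimate
makes them equicontinuous, so the supremum is continuous and no semicontinuous envelopes are needed.
It is periodic because lattice translations preserve the class. -/
theorem exists_discounted_solution (hB : JumpBounds σ ν j C)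
    (hH : Continuous fun q : Eucl N × Eucl N => H q.1 q.2)
    (hj_per : ∀ z : Eucl N, ZPeriodic (fun x => j x z))
    (hH_per : ∀ p : Eucl N, ZPeriodic (fun x => H x p)) {H₀ l m R Λ : ℝ}
    (h0 : ∀ x, |H x 0| ≤ H₀) (hl : 0 < l) (hm : 1 < m) (hmσ : σ < m) (hR : 1 ≤ R) (hΛ : 0 ≤ Λ)
    (hctrl : HolderControl σ C m H₀ R Λ ν j H) :
    ∃ w : Eucl N → ℝ, Continuous w ∧ ZPeriodic w ∧ (∀ x, |w x| ≤ H₀ / l) ∧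
      JetSub σ C ν j H (fun y => 0 - l * w y) w ∧
      JetSuper σ C ν j H (fun y => 0 - l * w y) w := by
  have hH₀ : 0 ≤ H₀ := (abs_nonneg _).trans (h0 0)
  have hM0 : 0 ≤ H₀ / l := by positivity
  have hMl : l * (H₀ / l) = H₀ := by field_simp
  have hγ : 0 < (m - σ) / m := div_pos (by linarith) (by linarith)
  set S : Set (Eucl N → ℝ) := {u | Continuous u ∧ (∀ x, |u x| ≤ H₀ / l) ∧
    JetSub σ C ν j H (fun y => 0 - l * u y) u} with hS
  have hSne : S.Nonempty := ⟨fun _ => -(H₀ / l), continuous_const, fun x => by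
    rw [abs_neg, abs_of_nonneg hM0], jetSub_const hB h0 hl⟩
  set w : Eucl N → ℝ := fun x => sSup ((fun u : Eucl N → ℝ => u x) '' S) with hwd
  have hbdd : ∀ x, BddAbove ((fun u : Eucl N → ℝ => u x) '' S) := fun x =>
    ⟨H₀ / l, by rintro _ ⟨u, hu, rfl⟩; exact (abs_le.1 (hu.2.1 x)).2⟩
  have hne : ∀ x, ((fun u : Eucl N → ℝ => u x) '' S).Nonempty := fun x => hSne.image _
  have hle : ∀ u ∈ S, ∀ x, u x ≤ w x := fun u hu x => le_csSup (hbdd x) ⟨u, hu, rfl⟩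
  have happ : ∀ x, ∀ ε > 0, ∃ u ∈ S, w x - ε < u x := by
    intro x ε hε
    obtain ⟨_, ⟨u, hu, rfl⟩, h⟩ := exists_lt_of_lt_csSup (hne x) (sub_lt_self (w x) hε)
    exact ⟨u, hu, h⟩
  have hM : ∀ x, |w x| ≤ H₀ / l := by
    intro x
    obtain ⟨u, hu⟩ := hSne
    exact abs_le.2 ⟨(abs_le.1 (hu.2.1 x)).1.trans (hle u hu x),
      csSup_le (hne x) (by rintro _ ⟨u, hu, rfl⟩; exact (abs_le.1 (hu.2.1 x)).2)⟩
  obtain ⟨L, hL, hhol⟩ := hctrl.exists_holder hR hm hmσ hΛ hM0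
  have hholw : ∀ x y, w x - w y ≤ L * ‖x - y‖ ^ ((m - σ) / m) := by
    intro x y
    refine le_of_forall_pos_le_add fun ε hε => ?_
    obtain ⟨u, hu, hlt⟩ := happ x ε hε
    have := (abs_le.1 (hhol u _ hu.1 hu.2.1 hu.2.2 (fun z => by
      have := zero_sub_mul_le_of_bound hl hu.2.1 z
      rwa [hMl] at this) x y)).2
    linarith [hle u hu y]
  have hw : Continuous w := IsHolder.continuous hγ ⟨L, hL.le, fun x y => by
    have := hholw y x
    rw [norm_sub_rev] at this
    exact abs_le.2 ⟨by linarith, hholw x y⟩⟩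
  have hsub : JetSub σ C ν j H (fun y => 0 - l * w y) w := by
    refine jetSub_of_approx hB hH hw hM (M' := H₀ / l) fun x ε hε => ?_
    obtain ⟨u, hu, hlt⟩ := happ x ε hε
    exact ⟨u, 0, l, hu.1, hu.2.1, by simpa using hε.le, by simpa using hε.le, hu.2.2,
      fun y => by linarith [hle u hu y], hlt.le⟩
  have hper : ∀ (k : Fin N → ℤ) (x : Eucl N), w x ≤ w (x + latticePoint k) := by
    intro k x
    refine csSup_le (hne x) ?_
    rintro _ ⟨u, hu, rfl⟩
    have hmem : (fun y => u (y + latticePoint (-k))) ∈ S :=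
      ⟨hu.1.comp (continuous_add_const _), fun y => hu.2.1 _,
        hu.2.2.translate hj_per hH_per (-k)⟩
    have := hle _ hmem (x + latticePoint k)
    have e : x + latticePoint k + latticePoint (-k) = x := by
      ext i; simp [latticePoint]
    simpa only [e] using this
  refine ⟨w, hw, fun k x => le_antisymm ?_ (hper k x), hM, hsub,
    jetSuper_of_maximal hB hH h0 hl hw hM hsub fun u hu hub hus => hle u ⟨hu, hub, hus⟩⟩
  have := hper (-k) (x + latticePoint k)
  have e : x + latticePoint k + latticePoint (-k) = x := by
    ext i; simp [latticePoint]
  rwa [e] at this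

end Perron

/-! ### Vanishing discount -/

section VanishingDiscount

variable {N : ℕ} {σ C : ℝ} {ν : Measure (Eucl N)} {j : Eucl N → Eucl N → Eucl N}
  {H : Eucl N → Eucl N → ℝ}

theorem JetSub.sub_const {g u : Eucl N → ℝ} (h : JetSub σ C ν j H g u) (k : ℝ) :
    JetSub σ C ν j H g (fun x => u x - k) := by
  intro x p K hK ht δ hδ hδ1
  have h1 := h x p K hK (fun y => by linarith [ht y]) δ hδ hδ1
  have e : levyIto ν j (Metric.ball 0 δ)ᶜ (fun x => u x - k) x p
      = levyIto ν j (Metric.ball 0 δ)ᶜ u x p := by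
    simp only [levyIto_eq, increment, sub_sub_sub_cancel_right]
  rwa [e]

theorem JetSuper.sub_const {g u : Eucl N → ℝ} (h : JetSuper σ C ν j H g u) (k : ℝ) :
    JetSuper σ C ν j H g (fun x => u x - k) := by
  intro x p K hK ht δ hδ hδ1
  have h1 := h x p K hK (fun y => by linarith [ht y]) δ hδ hδ1
  have e : levyIto ν j (Metric.ball 0 δ)ᶜ (fun x => u x - k) x p
      = levyIto ν j (Metric.ball 0 δ)ᶜ u x p := by
    simp only [levyIto_eq, increment, sub_sub_sub_cancel_right]
  rwa [e]

/-- Equi-Hölder, equibounded sequences of periodic functions have uniform cluster points. -/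
theorem exists_uniform_cluster {γ L Ω B : ℝ} (hγ : 0 < γ) (v : ℕ → Eucl N → ℝ) (c : ℕ → ℝ)
    (hper : ∀ n, ZPeriodic (v n)) (hhol : ∀ n x y, |v n x - v n y| ≤ L * ‖x - y‖ ^ γ)
    (hΩ : ∀ n x, |v n x| ≤ Ω) (hc : ∀ n, |c n| ≤ B) :
    ∃ (c₀ : ℝ) (v₀ : Eucl N → ℝ), ZPeriodic v₀ ∧ (∀ x y, |v₀ x - v₀ y| ≤ L * ‖x - y‖ ^ γ) ∧
      (∀ x, |v₀ x| ≤ Ω) ∧ ∀ ε > 0, ∀ n₀, ∃ n ≥ n₀, |c n - c₀| ≤ ε ∧ ∀ x, |v n x - v₀ x| ≤ ε := by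
  set A : Set (ℝ × (Eucl N → ℝ)) := {q | (∀ (k : Fin N → ℤ) (x : Eucl N),
    q.2 (x + latticePoint k) = q.2 x) ∧ ∀ x y, |q.2 x - q.2 y| ≤ L * ‖x - y‖ ^ γ} with hA
  have hev : ∀ x, Continuous fun q : ℝ × (Eucl N → ℝ) => q.2 x := fun x =>
    (continuous_apply x).comp continuous_snd
  have hAc : IsClosed A := by
    simp only [hA, ofPred_and, ofPred_forall]
    refine IsClosed.inter (isClosed_iInter fun k => isClosed_iInter fun x =>
      isClosed_eq (hev _) (hev _)) (isClosed_iInter fun x => isClosed_iInter fun y =>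
      isClosed_le ((hev x).sub (hev y)).abs continuous_const)
  -- Compactness comes from Tychonoff's theorem for pointwise convergence; the common Hölder bound
  -- and a finite net of the cell upgrade it to uniform convergence.
  have hK : IsCompact ((Icc (-B) B ×ˢ Set.pi univ fun _ : Eucl N => Icc (-Ω) Ω) ∩ A) :=
    (isCompact_Icc.prod (isCompact_univ_pi fun _ => isCompact_Icc)).inter_right hAc
  obtain ⟨⟨c₀, v₀⟩, hmem, hcl⟩ := hK.exists_mapClusterPt_of_frequently (l := atTop)
    (f := fun n => (c n, v n)) (Eventually.of_forall fun n =>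
      ⟨⟨abs_le.1 (hc n), fun x _ => abs_le.1 (hΩ n x)⟩, hper n, hhol n⟩).frequently
  refine ⟨c₀, v₀, hmem.2.1, hmem.2.2, fun x => abs_le.2 (hmem.1.2 x (mem_univ x)),
    fun ε hε n₀ => ?_⟩
  -- a radius on which all functions oscillate little
  have hlim : Tendsto (fun r : ℝ => L * r ^ γ) (𝓝 0) (𝓝 0) := by
    have : ContinuousAt (fun r : ℝ => L * r ^ γ) 0 :=
      (Real.continuousAt_rpow_const _ _ (Or.inr hγ.le)).const_mul L
    simpa [ContinuousAt, Real.zero_rpow hγ.ne'] using this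
  obtain ⟨r, hr, hrr⟩ := Metric.eventually_nhds_iff.1
    (hlim.eventually (gt_mem_nhds (show 0 < ε / 3 by positivity)))
  obtain ⟨t, -, htf, htc⟩ :=
    (isCompact_closedBall (0 : Eucl N) (cellRadius N)).finite_cover_balls hr
  have hnhds : {q : ℝ × (Eucl N → ℝ) | |q.1 - c₀| < ε ∧ ∀ y ∈ t, |q.2 y - v₀ y| < ε / 3}
      ∈ 𝓝 (c₀, v₀) := by
    have h1 : ∀ᶠ q : ℝ × (Eucl N → ℝ) in 𝓝 (c₀, v₀), |q.1 - c₀| < ε := by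
      have : Continuous fun q : ℝ × (Eucl N → ℝ) => |q.1 - c₀| :=
        (continuous_fst.sub continuous_const).abs
      exact (this.tendsto (c₀, v₀)).eventually (gt_mem_nhds (by simpa using hε))
    have h2 : ∀ᶠ q : ℝ × (Eucl N → ℝ) in 𝓝 (c₀, v₀), ∀ y ∈ t, |q.2 y - v₀ y| < ε / 3 := by
      refine (eventually_all_finite htf).2 fun y _ => ?_
      have : Continuous fun q : ℝ × (Eucl N → ℝ) => |q.2 y - v₀ y| :=
        ((hev y).sub continuous_const).abs
      refine (this.tendsto (c₀, v₀)).eventually (gt_mem_nhds ?_)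
      simpa using hε
    exact h1.and h2
  obtain ⟨n, hn, hn1, hn2⟩ := frequently_atTop.1 (hcl.frequently hnhds) n₀
  refine ⟨n, hn, hn1.le, fun x => ?_⟩
  obtain ⟨k, hk⟩ := exists_translate_near x 0
  obtain ⟨y, hyt, hy⟩ := mem_iUnion₂.1 (htc (mem_closedBall_iff_norm.2 hk))
  rw [← hper n k x, ← show v₀ (x + latticePoint k) = v₀ x from hmem.2.1 k x]
  set z := x + latticePoint k
  have hzy : L * ‖z - y‖ ^ γ < ε / 3 := hrr (by
    rw [dist_zero_right, norm_norm, ← dist_eq_norm]; exact hy)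
  have h1 := abs_le.1 (hhol n z y)
  have h2 := abs_le.1 (hmem.2.2 z y)
  have h3 := abs_le.1 (hn2 y hyt).le
  simp only at h2 h3
  rw [abs_le]; constructor <;> linarith

/-- With discount 1/(n+1), the solutions normalized at the origin and the constants W n 0/(n+1) are
bounded, because the right-hand sides -l W n are at most H₀ for every n. A cluster point solves the
ergodic problem by stability, applied also to the negatives. -/
theorem exists_ergodic_pair (hB : JumpBounds σ ν j C)
    (hH : Continuous fun q : Eucl N × Eucl N => H q.1 q.2)
    (hj_per : ∀ z : Eucl N, ZPeriodic (fun x => j x z))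
    (hH_per : ∀ p : Eucl N, ZPeriodic (fun x => H x p)) {H₀ m Λ : ℝ}
    (h0 : ∀ x, |H x 0| ≤ H₀) (hm : 1 < m) (hmσ : σ < m) (hΛ : 0 ≤ Λ)
    (hctrl : HolderControl σ C m H₀ (cellRadius N) Λ ν j H) :
    ∃ (c : ℝ) (w : Eucl N → ℝ), IsHolder ((m - σ) / m) w ∧ IsErgodicSolution ν j H c w := by
  have hγ : 0 < (m - σ) / m := div_pos (by linarith) (by linarith)
  have hn : ∀ n : ℕ, (0 : ℝ) < 1 / (n + 1) := fun n => by positivity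
  choose W hW hWper hWM hWsub hWsuper using fun n : ℕ =>
    exists_discounted_solution hB hH hj_per hH_per h0 (hn n) hm hmσ one_le_cellRadius hΛ hctrl
  have hg : ∀ (n : ℕ) x, 0 - 1 / ((n : ℝ) + 1) * W n x ≤ H₀ := by
    intro n x
    have := zero_sub_mul_le_of_bound (hn n) (hWM n) x
    rwa [mul_div_cancel₀ _ (hn n).ne'] at this
  obtain ⟨Ω₀, hΩ₀, hosc⟩ := hctrl.exists_osc_bound hm hmσ hΛ
  obtain ⟨L, hL, hhol⟩ := hctrl.exists_holder one_le_cellRadius hm hmσ hΛ hΩ₀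
  have hosc' := fun n => hosc (W n) _ (hW n) (hWper n) (hWsub n) (hg n)
  set v : ℕ → Eucl N → ℝ := fun n x => W n x - W n 0 with hv
  set c : ℕ → ℝ := fun n => 1 / ((n : ℝ) + 1) * W n 0 with hc
  have hvb : ∀ n x, |v n x| ≤ Ω₀ := fun n x =>
    abs_le.2 ⟨by linarith [hosc' n 0 x], hosc' n x 0⟩
  have hvc : ∀ n, Continuous (v n) := fun n => (hW n).sub continuous_const
  have heq : ∀ (n : ℕ) x, 0 - 1 / ((n : ℝ) + 1) * W n x = -c n - 1 / ((n : ℝ) + 1) * v n x :=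
    fun n x => by simp only [hc, hv]; ring
  have hvsub : ∀ n, JetSub σ C ν j H (fun x => -c n - 1 / ((n : ℝ) + 1) * v n x) (v n) := fun n =>
    ((hWsub n).sub_const (W n 0)).congr (heq n)
  have hvsuper : ∀ n, JetSub σ C ν j (dualHam H)
      (fun x => c n - 1 / ((n : ℝ) + 1) * (-v n x)) (fun x => -v n x) := fun n =>
    (jetSuper_iff_neg.1 ((hWsuper n).sub_const (W n 0))).congr fun x => by rw [heq n]; ring
  obtain ⟨c₀, v₀, hper₀, hhol₀, hb₀, hclose⟩ := exists_uniform_cluster hγ v c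
    (fun n k x => by simp only [hv, hWper n k x])
    (fun n x y => hhol (v n) _ (hvc n) (hvb n) (hvsub n) (fun x => (heq n x).symm.trans_le (hg n x))
      x y) hvb (B := H₀) fun n => by
        have := mul_le_mul_of_nonneg_left (hWM n 0) (hn n).le
        rw [mul_div_cancel₀ _ (hn n).ne'] at this
        rwa [hc, abs_mul, abs_of_pos (hn n)]
  have hholder : IsHolder ((m - σ) / m) v₀ := ⟨L, hL.le, hhol₀⟩
  have hv₀ := hholder.continuous hγ
  have hclose' : ∀ ε > 0, ∃ n : ℕ, |c n - c₀| ≤ ε ∧ 1 / ((n : ℝ) + 1) ≤ ε ∧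
      ∀ x, |v n x - v₀ x| ≤ ε := by
    intro ε hε
    obtain ⟨n₀, hn₀⟩ := exists_nat_one_div_lt hε
    obtain ⟨n, hnn, h1, h2⟩ := hclose ε hε n₀
    exact ⟨n, h1, (Nat.one_div_le_one_div hnn).trans hn₀.le, h2⟩
  have hsub : JetSub σ C ν j H (fun x => -c₀ - 0 * v₀ x) v₀ := by
    refine jetSub_of_approx hB hH hv₀ hb₀ (M' := Ω₀) fun x ε hε => ?_
    obtain ⟨n, h1, h2, h3⟩ := hclose' ε hε
    refine ⟨v n, -c n, 1 / ((n : ℝ) + 1), hvc n, hvb n, ?_, ?_, hvsub n, fun y => ?_, ?_⟩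
    · rwa [← abs_neg, show -(-c n - -c₀) = c n - c₀ by ring]
    · rwa [sub_zero, abs_of_pos (hn n)]
    · linarith [(abs_le.1 (h3 y)).2]
    · linarith [(abs_le.1 (h3 x)).1]
  have hH' : Continuous fun q : Eucl N × Eucl N => dualHam H q.1 q.2 :=
    (hH.comp (continuous_fst.prodMk continuous_snd.neg)).neg
  have hsuper : JetSub σ C ν j (dualHam H) (fun x => c₀ - 0 * (-v₀ x)) (fun x => -v₀ x) := by
    refine jetSub_of_approx hB hH' hv₀.neg (M := Ω₀) (by simpa using hb₀) (M' := Ω₀)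
      fun x ε hε => ?_
    obtain ⟨n, h1, h2, h3⟩ := hclose' ε hε
    refine ⟨fun x => -v n x, c n, 1 / ((n : ℝ) + 1), (hvc n).neg, by simpa using hvb n, h1, ?_,
      hvsuper n, fun y => ?_, ?_⟩
    · rwa [sub_zero, abs_of_pos (hn n)]
    · change -v n y ≤ -v₀ y + ε
      linarith [(abs_le.1 (h3 y)).1]
    · change -v₀ x - ε ≤ -v n x
      linarith [(abs_le.1 (h3 x)).2]
  exact ⟨c₀, v₀, hholder, hper₀,
    isViscSubsolution_of_jetSub hB hv₀ hb₀ (hsub.congr fun x => by ring),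
    isViscSupersolution_of_jetSuper hB hv₀ hb₀
      (jetSuper_iff_neg.2 (hsuper.congr fun x => by ring))⟩

end VanishingDiscount

/-! ### Doubling of variables -/

section Doubling

variable {N : ℕ} {σ C : ℝ} {ν : Measure (Eucl N)} {j : Eucl N → Eucl N → Eucl N}
  {F H : Eucl N → Eucl N → ℝ}

theorem le_add_one_of_sq_le {t c : ℝ} (hc : t ^ 2 ≤ c) : t ≤ c + 1 := by
  nlinarith [sq_nonneg (t - 1), sq_nonneg t]

/-- Penalizing with 2β where contact holds with β leaves a surplus: at the maxima, β‖X - ξ‖² +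
(n+1)‖X - Y‖² ≤ v X - v Y. Boundedness of `v` gives ‖X - Y‖ → 0; uniform continuity on a ball then
sends the whole left side to 0. -/
theorem exists_doubling_points {f v : Eucl N → ℝ} (hf : Continuous f) (hv : Continuous v) {M : ℝ}
    (hM : ∀ x, |v x| ≤ M) {ξ q : Eucl N} {β : ℝ} (hβ : 0 < β)
    (hT : ∀ x, f x - v x ≤ f ξ - v ξ + inner ℝ q (x - ξ) + β * ‖x - ξ‖ ^ 2) :
    ∃ X Y : ℕ → Eucl N, (∀ (n : ℕ) x y,
      f x - v y - inner ℝ q (x - ξ) - 2 * β * ‖x - ξ‖ ^ 2 - ((n : ℝ) + 1) * ‖x - y‖ ^ 2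
        ≤ f (X n) - v (Y n) - inner ℝ q (X n - ξ) - 2 * β * ‖X n - ξ‖ ^ 2
          - ((n : ℝ) + 1) * ‖X n - Y n‖ ^ 2) ∧
      Tendsto X atTop (𝓝 ξ) ∧ Tendsto Y atTop (𝓝 ξ) ∧
      Tendsto (fun n : ℕ => ((n : ℝ) + 1) * ‖X n - Y n‖ ^ 2) atTop (𝓝 0) := by
  have hM0 : 0 ≤ M := (abs_nonneg _).trans (hM ξ)
  have hvv : ∀ x y, v x - v y ≤ 2 * M := fun x y => by
    linarith [(abs_le.1 (hM x)).2, (abs_le.1 (hM y)).1]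
  -- pairs where the penalized function is at least its value on the diagonal
  have hpen : ∀ (n : ℕ) x y, f ξ - v ξ ≤ f x - v y - inner ℝ q (x - ξ) - 2 * β * ‖x - ξ‖ ^ 2
      - ((n : ℝ) + 1) * ‖x - y‖ ^ 2 →
      β * ‖x - ξ‖ ^ 2 + ((n : ℝ) + 1) * ‖x - y‖ ^ 2 ≤ v x - v y := by
    intro n x y h
    linarith [hT x]
  have hn1 : ∀ n : ℕ, (1 : ℝ) ≤ (n : ℝ) + 1 := fun n => by
    linarith [Nat.cast_nonneg (α := ℝ) n]
  have hbdd : ∀ (n : ℕ) x y, f ξ - v ξ ≤ f x - v y - inner ℝ q (x - ξ) - 2 * β * ‖x - ξ‖ ^ 2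
      - ((n : ℝ) + 1) * ‖x - y‖ ^ 2 →
      ‖x - ξ‖ ≤ 2 * M / β + 1 ∧ ‖y - ξ‖ ≤ 2 * M / β + 1 + (2 * M + 1) := by
    intro n x y h
    have h1 := hpen n x y h
    have h2 := hvv x y
    have h3 : 0 ≤ β * ‖x - ξ‖ ^ 2 := by positivity
    have h4 : ‖x - y‖ ^ 2 ≤ ((n : ℝ) + 1) * ‖x - y‖ ^ 2 :=
      le_mul_of_one_le_left (by positivity) (hn1 n)
    have h5 : 0 ≤ ‖x - y‖ ^ 2 := by positivity
    have h6 : ‖x - ξ‖ ≤ 2 * M / β + 1 := le_add_one_of_sq_le (by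
      rw [le_div_iff₀ hβ]; linarith)
    have h7 : ‖x - y‖ ≤ 2 * M + 1 := le_add_one_of_sq_le (by linarith)
    refine ⟨h6, ?_⟩
    have h8 : ‖y - ξ‖ ≤ ‖y - x‖ + ‖x - ξ‖ := norm_sub_le_norm_sub_add_norm_sub y x ξ
    rw [norm_sub_rev y x] at h8
    linarith
  set R := 2 * M / β + 1 + (2 * M + 1) with hR
  have hmax : ∀ n : ℕ, ∃ z : Eucl N × Eucl N, ∀ z' : Eucl N × Eucl N,
      f z'.1 - v z'.2 - inner ℝ q (z'.1 - ξ) - 2 * β * ‖z'.1 - ξ‖ ^ 2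
        - ((n : ℝ) + 1) * ‖z'.1 - z'.2‖ ^ 2
      ≤ f z.1 - v z.2 - inner ℝ q (z.1 - ξ) - 2 * β * ‖z.1 - ξ‖ ^ 2
        - ((n : ℝ) + 1) * ‖z.1 - z.2‖ ^ 2 := by
    intro n
    refine exists_max_of_le (E := Eucl N × Eucl N) (by fun_prop) (ξ, ξ) R fun z hz => ?_
    by_contra! hcon
    simp only [sub_self, inner_zero_right, norm_zero] at hcon
    obtain ⟨h1, h2⟩ := hbdd n z.1 z.2 (by linarith)
    rw [Prod.norm_def, lt_max_iff] at hz
    rcases hz with hz | hz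
    · simp only [Prod.fst_sub] at hz; linarith
    · simp only [Prod.snd_sub] at hz; linarith
  choose Z hZ using hmax
  have hZξ : ∀ n : ℕ, f ξ - v ξ ≤ f (Z n).1 - v (Z n).2 - inner ℝ q ((Z n).1 - ξ)
      - 2 * β * ‖(Z n).1 - ξ‖ ^ 2 - ((n : ℝ) + 1) * ‖(Z n).1 - (Z n).2‖ ^ 2 := fun n => by
    have := hZ n (ξ, ξ)
    simp only [sub_self, inner_zero_right, norm_zero] at this
    linarith
  have hsum := fun n => hpen n _ _ (hZξ n)
  have hlim0 : Tendsto (fun n : ℕ => 2 * M * (1 / ((n : ℝ) + 1))) atTop (𝓝 0) := by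
    simpa using (tendsto_one_div_add_atTop_nhds_zero_nat (𝕜 := ℝ)).const_mul (2 * M)
  have hsq_to : ∀ {g : ℕ → ℝ}, (∀ n, 0 ≤ g n) → Tendsto (fun n => g n ^ 2) atTop (𝓝 0) →
      Tendsto g atTop (𝓝 0) := by
    intro g hg h
    have := h.sqrt
    simpa [Real.sqrt_sq, hg] using this
  have hXY : Tendsto (fun n => ‖(Z n).1 - (Z n).2‖) atTop (𝓝 0) := by
    refine hsq_to (fun n => norm_nonneg _) (squeeze_zero (fun n => by positivity) (fun n => ?_) hlim0)
    have h1 := hsum n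
    have h2 := hvv (Z n).1 (Z n).2
    have h3 : 0 ≤ β * ‖(Z n).1 - ξ‖ ^ 2 := by positivity
    rw [mul_one_div, le_div_iff₀ (by linarith [hn1 n])]
    linarith
  have huc := (isCompact_closedBall ξ R).uniformContinuousOn_of_continuous hv.continuousOn
  have hvlim : Tendsto (fun n => v (Z n).1 - v (Z n).2) atTop (𝓝 0) := by
    rw [Metric.tendsto_atTop]
    intro ε hε
    obtain ⟨η, hη, hh⟩ := Metric.uniformContinuousOn_iff.1 huc ε hε
    obtain ⟨n₀, hn₀⟩ := Metric.tendsto_atTop.1 hXY η hη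
    refine ⟨n₀, fun n hn => ?_⟩
    obtain ⟨h1, h2⟩ := hbdd n _ _ (hZξ n)
    have h3 := hh (Z n).1 (mem_closedBall_iff_norm.2 (by rw [hR]; linarith)) (Z n).2
      (mem_closedBall_iff_norm.2 h2) (by
        have := hn₀ n hn
        rwa [dist_zero_right, norm_norm, ← dist_eq_norm] at this)
    rwa [dist_zero_right, ← dist_eq_norm]
  have hX : Tendsto (fun n => (Z n).1) atTop (𝓝 ξ) := by
    rw [tendsto_iff_norm_sub_tendsto_zero]
    have h0 : Tendsto (fun n => (v (Z n).1 - v (Z n).2) / β) atTop (𝓝 0) := by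
      simpa using hvlim.div_const β
    refine hsq_to (fun n => norm_nonneg _) (squeeze_zero (fun n => by positivity) (fun n => ?_) h0)
    have h1 := hsum n
    have h3 : 0 ≤ ((n : ℝ) + 1) * ‖(Z n).1 - (Z n).2‖ ^ 2 := by positivity
    rw [le_div_iff₀ hβ]; linarith
  refine ⟨fun n => (Z n).1, fun n => (Z n).2, fun n x y => hZ n (x, y), hX, ?_, ?_⟩
  · have := hX.sub (tendsto_zero_iff_norm_tendsto_zero.2 hXY)
    simpa using this
  · refine squeeze_zero (fun n => by positivity) (fun n => ?_) hvlim
    have h1 := hsum n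
    have h3 : 0 ≤ β * ‖(Z n).1 - ξ‖ ^ 2 := by positivity
    linarith

theorem setIntegral_sq_sub_le (hB : JumpBounds σ ν j C) (hJ2 : CondJ2 ν j) :
    ∃ C₁, 0 ≤ C₁ ∧ ∀ (A : Set (Eucl N)) (x y : Eucl N), A ⊆ Metric.ball 0 1 →
      IntegrableOn (fun z => ‖j x z - j y z‖ ^ 2) A ν ∧
        ∫ z in A, ‖j x z - j y z‖ ^ 2 ∂ν ≤ C₁ * ‖x - y‖ ^ 2 := by
  obtain ⟨C₁, hC₁, h⟩ := hJ2 1 one_pos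
  exact ⟨C₁, hC₁.le, fun A x y hA => integrableOn_and_setIntegral_le
    (((hB.meas x).sub (hB.meas y)).norm.pow_const 2) (fun z => by positivity) (by positivity)
    ((lintegral_mono_set hA).trans (h x y).1)⟩

theorem setIntegral_norm_sub_le (hB : JumpBounds σ ν j C) (hJ2 : CondJ2 ν j) {κ : ℝ} (hκ : 0 < κ) :
    ∃ C₁, 0 ≤ C₁ ∧ ∀ x y : Eucl N,
      IntegrableOn (fun z => ‖j x z - j y z‖) (Metric.ball 0 1 \ Metric.ball 0 κ) ν ∧
        ∫ z in Metric.ball (0 : Eucl N) 1 \ Metric.ball 0 κ, ‖j x z - j y z‖ ∂ν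
          ≤ C₁ * ‖x - y‖ := by
  obtain ⟨C₁, hC₁, h⟩ := hJ2 κ hκ
  exact ⟨C₁, hC₁.le, fun x y => integrableOn_and_setIntegral_le
    ((hB.meas x).sub (hB.meas y)).norm (fun z => norm_nonneg _) (by positivity) (h x y).2⟩

/-- Comparison of the large jumps of two functions when the common part `P` of the gradients is
removed. -/
theorem levyIto_sub_le_of_common_gradient (hB : JumpBounds σ ν j C) {f v : Eucl N → ℝ}
    (hf : Continuous f) (hv : Continuous v) {Mf Mv : ℝ} (hMf : ∀ x, |f x| ≤ Mf)
    (hMv : ∀ x, |v x| ≤ Mv) {κ C₂ : ℝ} (hκ : 0 < κ)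
    (hC₂ : ∀ x y : Eucl N,
      IntegrableOn (fun z => ‖j x z - j y z‖) (Metric.ball 0 1 \ Metric.ball 0 κ) ν ∧
        ∫ z in Metric.ball (0 : Eucl N) 1 \ Metric.ball 0 κ, ‖j x z - j y z‖ ∂ν
          ≤ C₂ * ‖x - y‖) (x y q P : Eucl N) :
    levyIto ν j (Metric.ball 0 κ)ᶜ f x (q + P) - levyIto ν j (Metric.ball 0 κ)ᶜ v y P
      ≤ levyIto ν j (Metric.ball 0 κ)ᶜ f x q - levyIto ν j (Metric.ball 0 κ)ᶜ v y 0
        + ‖P‖ * (C₂ * ‖x - y‖) := by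
  obtain ⟨hi, hb⟩ := hC₂ x y
  have hset : (Metric.ball (0 : Eucl N) κ)ᶜ ∩ Metric.ball 0 1
      = Metric.ball 0 1 \ Metric.ball 0 κ := by rw [inter_comm]; rfl
  set D : Eucl N → ℝ := (Metric.ball (0 : Eucl N) 1).indicator fun z => ‖P‖ * ‖j x z - j y z‖
  have hD : IntegrableOn D (Metric.ball 0 κ)ᶜ ν := by
    rw [IntegrableOn, integrable_indicator_iff measurableSet_ball, IntegrableOn,
      Measure.restrict_restrict measurableSet_ball, inter_comm, hset]
    exact hi.const_mul _
  have hDi : ∫ z in (Metric.ball (0 : Eucl N) κ)ᶜ, D z ∂ν ≤ ‖P‖ * (C₂ * ‖x - y‖) := by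
    rw [setIntegral_indicator measurableSet_ball, hset, integral_const_mul]
    exact mul_le_mul_of_nonneg_left hb (norm_nonneg P)
  have i1 := integrableOn_increment hB hf hMf hκ x (q + P)
  have i2 := integrableOn_increment hB hv hMv hκ y P
  have i3 := integrableOn_increment hB hf hMf hκ x q
  have i4 := integrableOn_increment hB hv hMv hκ y 0
  have hmain : ∫ z in (Metric.ball (0 : Eucl N) κ)ᶜ,
        (increment j f x (q + P) z - increment j v y P z) ∂ν
      ≤ ∫ z in (Metric.ball (0 : Eucl N) κ)ᶜ,
        (increment j f x q z - increment j v y 0 z + D z) ∂ν := by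
    refine setIntegral_mono (i1.sub i2) ((i3.sub i4).add hD) fun z => ?_
    by_cases hz : ‖z‖ < 1
    · have hDz : D z = ‖P‖ * ‖j x z - j y z‖ := indicator_of_mem (mem_ball_zero_iff.2 hz) _
      simp only [increment_of_norm_lt hz, hDz, inner_add_left, inner_zero_left]
      have := (abs_le.1 (abs_real_inner_le_norm P (j x z - j y z))).1
      rw [inner_sub_right] at this
      linarith
    · have hDz : D z = 0 := indicator_of_notMem (fun h => hz (mem_ball_zero_iff.1 h)) _
      simp only [increment_of_le_norm (not_lt.1 hz), hDz]
      linarith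
  rw [integral_sub i1 i2, integral_add (f := fun z => increment j f x q z - increment j v y 0 z)
    (i3.sub i4) hD, integral_sub i3 i4] at hmain
  simp only [levyIto_eq]
  linarith

/-- Comparison inequality at a point `ξ` where `f - v` is touched from above by a paraboloid. -/
theorem le_of_doubling (hB : JumpBounds σ ν j C) (hJ2 : CondJ2 ν j) {f v : Eucl N → ℝ}
    (hf : Continuous f) (hv : Continuous v) {Mf Mv a b : ℝ} (hMf : ∀ x, |f x| ≤ Mf)
    (hMv : ∀ x, |v x| ≤ Mv) (hsub : JetSub σ C ν j F (fun _ => a) f)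
    (hsuper : JetSuper σ C ν j H (fun _ => b) v) {ξ q : Eucl N} {β s E η : ℝ} (hβ : 0 < β)
    (hqs : ‖q‖ < s) (hη : 0 < η)
    (hFH : ∀ x y P q' : Eucl N, ‖x - y‖ < η → ‖q'‖ ≤ s → H y P - F x (q' + P) ≤ E)
    (hT : ∀ x, f x - v x ≤ f ξ - v ξ + inner ℝ q (x - ξ) + β * ‖x - ξ‖ ^ 2)
    {κ : ℝ} (hκ : 0 < κ) (hκ1 : κ < 1) :
    b - a ≤ E + 2 * β * (C * κ ^ (2 - σ))
      + (levyIto ν j (Metric.ball 0 κ)ᶜ f ξ q - levyIto ν j (Metric.ball 0 κ)ᶜ v ξ 0) := by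
  obtain ⟨X, Y, hmax, hX, hY, hXY⟩ := exists_doubling_points hf hv hMv hβ hT
  obtain ⟨C₁, hC₁, hsq⟩ := setIntegral_sq_sub_le hB hJ2
  obtain ⟨C₂, hC₂, hlin⟩ := setIntegral_norm_sub_le hB hJ2 hκ
  set P : ℕ → Eucl N := fun n => (2 * ((n : ℝ) + 1)) • (X n - Y n) with hP
  set Q : ℕ → Eucl N := fun n => q + (4 * β) • (X n - ξ) with hQ
  have habove : ∀ n, TouchAbove f (X n) (Q n + P n) (2 * β + ((n : ℝ) + 1)) := by
    intro n x
    have h1 := hmax n x (Y n)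
    rw [norm_sub_sq_expand (X n) ξ x, norm_sub_sq_expand (X n) (Y n) x] at h1
    have h2 : inner ℝ q (x - ξ) = inner ℝ q (X n - ξ) + inner ℝ q (x - X n) := by
      rw [← inner_add_right]; congr 1; abel
    rw [h2] at h1
    simp only [hP, hQ, inner_add_left, real_inner_smul_left]
    linarith
  have hbelow : ∀ n, TouchBelow v (Y n) (P n) ((n : ℝ) + 1) := by
    intro n y
    have h1 := hmax n (X n) y
    rw [norm_sub_rev (X n) y, norm_sub_sq_expand (Y n) (X n) y, norm_sub_rev (Y n) (X n),
      ← neg_sub (X n) (Y n), inner_neg_left] at h1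
    simp only [hP, real_inner_smul_left]
    linarith
  have hn0 : ∀ n : ℕ, (0 : ℝ) ≤ (n : ℝ) + 1 := fun n => by positivity
  -- the inequality with both solutions at the maximum of the penalized function
  have hn : ∀ n, b - a ≤ H (Y n) (P n) - F (X n) (Q n + P n) + 2 * β * (C * κ ^ (2 - σ))
      + ((n : ℝ) + 1) * ‖X n - Y n‖ ^ 2 * (C₁ + 2 * C₂)
      + (levyIto ν j (Metric.ball 0 κ)ᶜ f (X n) (Q n)
        - levyIto ν j (Metric.ball 0 κ)ᶜ v (Y n) 0) := by
    intro n
    refine le_of_forall_pos_le_add fun ε hε => ?_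
    obtain ⟨δ₀, hδ₀, hrate⟩ := exists_small_rate (C := C) hB.sigma_lt (2 * β + 2 * ((n : ℝ) + 1)) hε
    obtain ⟨δ, hδ, hlt⟩ := exists_between (lt_min hδ₀ hκ)
    simp only [lt_min_iff] at hlt
    have hrate := hrate δ hδ hlt.1
    have h1 := hsub (X n) _ _ (by have := hn0 n; positivity) (habove n) δ hδ (by linarith)
    have h2 := hsuper (Y n) _ _ (hn0 n) (hbelow n) δ hδ (by linarith)
    rw [levyIto_split hB hf hMf hδ hlt.2.le] at h1
    rw [levyIto_split hB hv hMv hδ hlt.2.le] at h2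
    have hsubset : Metric.ball (0 : Eucl N) κ \ Metric.ball 0 δ ⊆ (Metric.ball 0 δ)ᶜ :=
      fun z hz => hz.2
    have hA1 : Metric.ball (0 : Eucl N) κ \ Metric.ball 0 δ ⊆ Metric.ball 0 1 :=
      sdiff_subset.trans (Metric.ball_subset_ball hκ1.le)
    obtain ⟨i1, b1⟩ := hsq _ (X n) (Y n) hA1
    obtain ⟨i2, b2⟩ := setIntegral_sq_le hB hκ hκ1
      (sdiff_subset (s := Metric.ball (0 : Eucl N) κ) (t := Metric.ball 0 δ)) (X n)
    have i3 := (integrableOn_increment hB hf hMf hδ (X n) (Q n + P n)).mono_set hsubset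
    have i4 := (integrableOn_increment hB hv hMv hδ (Y n) (P n)).mono_set hsubset
    have hann : levyIto ν j (Metric.ball (0 : Eucl N) κ \ Metric.ball 0 δ) f (X n) (Q n + P n)
        - levyIto ν j (Metric.ball (0 : Eucl N) κ \ Metric.ball 0 δ) v (Y n) (P n)
        ≤ 2 * β * (C * κ ^ (2 - σ)) + ((n : ℝ) + 1) * (C₁ * ‖X n - Y n‖ ^ 2) := by
      have hle : ∫ z in Metric.ball (0 : Eucl N) κ \ Metric.ball 0 δ,
          (increment j f (X n) (Q n + P n) z - increment j v (Y n) (P n) z) ∂ν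
          ≤ ∫ z in Metric.ball (0 : Eucl N) κ \ Metric.ball 0 δ,
            (2 * β * ‖j (X n) z‖ ^ 2 + ((n : ℝ) + 1) * ‖j (X n) z - j (Y n) z‖ ^ 2) ∂ν := by
        refine setIntegral_mono_on (i3.sub i4) ((i2.const_mul _).add (i1.const_mul _))
          (measurableSet_ball.diff measurableSet_ball) fun z hz => ?_
        have hz1 := mem_ball_zero_iff.1 (hA1 hz)
        rw [increment_of_norm_lt hz1, increment_of_norm_lt hz1]
        -- Comparing the maximum with the pair after both jumps cancels the common gradient `P n`.
        -- Only squares of jumps and of jump differences remain.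
        have h3 := hmax n (X n + j (X n) z) (Y n + j (Y n) z)
        have e2 : inner ℝ q (X n + j (X n) z - ξ)
            = inner ℝ q (X n - ξ) + inner ℝ q (j (X n) z) := by
          rw [← inner_add_right]; congr 1; abel
        have e3 : ‖X n + j (X n) z - ξ‖ ^ 2
            = ‖X n - ξ‖ ^ 2 + 2 * inner ℝ (X n - ξ) (j (X n) z) + ‖j (X n) z‖ ^ 2 := by
          rw [← norm_add_sq_real]; congr 2; abel
        have e4 : ‖X n + j (X n) z - (Y n + j (Y n) z)‖ ^ 2
            = ‖X n - Y n‖ ^ 2 + 2 * inner ℝ (X n - Y n) (j (X n) z - j (Y n) z)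
              + ‖j (X n) z - j (Y n) z‖ ^ 2 := by
          rw [← norm_add_sq_real]; congr 2; abel
        rw [e2, e3, e4, inner_sub_right (X n - Y n)] at h3
        simp only [hP, hQ, inner_add_left, real_inner_smul_left]
        linarith
      rw [integral_sub i3 i4, integral_add (i2.const_mul _) (i1.const_mul _), integral_const_mul,
        integral_const_mul] at hle
      have b1' := mul_le_mul_of_nonneg_left b1 (hn0 n)
      have b2' := mul_le_mul_of_nonneg_left b2 (show 0 ≤ 2 * β by positivity)
      simp only [levyIto_eq]
      linarith
    have hlarge := levyIto_sub_le_of_common_gradient hB hf hv hMf hMv hκ hlin (X n) (Y n) (Q n) (P n)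
    -- `P n` may be unbounded, but the large-jump error is ‖P n‖·‖X n - Y n‖, a multiple of the
    -- vanishing penalization. The Hamiltonian error `E` does not depend on `P n`.
    have hPn : ‖P n‖ = 2 * ((n : ℝ) + 1) * ‖X n - Y n‖ := by
      rw [hP, norm_smul, Real.norm_eq_abs, abs_of_nonneg (by have := hn0 n; positivity)]
    rw [hPn] at hlarge
    linarith
  -- passage to the limit
  have hQlim : Tendsto Q atTop (𝓝 q) := by
    simpa using tendsto_const_nhds.add ((hX.sub_const ξ).const_smul (4 * β))
  have hfl := ((continuous_levyIto hB hf hMf hκ).tendsto (ξ, q)).comp (hX.prodMk_nhds hQlim)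
  have hvl := ((continuous_levyIto hB hv hMv hκ).tendsto (ξ, 0)).comp
    (hY.prodMk_nhds (tendsto_const_nhds (x := (0 : Eucl N))))
  have hlim : Tendsto (fun n : ℕ => E + 2 * β * (C * κ ^ (2 - σ))
      + ((n : ℝ) + 1) * ‖X n - Y n‖ ^ 2 * (C₁ + 2 * C₂)
      + (levyIto ν j (Metric.ball 0 κ)ᶜ f (X n) (Q n)
        - levyIto ν j (Metric.ball 0 κ)ᶜ v (Y n) 0)) atTop
      (𝓝 (E + 2 * β * (C * κ ^ (2 - σ)) + 0 * (C₁ + 2 * C₂)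
      + (levyIto ν j (Metric.ball 0 κ)ᶜ f ξ q - levyIto ν j (Metric.ball 0 κ)ᶜ v ξ 0))) :=
    ((hXY.mul_const _).const_add _).add (hfl.sub hvl)
  rw [zero_mul, add_zero] at hlim
  refine ge_of_tendsto hlim ?_
  have hclose : ∀ᶠ n in atTop, ‖X n - Y n‖ < η := by
    have : Tendsto (fun n => ‖X n - Y n‖) atTop (𝓝 0) := by simpa using (hX.sub hY).norm
    exact this.eventually (gt_mem_nhds hη)
  filter_upwards [hclose, hQlim.norm.eventually (gt_mem_nhds hqs)] with n h1 h2
  have := hFH (X n) (Y n) (P n) (Q n) h1 h2.le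
  linarith [hn n]

end Doubling

/-! ### Uniqueness of the ergodic constant and strong maximum principle -/

section Uniqueness

variable {N : ℕ} {σ C m A b₀ : ℝ} {ν : Measure (Eucl N)} {j : Eucl N → Eucl N → Eucl N}
  {H : Eucl N → Eucl N → ℝ} {ζ₁ ζ₂ : ℝ → ℝ}

theorem JetSub.const_mul {a μ : ℝ} (hμ : 0 < μ) {w : Eucl N → ℝ}
    (h : JetSub σ C ν j H (fun _ => a) w) :
    JetSub σ C ν j (fun x p => μ * H x (μ⁻¹ • p)) (fun _ => μ * a) (fun x => μ * w x) := by
  intro x p K hK ht δ hδ hδ1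
  have h1 := h x (μ⁻¹ • p) (μ⁻¹ * K) (by positivity) (fun y => ?_) δ hδ hδ1
  · have e := levyIto_smul (ν := ν) (j := j) (Metric.ball 0 δ)ᶜ w x (μ⁻¹ • p) μ
    rw [smul_inv_smul₀ hμ.ne'] at e
    rw [e]
    have h2 := mul_le_mul_of_nonneg_left h1 hμ.le
    have h3 : μ * (a + μ⁻¹ * K * (C * δ ^ (2 - σ))) = μ * a + K * (C * δ ^ (2 - σ)) := by
      field_simp
    linarith
  · have h2 := mul_le_mul_of_nonneg_left (ht y) (inv_pos.2 hμ).le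
    rw [real_inner_smul_left]
    rw [inv_mul_cancel_left₀ hμ.ne'] at h2
    refine h2.trans (le_of_eq ?_)
    field_simp

/-- The error in the comparison of `H` with its rescaling by `μ`, for a perturbation of size `s` of
the gradient. -/
noncomputable def hamiltonianError (m A b₀ : ℝ) (ζ₂ : ℝ → ℝ) (μ s : ℝ) : ℝ :=
  (1 - μ) * (b₀ * (m - 1) / 2) + ζ₂ s
    + ζ₂ s * (ζ₂ s / ((1 - μ) * (b₀ * (m - 1) / 2))) ^ (m - 1) + (1 - μ) * A

/-- Beyond the threshold z/θ the left side is nonpositive; below it the first term is monotone in t.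
-/
theorem mul_rpow_sub_le {z θ t m : ℝ} (hm : 1 < m) (hz : 0 ≤ z) (hθ : 0 < θ) (ht : 0 ≤ t) :
    z * t ^ (m - 1) - θ * t ^ m ≤ z * (z / θ) ^ (m - 1) := by
  rcases le_or_gt t (z / θ) with h | h
  · have h1 : t ^ (m - 1) ≤ (z / θ) ^ (m - 1) := Real.rpow_le_rpow ht h (by linarith)
    have h2 : 0 ≤ θ * t ^ m := by positivity
    linarith [mul_le_mul_of_nonneg_left h1 hz]
  · have h0 : 0 < t := lt_of_le_of_lt (by positivity) h
    have h1 : z ≤ θ * t := by rw [div_lt_iff₀ hθ] at h; linarith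
    have h2 : t ^ m = t * t ^ (m - 1) := by
      rw [mul_comm, ← Real.rpow_add_one h0.ne', sub_add_cancel]
    have h3 : 0 ≤ z * (z / θ) ^ (m - 1) := by positivity
    have h4 := mul_le_mul_of_nonneg_right h1 (show 0 ≤ t ^ (m - 1) by positivity)
    rw [h2]; linarith

/-- Inserting H(x, q' + P) splits the difference into an (H1) part and an (H2) part. The latter
supplies -2θ t^m with t = ‖q' + P‖. One θ absorbs the ζ₁ error once ζ₁ < θ, the other absorbs the ζ₂
error of order t^(m-1), so the bound is uniform in P. -/
theorem exists_hamiltonian_comparison (hm : 1 < m) (hζ₁ : IsModulus ζ₁) (hζ₂ : IsModulus ζ₂)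
    (hH1 : CondH1 m ζ₁ ζ₂ H) (hb₀ : 0 < b₀)
    (hH2 : ∀ μ : ℝ, 0 < μ → μ < 1 → ∀ x p : Eucl N,
      H x p - μ * H x (μ⁻¹ • p) ≤ (1 - μ) * (b₀ * (1 - m) * ‖p‖ ^ m + A))
    {μ s : ℝ} (hμ : 0 < μ) (hμ1 : μ < 1) (hs : 0 < s) :
    ∃ η > 0, ∀ x y P q' : Eucl N, ‖x - y‖ < η → ‖q'‖ ≤ s →
      H y P - μ * H x (μ⁻¹ • (q' + P)) ≤ hamiltonianError m A b₀ ζ₂ μ s := by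
  set θ := (1 - μ) * (b₀ * (m - 1) / 2) with hθ
  have hθ0 : 0 < θ := mul_pos (by linarith) (by have : 0 < m - 1 := by linarith
                                                positivity)
  obtain ⟨η, hη, hh⟩ := Metric.eventually_nhds_iff.1
    ((hζ₁.tendsto_norm (E := Eucl N)).eventually (gt_mem_nhds hθ0))
  refine ⟨η, hη, fun x y P q' hxy hq' => ?_⟩
  have h1 : ζ₁ ‖x - y‖ < θ := hh (by rwa [dist_zero_right])
  have h2 : ζ₂ ‖q'‖ ≤ ζ₂ s := hζ₂.monotoneOn (mem_Ici.2 (norm_nonneg _)) (mem_Ici.2 hs.le) hq'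
  have h3 := hH1 x y (q' + P) (-q')
  have e : q' + P + -q' = P := by abel
  rw [e, norm_neg] at h3
  have h4 := hH2 μ hμ hμ1 x (q' + P)
  set t := ‖q' + P‖ with ht
  have h5 := mul_rpow_sub_le hm (hζ₂.nonneg hs.le) hθ0 (norm_nonneg (q' + P))
  rw [← ht] at h5
  have h6 : ζ₁ ‖x - y‖ * (1 + t ^ m) ≤ θ * (1 + t ^ m) :=
    mul_le_mul_of_nonneg_right h1.le (by positivity)
  have h7 : ζ₂ ‖q'‖ * (1 + t ^ (m - 1)) ≤ ζ₂ s * (1 + t ^ (m - 1)) :=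
    mul_le_mul_of_nonneg_right h2 (by positivity)
  have h8 : (1 - μ) * (b₀ * (1 - m) * t ^ m + A) = -(2 * (θ * t ^ m)) + (1 - μ) * A := by
    rw [hθ]; ring
  rw [h8] at h4
  rw [hamiltonianError, ← hθ]
  linarith

theorem abs_const_mul_le {μ : ℝ} (hμ : 0 < μ) (hμ1 : μ < 1) {w : Eucl N → ℝ} {M : ℝ}
    (hM : ∀ x, |w x| ≤ M) (x : Eucl N) : |μ * w x| ≤ M := by
  rw [abs_mul, abs_of_pos hμ]
  exact (mul_le_of_le_one_left (abs_nonneg _) hμ1.le).trans (hM x)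

/-- A subsolution with constant `c₁` and a supersolution with constant `c₂` satisfy `c₁ ≤ c₂`. -/
theorem ergodic_constant_le (hB : JumpBounds σ ν j C) (hJ2 : CondJ2 ν j) (hm : 1 < m)
    (hζ₁ : IsModulus ζ₁) (hζ₂ : IsModulus ζ₂) (hH1 : CondH1 m ζ₁ ζ₂ H) (hb₀ : 0 < b₀)
    (hH2 : ∀ μ : ℝ, 0 < μ → μ < 1 → ∀ x p : Eucl N,
      H x p - μ * H x (μ⁻¹ • p) ≤ (1 - μ) * (b₀ * (1 - m) * ‖p‖ ^ m + A))
    {c₁ c₂ : ℝ} {w v : Eucl N → ℝ} (hw : Continuous w) (hv : Continuous v)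
    (hwp : ZPeriodic w) (hvp : ZPeriodic v)
    (hsub : JetSub σ C ν j H (fun _ => -c₁) w) (hsuper : JetSuper σ C ν j H (fun _ => -c₂) v) :
    c₁ ≤ c₂ := by
  obtain ⟨Mw, hMw⟩ := hwp.exists_bound hw
  obtain ⟨Mv, hMv⟩ := hvp.exists_bound hv
  have hm1 : 0 < m - 1 := by linarith
  have key : ∀ μ : ℝ, 0 < μ → μ < 1 →
      μ * c₁ - c₂ ≤ (1 - μ) * (b₀ * (m - 1) / 2) + (1 - μ) * A := by
    intro μ hμ hμ1
    have hθ0 : 0 < (1 - μ) * (b₀ * (m - 1) / 2) := mul_pos (by linarith) (by positivity)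
    have hf : Continuous fun x => μ * w x := hw.const_mul μ
    obtain ⟨x₀, hx₀⟩ := ZPeriodic.exists_max (u := fun x => μ * w x - v x) (hf.sub hv)
      (fun k x => by simp only [hwp k x, hvp k x])
    -- Since `x₀` is a maximum, the gradient is 0 and every positive opening is allowed; s serves as
    -- opening and as gradient bound. First s → 0 with μ fixed, then μ → 1.
    have hs : ∀ s : ℝ, 0 < s → μ * c₁ - c₂ ≤ hamiltonianError m A b₀ ζ₂ μ s
        + 2 * s * (C * (1 / 2) ^ (2 - σ)) := by
      intro s hs
      obtain ⟨η, hη, hcmp⟩ := exists_hamiltonian_comparison hm hζ₁ hζ₂ hH1 hb₀ hH2 hμ hμ1 hs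
      have h1 := le_of_doubling hB hJ2 hf hv (abs_const_mul_le hμ hμ1 hMw) hMv (hsub.const_mul hμ)
        hsuper (ξ := x₀) (q := 0) hs (by rwa [norm_zero]) hη hcmp (fun x => by
          have h2 : 0 ≤ s * ‖x - x₀‖ ^ 2 := by positivity
          rw [inner_zero_left]
          linarith [hx₀ x]) (κ := 1 / 2) (by norm_num) (by norm_num)
      have h2 := levyIto_mono hB hf hv (abs_const_mul_le hμ hμ1 hMw) hMv
        (c := μ * w x₀ - v x₀) (fun y => by linarith [hx₀ y]) (show (0 : ℝ) < 1 / 2 by norm_num) x₀ 0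
      have h3 : v x₀ + (μ * w x₀ - v x₀) - μ * w x₀ = 0 := by ring
      rw [h3, zero_mul, add_zero] at h2
      linarith
    have hz : Tendsto ζ₂ (𝓝[>] 0) (𝓝 0) := hζ₂.tendsto_zero
    have hid : Tendsto (fun s : ℝ => s) (𝓝[>] 0) (𝓝 0) := tendsto_nhdsWithin_of_tendsto_nhds tendsto_id
    have hlim : Tendsto (fun s : ℝ => hamiltonianError m A b₀ ζ₂ μ s
        + 2 * s * (C * (1 / 2) ^ (2 - σ))) (𝓝[>] 0)
        (𝓝 ((1 - μ) * (b₀ * (m - 1) / 2) + 0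
          + 0 * (0 / ((1 - μ) * (b₀ * (m - 1) / 2))) ^ (m - 1) + (1 - μ) * A
          + 2 * 0 * (C * (1 / 2) ^ (2 - σ)))) :=
      (((hz.const_add _).add (hz.mul ((hz.div_const _).rpow_const (Or.inr hm1.le)))).add_const _).add
        ((hid.const_mul 2).mul_const _)
    have := ge_of_tendsto hlim (eventually_nhdsWithin_of_forall fun s hs' => hs s hs')
    simpa using this
  have hcont : Continuous fun μ : ℝ =>
      (1 - μ) * (b₀ * (m - 1) / 2) + (1 - μ) * A - (μ * c₁ - c₂) := by fun_prop
  have hlim : Tendsto (fun μ : ℝ => (1 - μ) * (b₀ * (m - 1) / 2) + (1 - μ) * A - (μ * c₁ - c₂))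
      (𝓝[<] 1) (𝓝 ((1 - 1) * (b₀ * (m - 1) / 2) + (1 - 1) * A - (1 * c₁ - c₂))) :=
    tendsto_nhdsWithin_of_tendsto_nhds (hcont.tendsto 1)
  have := ge_of_tendsto (b := 0) hlim (by
    filter_upwards [Ioo_mem_nhdsLT (zero_lt_one (α := ℝ))] with μ hμ
    linarith [key μ hμ.1 hμ.2])
  linarith

/-- With 1 - μ = τ and s = τS, the critical term is ζ₂(s)^m/(τk)^(m-1), which equals (ζ₂(s)
s^((1-m)/m))^m times a constant. This is where the rate condition on ζ₂ enters. -/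
theorem tendsto_hamiltonianError (hm : 1 < m) (hζ₂ : IsModulus ζ₂) (hb₀ : 0 < b₀)
    (hrate : Tendsto (fun s : ℝ => ζ₂ s * s ^ ((1 - m) / m)) (𝓝[>] 0) (𝓝 0)) {S : ℝ} (hS : 0 < S) :
    Tendsto (fun τ : ℝ => hamiltonianError m A b₀ ζ₂ (1 - τ) (τ * S)) (𝓝[>] 0) (𝓝 0) := by
  have hm1 : 0 < m - 1 := by linarith
  have hid : Tendsto (fun τ : ℝ => τ) (𝓝[>] 0) (𝓝 0) := tendsto_nhdsWithin_of_tendsto_nhds tendsto_id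
  have hs : Tendsto (fun τ : ℝ => τ * S) (𝓝[>] 0) (𝓝[>] 0) := by
    refine tendsto_nhdsWithin_iff.2 ⟨by simpa using hid.mul_const S, ?_⟩
    filter_upwards [self_mem_nhdsWithin] with τ hτ using mul_pos hτ hS
  set k := b₀ * (m - 1) / 2 with hk
  have hk0 : 0 < k := by positivity
  have hz : Tendsto (fun τ : ℝ => ζ₂ (τ * S)) (𝓝[>] 0) (𝓝 0) := hζ₂.tendsto_zero.comp hs
  have hprod : Tendsto (fun τ : ℝ => ζ₂ (τ * S) * (ζ₂ (τ * S) / (τ * k)) ^ (m - 1)) (𝓝[>] 0)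
      (𝓝 0) := by
    have h1 : Tendsto (fun τ : ℝ => (ζ₂ (τ * S) * (τ * S) ^ ((1 - m) / m)) ^ m
        * (S / k) ^ (m - 1)) (𝓝[>] 0) (𝓝 (0 ^ m * (S / k) ^ (m - 1))) :=
      ((hrate.comp hs).rpow_const (Or.inr (by linarith))).mul_const _
    rw [Real.zero_rpow (by linarith), zero_mul] at h1
    refine h1.congr' ?_
    filter_upwards [self_mem_nhdsWithin] with τ hτ
    have hτ : 0 < τ := hτ
    have hz0 : 0 ≤ ζ₂ (τ * S) := hζ₂.nonneg (by positivity)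
    have e1 : ((τ * S) ^ ((1 - m) / m)) ^ m = (τ * S)⁻¹ ^ (m - 1) := by
      rw [← Real.rpow_mul (by positivity), div_mul_cancel₀ _ (by linarith),
        Real.inv_rpow (by positivity), ← Real.rpow_neg (by positivity), neg_sub]
    have e2 : ζ₂ (τ * S) ^ m = ζ₂ (τ * S) * ζ₂ (τ * S) ^ (m - 1) := by
      rw [← Real.rpow_one_add' hz0 (by linarith), add_sub_cancel]
    rw [Real.mul_rpow hz0 (by positivity), e1, e2, mul_assoc, mul_assoc, ← Real.mul_rpow
      (by positivity) (by positivity), ← Real.mul_rpow hz0 (by positivity)]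
    congr 2
    field_simp
  have h := (((hid.mul_const k).add hz).add hprod).add (hid.mul_const A)
  simp only [zero_mul, add_zero] at h
  refine h.congr fun τ => ?_
  rw [hamiltonianError, sub_sub_cancel]

/-- Near a maximum point of `w - v` there are maximum points whose jumps reach maximum points. -/
theorem exists_max_ae_jump (hB : JumpBounds σ ν j C) (hJ2 : CondJ2 ν j) (hm : 1 < m)
    (hζ₁ : IsModulus ζ₁) (hζ₂ : IsModulus ζ₂) (hH1 : CondH1 m ζ₁ ζ₂ H) (hb₀ : 0 < b₀)
    (hH2 : ∀ μ : ℝ, 0 < μ → μ < 1 → ∀ x p : Eucl N,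
      H x p - μ * H x (μ⁻¹ • p) ≤ (1 - μ) * (b₀ * (1 - m) * ‖p‖ ^ m + A))
    (hrate : Tendsto (fun s : ℝ => ζ₂ s * s ^ ((1 - m) / m)) (𝓝[>] 0) (𝓝 0))
    {a : ℝ} {w v : Eucl N → ℝ} (hw : Continuous w) (hv : Continuous v) {Mw Mv : ℝ}
    (hMw : ∀ x, |w x| ≤ Mw) (hMv : ∀ x, |v x| ≤ Mv)
    (hsub : JetSub σ C ν j H (fun _ => a) w) (hsuper : JetSuper σ C ν j H (fun _ => a) v)
    {x₀ : Eucl N} (hx₀ : ∀ x, w x - v x ≤ w x₀ - v x₀) {ρ : ℝ} (hρ : 0 < ρ) :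
    ∃ ξ, ‖ξ - x₀‖ ≤ ρ ∧ ∀ᵐ z ∂ν, w (ξ + j ξ z) - v (ξ + j ξ z) = w x₀ - v x₀ := by
  have hMw0 : 0 ≤ Mw := (abs_nonneg _).trans (hMw 0)
  -- Passing from w to (1-τ)w changes differences of values by at most 2Mw·τ. The penalty exceeds
  -- this outside the ball of radius ρ, so the perturbed maxima stay near `x₀`, whereas without it
  -- they could drift to another maximum.
  set K := (2 * Mw + 1) / ρ ^ 2 with hK
  have hK0 : 0 < K := by positivity
  have hKρ : K * ρ ^ 2 = 2 * Mw + 1 := by rw [hK]; field_simp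
  set τ : ℕ → ℝ := fun n => 1 / ((n : ℝ) + 2) with hτ
  have hτ0 : ∀ n, 0 < τ n := fun n => by positivity
  have hτ1 : ∀ n, τ n < 1 := fun n => by
    rw [hτ, div_lt_one (by positivity)]; linarith [Nat.cast_nonneg (α := ℝ) n]
  have hτlim : Tendsto τ atTop (𝓝[>] 0) := by
    refine tendsto_nhdsWithin_iff.2 ⟨?_, Eventually.of_forall hτ0⟩
    refine squeeze_zero (fun n => (hτ0 n).le) (fun n => ?_)
      (tendsto_one_div_add_atTop_nhds_zero_nat (𝕜 := ℝ))
    exact one_div_le_one_div_of_le (by positivity) (by linarith)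
  -- maximum points of the penalized differences
  have hfar : ∀ n y, ρ < ‖y - x₀‖ → (1 - τ n) * w y - v y - τ n * K * ‖y - x₀‖ ^ 2
      < (1 - τ n) * w x₀ - v x₀ := by
    intro n y hy
    have h1 := hx₀ y
    have h2 : 2 * Mw + 1 ≤ K * ‖y - x₀‖ ^ 2 := by
      rw [← hKρ]; gcongr
    have h3 : -(2 * Mw) ≤ w y - w x₀ := by
      linarith [(abs_le.1 (hMw y)).1, (abs_le.1 (hMw x₀)).2]
    have h4 := mul_le_mul_of_nonneg_left h2 (hτ0 n).le
    have h5 := mul_le_mul_of_nonneg_left h3 (hτ0 n).le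
    have := hτ0 n
    nlinarith
  have hex : ∀ n, ∃ x, ∀ y, (1 - τ n) * w y - v y - τ n * K * ‖y - x₀‖ ^ 2
      ≤ (1 - τ n) * w x - v x - τ n * K * ‖x - x₀‖ ^ 2 := fun n =>
    exists_max_of_le (by fun_prop) x₀ ρ fun y hy => by simpa using (hfar n y hy).le
  choose X hX using hex
  have hX₀ : ∀ n, (1 - τ n) * w x₀ - v x₀
      ≤ (1 - τ n) * w (X n) - v (X n) - τ n * K * ‖X n - x₀‖ ^ 2 := fun n => by
    simpa using hX n x₀
  have hXρ : ∀ n, ‖X n - x₀‖ ≤ ρ := fun n => by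
    by_contra! hcon
    linarith [hfar n _ hcon, hX₀ n]
  obtain ⟨ξ, hξ, φ, hφ, hlim⟩ := (isCompact_closedBall x₀ ρ).tendsto_subseq
    fun n => mem_closedBall_iff_norm.2 (hXρ n)
  have hτφ : Tendsto (fun n => τ (φ n)) atTop (𝓝[>] 0) := hτlim.comp hφ.tendsto_atTop
  have hτφ0 : Tendsto (fun n => τ (φ n)) atTop (𝓝 0) := tendsto_nhds_of_tendsto_nhdsWithin hτφ
  have hDξ : w ξ - v ξ = w x₀ - v x₀ := by
    refine le_antisymm (hx₀ ξ) ?_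
    have h1 : Tendsto (fun n => w (X (φ n)) - v (X (φ n)) + τ (φ n) * (2 * Mw)) atTop
        (𝓝 (w ξ - v ξ + 0 * (2 * Mw))) :=
      (((hw.tendsto ξ).comp hlim).sub ((hv.tendsto ξ).comp hlim)).add (hτφ0.mul_const _)
    rw [zero_mul, add_zero] at h1
    refine ge_of_tendsto' h1 fun n => ?_
    have h2 := hX₀ (φ n)
    have h3 : w x₀ - w (X (φ n)) ≤ 2 * Mw := by
      linarith [(abs_le.1 (hMw (X (φ n)))).1, (abs_le.1 (hMw x₀)).2]
    have h4 := mul_le_mul_of_nonneg_left h3 (hτ0 (φ n)).le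
    have h5 : 0 ≤ τ (φ n) * K * ‖X (φ n) - x₀‖ ^ 2 := by have := hτ0 (φ n); positivity
    linarith
  refine ⟨ξ, mem_closedBall_iff_norm.1 hξ, ?_⟩
  set q : ℕ → Eucl N := fun n => (2 * (τ n * K)) • (X n - x₀) with hq
  set S := 2 * K * ρ + 1 with hS
  have hS0 : 0 < S := by positivity
  have hqS : ∀ n, ‖q n‖ < τ n * S := by
    intro n
    have h0 := hτ0 n
    rw [hq, norm_smul, Real.norm_eq_abs, abs_of_nonneg (by positivity), hS]
    have := mul_le_mul_of_nonneg_left (hXρ n) (show 0 ≤ 2 * (τ n * K) by positivity)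
    linarith
  have hqlim : Tendsto (fun n => q (φ n)) atTop (𝓝 0) := by
    rw [tendsto_zero_iff_norm_tendsto_zero]
    exact squeeze_zero (fun n => norm_nonneg _) (fun n => (hqS (φ n)).le)
      (by simpa using hτφ0.mul_const S)
  have hμ0 : ∀ n, 0 < 1 - τ n := fun n => by linarith [hτ1 n]
  have hμ1 : ∀ n, 1 - τ n < 1 := fun n => by linarith [hτ0 n]
  -- the integral of the increments of `w - v` is nonnegative
  have hint : ∀ κ : ℝ, 0 < κ → κ < 1 →
      0 ≤ levyIto ν j (Metric.ball 0 κ)ᶜ w ξ 0 - levyIto ν j (Metric.ball 0 κ)ᶜ v ξ 0 := by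
    intro κ hκ hκ1
    -- The right-hand sides a and (1-τ)a differ by only τa. The perturbed gradient `q n` is O(τ),
    -- the scale required by `tendsto_hamiltonianError`.
    have hineq : ∀ n, τ n * a ≤ hamiltonianError m A b₀ ζ₂ (1 - τ n) (τ n * S)
        + 2 * (τ n * K) * (C * κ ^ (2 - σ))
        + ((1 - τ n) * levyIto ν j (Metric.ball 0 κ)ᶜ w (X n) ((1 - τ n)⁻¹ • q n)
          - levyIto ν j (Metric.ball 0 κ)ᶜ v (X n) 0) := by
      intro n
      obtain ⟨η, hη, hcmp⟩ := exists_hamiltonian_comparison hm hζ₁ hζ₂ hH1 hb₀ hH2 (hμ0 n) (hμ1 n)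
        (mul_pos (hτ0 n) hS0)
      have h1 := le_of_doubling hB hJ2 (hw.const_mul (1 - τ n)) hv
        (abs_const_mul_le (hμ0 n) (hμ1 n) hMw) hMv (hsub.const_mul (hμ0 n)) hsuper
        (ξ := X n) (q := q n) (mul_pos (hτ0 n) hK0) (hqS n) hη hcmp (fun x => by
          have h2 := hX n x
          rw [norm_sub_sq_expand (X n) x₀ x] at h2
          simp only [hq, real_inner_smul_left]
          linarith) hκ hκ1
      have e := levyIto_smul (ν := ν) (j := j) (Metric.ball 0 κ)ᶜ w (X n) ((1 - τ n)⁻¹ • q n)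
        (1 - τ n)
      rw [smul_inv_smul₀ (hμ0 n).ne'] at e
      rw [e] at h1
      linarith
    have hμlim : Tendsto (fun n => 1 - τ (φ n)) atTop (𝓝 1) := by
      simpa using hτφ0.const_sub 1
    have hplim : Tendsto (fun n => (1 - τ (φ n))⁻¹ • q (φ n)) atTop (𝓝 0) := by
      simpa using (hμlim.inv₀ one_ne_zero).smul hqlim
    have h1 := ((continuous_levyIto hB hw hMw hκ).tendsto (ξ, 0)).comp (hlim.prodMk_nhds hplim)
    have h2 := ((continuous_levyIto hB hv hMv hκ).tendsto (ξ, 0)).comp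
      (hlim.prodMk_nhds (tendsto_const_nhds (x := (0 : Eucl N))))
    have hE := (tendsto_hamiltonianError (A := A) hm hζ₂ hb₀ hrate hS0).comp hτφ
    have hR := (hE.add (((hτφ0.mul_const K).const_mul 2).mul_const (C * κ ^ (2 - σ)))).add
      ((hμlim.mul h1).sub h2)
    simp only [zero_mul, mul_zero, add_zero, zero_add, one_mul] at hR
    have hLft : Tendsto (fun n => τ (φ n) * a) atTop (𝓝 0) := by simpa using hτφ0.mul_const a
    exact le_of_tendsto_of_tendsto' hLft hR fun n => hineq (φ n)
  -- At the maximum ξ the increments of w - v are nonpositive, while their integral is nonnegative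
  -- by `hint`; hence they vanish almost everywhere.
  have hae : ∀ n : ℕ, ∀ᵐ z ∂ν, z ∈ (Metric.ball (0 : Eucl N) (1 / ((n : ℝ) + 2)))ᶜ →
      w (ξ + j ξ z) - v (ξ + j ξ z) = w x₀ - v x₀ := by
    intro n
    rw [← ae_restrict_iff' measurableSet_ball.compl]
    have hκ : 0 < 1 / ((n : ℝ) + 2) := hτ0 n
    have i1 := integrableOn_increment hB hw hMw hκ ξ 0
    have i2 := integrableOn_increment hB hv hMv hκ ξ 0
    have h1 := hint _ hκ (hτ1 n)
    simp only [levyIto_eq] at h1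
    rw [← integral_sub i1 i2] at h1
    have hinc : ∀ z, increment j v ξ 0 z - increment j w ξ 0 z
        = (w x₀ - v x₀) - (w (ξ + j ξ z) - v (ξ + j ξ z)) := by
      intro z
      rw [← hDξ]
      simp only [increment, inner_zero_left, indicator_zero]
      ring
    have hnn : ∀ z, 0 ≤ increment j v ξ 0 z - increment j w ξ 0 z := fun z => by
      rw [hinc]; linarith [hx₀ (ξ + j ξ z)]
    have h2 : ∫ z in (Metric.ball (0 : Eucl N) (1 / ((n : ℝ) + 2)))ᶜ,
        (increment j v ξ 0 z - increment j w ξ 0 z) ∂ν = 0 := by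
      refine le_antisymm ?_ (integral_nonneg hnn)
      rw [integral_sub i2 i1]
      rw [integral_sub i1 i2] at h1
      linarith
    have h3 := (integral_eq_zero_iff_of_nonneg hnn (i2.sub i1)).1 h2
    filter_upwards [h3] with z hz
    have hz' : increment j v ξ 0 z - increment j w ξ 0 z = 0 := hz
    rw [hinc] at hz'
    linarith
  filter_upwards [ae_all_iff.2 hae] with z hz
  -- The complements of shrinking balls exhaust all z ≠ 0, and (J1) forces the jump at z = 0 to
  -- vanish.
  by_cases hz0 : z = 0
  · have hj0 : j ξ z = 0 := by
      rw [← norm_le_zero_iff]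
      simpa [hz0] using hB.norm_le ξ z
    rw [hj0, add_zero, hDξ]
  · obtain ⟨n, hn⟩ := exists_nat_one_div_lt (norm_pos_iff.2 hz0)
    refine hz n ?_
    rw [mem_compl_iff, mem_ball_zero_iff, not_lt]
    exact (one_div_le_one_div_of_le (by positivity) (by linarith)).trans hn.le

theorem eq_of_ae_eq_of_mem_support {g : Eucl N → ℝ} {k : ℝ} (hg : ContinuousOn g ν.support)
    (h : ∀ᵐ z ∂ν, g z = k) {z : Eucl N} (hz : z ∈ ν.support) : g z = k := by
  by_contra hne
  have h1 : ∀ᶠ y in 𝓝[ν.support] z, g y ≠ k := (hg z hz).eventually_ne hne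
  have h2 : ∀ᶠ y in 𝓝 z, y ∈ ν.support → g y ≠ k := eventually_nhdsWithin_iff.1 h1
  have h3 : 0 < ν {y | y ∈ ν.support → g y ≠ k} :=
    (Measure.mem_support_iff_forall z).1 hz _ h2
  refine h3.ne' (measure_mono_null (t := {y | ¬ g y = k} ∪ ν.supportᶜ) (fun y hy => ?_)
    (measure_union_null (ae_iff.1 h) Measure.measure_compl_support))
  by_cases hys : y ∈ ν.support
  · exact Or.inl (hy hys)
  · exact Or.inr hys

/-- The almost-everywhere statement at nearby maxima X n extends to the whole support by continuity
in z. Continuity in x then carries it to `x₀` for each fixed z. -/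
theorem max_of_jump (hB : JumpBounds σ ν j C) (hJ2 : CondJ2 ν j) (hm : 1 < m)
    (hζ₁ : IsModulus ζ₁) (hζ₂ : IsModulus ζ₂) (hH1 : CondH1 m ζ₁ ζ₂ H) (hb₀ : 0 < b₀)
    (hH2 : ∀ μ : ℝ, 0 < μ → μ < 1 → ∀ x p : Eucl N,
      H x p - μ * H x (μ⁻¹ • p) ≤ (1 - μ) * (b₀ * (1 - m) * ‖p‖ ^ m + A))
    (hrate : Tendsto (fun s : ℝ => ζ₂ s * s ^ ((1 - m) / m)) (𝓝[>] 0) (𝓝 0))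
    (hjs : ∀ x : Eucl N, ContinuousOn (j x) ν.support)
    {a : ℝ} {w v : Eucl N → ℝ} (hw : Continuous w) (hv : Continuous v) {Mw Mv : ℝ}
    (hMw : ∀ x, |w x| ≤ Mw) (hMv : ∀ x, |v x| ≤ Mv)
    (hsub : JetSub σ C ν j H (fun _ => a) w) (hsuper : JetSuper σ C ν j H (fun _ => a) v)
    {x₀ : Eucl N} (hx₀ : ∀ x, w x - v x ≤ w x₀ - v x₀) {z : Eucl N} (hz : z ∈ ν.support) :
    w (x₀ + j x₀ z) - v (x₀ + j x₀ z) = w x₀ - v x₀ := by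
  have hn : ∀ n : ℕ, (0 : ℝ) < 1 / (n + 1) := fun n => by positivity
  choose X hX hXae using fun n => exists_max_ae_jump hB hJ2 hm hζ₁ hζ₂ hH1 hb₀ hH2 hrate hw hv hMw
    hMv hsub hsuper hx₀ (hn n)
  have heq : ∀ n, w (X n + j (X n) z) - v (X n + j (X n) z) = w x₀ - v x₀ := fun n =>
    eq_of_ae_eq_of_mem_support (g := fun z => w (X n + j (X n) z) - v (X n + j (X n) z))
      ((hw.sub hv).comp_continuousOn (continuousOn_const.add (hjs (X n)))) (hXae n) hz
  have hXlim : Tendsto X atTop (𝓝 x₀) := by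
    rw [tendsto_iff_norm_sub_tendsto_zero]
    exact squeeze_zero (fun n => norm_nonneg _) hX tendsto_one_div_add_atTop_nhds_zero_nat
  have hc : Continuous fun x => w (x + j x z) - v (x + j x z) :=
    (hw.sub hv).comp (continuous_id.add (hB.cont z))
  exact tendsto_nhds_unique (((hc.tendsto x₀).comp hXlim).congr heq) tendsto_const_nhds

end Uniqueness

theorem mainTheorem2 (N : ℕ) (σ m : ℝ) (hσ0 : 0 < σ) (hσ2 : σ < 2) (hm : max 1 σ < m)
    (ν : Measure (Eucl N)) (j : Eucl N → Eucl N → Eucl N) (H : Eucl N → Eucl N → ℝ)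
    (ζ₁ ζ₂ : ℝ → ℝ)
    (hM1 : CondM1 σ ν) (hM2 : CondM2 σ ν)
    (hj_meas : ∀ x : Eucl N, Measurable (j x))
    (hj_cont : ∀ z : Eucl N, Continuous (fun x => j x z))
    (hj_per : ∀ z : Eucl N, ZPeriodic (fun x => j x z))
    (hJ1 : CondJ1 j) (hJ2 : CondJ2 ν j) (hcov : Covering ν j)
    (hH_per : ∀ p : Eucl N, ZPeriodic (fun x => H x p))
    (hζ₁ : IsModulus ζ₁) (hζ₂ : IsModulus ζ₂)
    (hH0 : CondH0 H) (hH1 : CondH1 m ζ₁ ζ₂ H) (hH2 : CondH2 m H) :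
    (∃! c : ℝ, ∃ w : Eucl N → ℝ, IsHolder ((m - σ) / m) w ∧ IsErgodicSolution ν j H c w) ∧
    ((∀ x : Eucl N, ContinuousOn (j x) ν.support) →
      Tendsto (fun s : ℝ => ζ₂ s * s ^ ((1 - m) / m)) (𝓝[>] 0) (𝓝 0) →
      ∀ (c : ℝ) (w : Eucl N → ℝ), IsHolder ((m - σ) / m) w → IsErgodicSolution ν j H c w →
        ∀ v : Eucl N → ℝ, Continuous v → IsErgodicSolution ν j H c v →
          ∃ k : ℝ, ∀ x : Eucl N, v x = w x + k) := by
  obtain ⟨hm1, hmσ⟩ := max_lt_iff.1 hm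
  have hm0 : 0 < m := by linarith
  have hγ : 0 < (m - σ) / m := div_pos (by linarith) hm0
  obtain ⟨C, hB⟩ := exists_jumpBounds hσ0 hσ2 hM1 hM2 hj_meas hj_cont hJ1
  have hHc := continuous_hamiltonian hm1 hζ₁ hζ₂ hH1
  obtain ⟨b, E, D, hb, hE, hD, hcoer⟩ := exists_coercive hm1 hζ₂ hζ₁ hH0 hH1 hH2
  obtain ⟨H₀, hH₀, h0⟩ := hH0
  obtain ⟨A, b₀, hA, hb₀, hH2'⟩ := hH2
  -- The exponent σ/m is the one whose drift bound matches the cone gradient; since m > 1 it lies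
  -- below σ, so (M1) gives the power rate.
  have hσm : σ / m < σ := div_lt_self hσ0 hm1
  obtain ⟨C', hC', hdrift⟩ := hM1 (σ / m) (by positivity) (by linarith)
  simp only [levyRate, if_pos hσm] at hdrift
  obtain ⟨Λ, hΛ, hctrl⟩ := holder_constant_bound hB hm1 hmσ hC'.le hdrift hb hE hD hcoer hH₀.le
    (show 0 ≤ cellRadius N by linarith [one_le_cellRadius (N := N)])
  have hle : ∀ {c₁ c₂ : ℝ} {w₁ w₂ : Eucl N → ℝ}, IsHolder ((m - σ) / m) w₁ →
      IsErgodicSolution ν j H c₁ w₁ → IsHolder ((m - σ) / m) w₂ →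
      IsErgodicSolution ν j H c₂ w₂ → c₁ ≤ c₂ := fun hw₁ h₁ hw₂ h₂ =>
    ergodic_constant_le hB hJ2 hm1 hζ₁ hζ₂ hH1 hb₀ hH2' (hw₁.continuous hγ) (hw₂.continuous hγ)
      h₁.1 h₂.1 (jetSub_of_isViscSubsolution hB h₁.2.1) (jetSuper_of_isViscSupersolution hB h₂.2.2)
  constructor
  · obtain ⟨c, w, hw, hsol⟩ := exists_ergodic_pair hB hHc hj_per hH_per h0 hm1 hmσ hΛ hctrl
    refine ⟨c, ⟨w, hw, hsol⟩, ?_⟩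
    rintro c' ⟨w', hw', hsol'⟩
    exact le_antisymm (hle hw' hsol' hw hsol) (hle hw hsol hw' hsol')
  · intro hjs hrate c w hw hsol v hv hsolv
    have hwc := hw.continuous hγ
    obtain ⟨Mw, hMw⟩ := hsol.1.exists_bound hwc
    obtain ⟨Mv, hMv⟩ := hsolv.1.exists_bound hv
    obtain ⟨x₀, hx₀⟩ := ZPeriodic.exists_max (u := fun x => w x - v x) (hwc.sub hv)
      (fun k x => by simp only [hsol.1 k x, hsolv.1 k x])
    -- Each reached point is again a global maximum of w - v, so `max_of_jump` can be applied anew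
    -- from it.
    have hreach : ∀ n, ∀ y ∈ reachable ν j x₀ n, w y - v y = w x₀ - v x₀ := by
      intro n
      induction n with
      | zero => rintro y rfl; rfl
      | succ n ih =>
        intro y hy
        obtain ⟨ξ, hξ, z, hz, rfl⟩ := mem_iUnion₂.1 hy
        have hξ' := ih ξ hξ
        have := max_of_jump hB hJ2 hm1 hζ₁ hζ₂ hH1 hb₀ hH2' hrate hjs hwc hv hMw hMv
          (jetSub_of_isViscSubsolution hB hsol.2.1) (jetSuper_of_isViscSupersolution hB hsolv.2.2)
          (x₀ := ξ) (fun x => by rw [hξ']; exact hx₀ x) hz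
        exact this.trans hξ'
    have hclosed : IsClosed {y | w y - v y = w x₀ - v x₀} :=
      isClosed_eq (hwc.sub hv) continuous_const
    have hsubset : closure {y : Eucl N | ∃ k : Fin N → ℤ,
        y + latticePoint k ∈ ⋃ n, reachable ν j x₀ n} ⊆ {y | w y - v y = w x₀ - v x₀} := by
      refine closure_minimal ?_ hclosed
      rintro y ⟨k, hk⟩
      obtain ⟨n, hn⟩ := mem_iUnion.1 hk
      have := hreach n _ hn
      rwa [hsol.1 k y, hsolv.1 k y] at this
    rw [hcov x₀] at hsubset
    refine ⟨-(w x₀ - v x₀), fun x => ?_⟩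
    have : w x - v x = w x₀ - v x₀ := hsubset (mem_univ x)
    linarith
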